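/- Throughout, a plane graph is a finite connected plane graph with at least one edge (loops and multiple edges are allowed). It is given by its combinatorial embedding, i.e. for every edge and each of its two directions (darts) the counterclockwise next dart around the vertex at which it starts, together with a dart that has the outer face on its left. The input string lists this data, with darts numbered $0,\dots,2m-1$ ($m$ the number of edges) and numbers written in unary, so its length is polynomial in $m$. The angles of $G$ are the pairs of rotationally consecutive darts at a vertex (one angle for a vertex of degree one); each edge is incident to two angles at each of its endpoints, one on each side. A weak labeling of a plane graph $G$ is a map from the angles of $G$ to $\{0,1\}$ such that (G0) there are two distinct special vertices $s_0,s_1$ on the outer face such that all angles incident to $s_i$ are labeled $i$; (G1) around each vertex $v\notin\{s_0,s_1\}$ the labels form, cyclically, a non-empty interval of $1$s and a non-empty interval of $0$s; (G2) for each edge, the incident labels coincide at one endpoint and differ at the other; (G3) for each face (including the outer face) its labels form, cyclically, a non-empty interval of $1$s and a non-empty interval of $0$s. If the vertices of $G$ are properly colored white and black, a generalized strong labeling of $G$ is a map from the angles to $\{0,1\}$ satisfying (G0), (G1) and (G2$^+$) for each edge, traversed from its white to its black end, either the labels coincide at exactly one endpoint, coincide on the right side and differ on the left side, or the labels differ at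 both endpoints and on both sides (six patterns in all); (G3$^+$) each face has exactly one pair of adjacent $0$-labels and exactly one pair of adjacent $1$-labels, where pairs are counted along the edges of the boundary walk; in addition, the edge on the outer face which contains $s_0$ and which has the outer face to its right when traversed from its white to its black end has two labels $0$ in the outer face. Theorem. (a) Plane graphs admitting a weak labeling can be recognized in polynomial time: there is a Turing machine that, given any plane graph $G$, decides in a number of steps bounded by a polynomial in the input length whether $G$ admits a weak labeling. (b) Likewise, plane graphs with a given proper white/black coloring of the vertices (whose input also lists, for each edge, the color of the endpoint at which its first dart starts) that admit a generalized strong labeling can be recognized in polynomial time. -/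

import Mathlib

/-- The number of cycles of a permutation (fixed points count as cycles). -/
noncomputable def cycleCount {α : Type} (f : Equiv.Perm α) : ℕ :=
  Nat.card (Quotient (Equiv.Perm.SameCycle.setoid f))

/-- Every edge `e` among `m` edges consists of two darts (directed half-edges), `(e, false)` and
`(e, true)`; `dartRev` exchanges them. -/
def dartRev (m : ℕ) : Equiv.Perm (Fin m × Bool) :=
  (Equiv.refl (Fin m)).prodCongr Equiv.boolNot

/-- A finite connected plane graph with at least one edge (loops and multiple edges are allowed),
given by its combinatorial embedding (rotation system) and its outer face. `next d` is the next
dart after `d` in counterclockwise order around the vertex at which `d` starts, so the vertices are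
the cycles of `next`. The boundary walk of the face to the left of `d` continues, after `d`, with
the dart `next⁻¹ (dartRev d)`, so the faces are the cycles of `next⁻¹ * dartRev`. The outer face is
the one to the left of the dart `outer`. By Euler's formula the embedding is plane iff
`#vertices - #edges + #faces = 2`. -/
structure PlaneGraph where
  numEdges : ℕ
  next : Equiv.Perm (Fin numEdges × Bool)
  outer : Fin numEdges × Bool
  connected : ∀ x y : Fin numEdges × Bool,
    ∃ g ∈ Subgroup.closure {next, dartRev numEdges}, g x = y
  euler : cycleCount next + cycleCount (next⁻¹ * dartRev numEdges) = numEdges + 2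

namespace PlaneGraph

/-- The darts of `G`. They also serve as names of its angles: the angle `d` is the angle, at the
vertex where `d` starts, between `d` and the dart `next d`. It lies in the face to the left
of `d`. -/
abbrev Dart (G : PlaneGraph) : Type := Fin G.numEdges × Bool

/-- The same edge traversed in the opposite direction. -/
def rev (G : PlaneGraph) : Equiv.Perm G.Dart := dartRev G.numEdges

/-- The next dart (or angle) along the boundary walk of the face to the left of a dart. -/
def faceNext (G : PlaneGraph) : Equiv.Perm G.Dart := G.next⁻¹ * G.rev

/-- The vertices of `G`. -/
abbrev Vertex (G : PlaneGraph) : Type := Quotient (Equiv.Perm.SameCycle.setoid G.next)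

/-- The vertex at which a dart starts; the vertex to which an angle is incident. -/
def origin (G : PlaneGraph) (d : G.Dart) : G.Vertex := Quotient.mk _ d

/-- The angle `d` belongs to the outer face (equivalently: the outer face is to the left
of the dart `d`). -/
def InOuterFace (G : PlaneGraph) (d : G.Dart) : Prop := G.faceNext.SameCycle G.outer d

/-- The vertex `v` is on the outer face. -/
def OnOuterFace (G : PlaneGraph) (v : G.Vertex) : Prop := ∃ d, G.InOuterFace d ∧ G.origin d = v

/-! The four angles incident to the edge of a dart `d` are `d` (at the start of `d`, left of `d`),
`next⁻¹ d` (at the start, right), `faceNext d` (at the end, left) and `rev d` (at the end, right).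
Labels are Booleans, with `false` for the label `0` and `true` for the label `1`. -/

/-- The two labels incident to the edge of `d` at the start of `d` coincide. -/
def CoincideAtOrigin (G : PlaneGraph) (ℓ : G.Dart → Bool) (d : G.Dart) : Prop :=
  ℓ d = ℓ (G.next⁻¹ d)

/-- The two labels incident to the edge of `d` on the left side of `d` coincide. -/
def CoincideOnLeft (G : PlaneGraph) (ℓ : G.Dart → Bool) (d : G.Dart) : Prop :=
  ℓ d = ℓ (G.faceNext d)

/-- Read along the cycle of `f` that contains `x`, the labels form a non-empty interval of `0`s
followed by a non-empty interval of `1`s. -/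
def TwoIntervals {α : Type} (f : Equiv.Perm α) (ℓ : α → Bool) (x : α) : Prop :=
  ∃ y, f.SameCycle x y ∧ ∃ a b : ℕ, 0 < a ∧ 0 < b ∧ a + b = Function.minimalPeriod f y ∧
    (∀ i < a, ℓ (f^[i] y) = false) ∧ (∀ i < b, ℓ (f^[a + i] y) = true)

/-- Special vertices: `s₀ ≠ s₁` lie on the outer face and all angles incident to `sᵢ` are
labeled `i`. -/
def SpecialVertices (G : PlaneGraph) (s₀ s₁ : G.Vertex) (ℓ : G.Dart → Bool) : Prop :=
  s₀ ≠ s₁ ∧ G.OnOuterFace s₀ ∧ G.OnOuterFace s₁ ∧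
    (∀ d, G.origin d = s₀ → ℓ d = false) ∧ (∀ d, G.origin d = s₁ → ℓ d = true)

/-- Vertex rule: around every non-special vertex the labels form a non-empty interval of `1`s and a
non-empty interval of `0`s. -/
def VertexRule (G : PlaneGraph) (s₀ s₁ : G.Vertex) (ℓ : G.Dart → Bool) : Prop :=
  ∀ d, G.origin d ≠ s₀ → G.origin d ≠ s₁ → TwoIntervals G.next ℓ d

/-- Edge rule: the labels incident to an edge coincide at one endpoint and differ at the other. -/
def EdgeRule (G : PlaneGraph) (ℓ : G.Dart → Bool) : Prop :=
  ∀ d, Xor (G.CoincideAtOrigin ℓ d) (G.CoincideAtOrigin ℓ (G.rev d))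

/-- Face rule: in every face, the outer one included, the labels form a non-empty interval of `1`s
and a non-empty interval of `0`s. -/
def FaceRule (G : PlaneGraph) (ℓ : G.Dart → Bool) : Prop :=
  ∀ d, TwoIntervals G.faceNext ℓ d

/-- `ℓ` is a weak labeling of `G` with special vertices `s₀` and `s₁`. -/
structure IsWeakLabeling (G : PlaneGraph) (s₀ s₁ : G.Vertex) (ℓ : G.Dart → Bool) : Prop where
  special : G.SpecialVertices s₀ s₁ ℓ
  vertexRule : G.VertexRule s₀ s₁ ℓ
  edgeRule : G.EdgeRule ℓ
  faceRule : G.FaceRule ℓ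

def AdmitsWeakLabeling (G : PlaneGraph) : Prop :=
  ∃ s₀ s₁ ℓ, G.IsWeakLabeling s₀ s₁ ℓ

end PlaneGraph

/-- A plane graph together with a proper 2-coloring of its vertices, white (`true`) and
black (`false`). -/
structure BipartitePlaneGraph extends PlaneGraph where
  white : toPlaneGraph.Vertex → Bool
  proper : ∀ d, white (toPlaneGraph.origin d) ≠ white (toPlaneGraph.origin (toPlaneGraph.rev d))

namespace BipartitePlaneGraph

/-- Extended edge rule. Traverse the edge from its white to its black endpoint. In the four
unidirected patterns, the labels coincide at exactly one endpoint, coincide on the right side and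
differ on the left side; in the two bidirected patterns, they differ at both endpoints and on both
sides. -/
def ExtendedEdgeRule (G : BipartitePlaneGraph) (ℓ : G.Dart → Bool) : Prop :=
  ∀ d, G.white (G.origin d) = true →
    (Xor (G.CoincideAtOrigin ℓ d) (G.CoincideAtOrigin ℓ (G.rev d)) ∧
        G.CoincideOnLeft ℓ (G.rev d) ∧ ¬ G.CoincideOnLeft ℓ d) ∨
      (¬ G.CoincideAtOrigin ℓ d ∧ ¬ G.CoincideAtOrigin ℓ (G.rev d) ∧
        ¬ G.CoincideOnLeft ℓ (G.rev d) ∧ ¬ G.CoincideOnLeft ℓ d)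

/-- Strong face rule: each face has exactly one pair of adjacent `0`-labels and exactly one pair of
adjacent `1`-labels. In addition, the edge on the outer face which contains `s₀` and which has the
outer face to its right when traversed from its white to its black end (hence to its left when
traversed, as the dart `d`, from black to white) has two labels `0` in the outer face. -/
def StrongFaceRule (G : BipartitePlaneGraph) (s₀ : G.Vertex) (ℓ : G.Dart → Bool) : Prop :=
  (∀ d, ∀ i : Bool, ∃! y, G.faceNext.SameCycle d y ∧ ℓ y = i ∧ ℓ (G.faceNext y) = i) ∧
    ∀ d, G.InOuterFace d → G.white (G.origin d) = false →
      (G.origin d = s₀ ∨ G.origin (G.rev d) = s₀) → ℓ d = false ∧ ℓ (G.faceNext d) = false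

/-- `ℓ` is a generalized strong labeling of `G` with special vertices `s₀` and `s₁`. -/
structure IsGeneralizedStrongLabeling (G : BipartitePlaneGraph) (s₀ s₁ : G.Vertex)
    (ℓ : G.Dart → Bool) : Prop where
  special : G.SpecialVertices s₀ s₁ ℓ
  vertexRule : G.VertexRule s₀ s₁ ℓ
  extendedEdgeRule : G.ExtendedEdgeRule ℓ
  strongFaceRule : G.StrongFaceRule s₀ ℓ

def AdmitsGeneralizedStrongLabeling (G : BipartitePlaneGraph) : Prop :=
  ∃ s₀ s₁ ℓ, G.IsGeneralizedStrongLabeling s₀ s₁ ℓ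

end BipartitePlaneGraph

/-- The unary code of a number, a block of `true`s closed by `false`. -/
def unaryCode (k : ℕ) : List Bool := List.replicate k true ++ [false]

/-- The code of the dart `(e, b)`: the number `2 e + b` in unary. -/
def dartCode {m : ℕ} (d : Fin m × Bool) : List Bool := unaryCode (2 * d.1 + d.2.toNat)

/-- The bit string that is given to a machine as the plane graph `G`: the dart that marks the outer
face, and for every edge the counterclockwise successors of its two darts. With `m` edges its length
is at most `2 m (2 m + 1)`. -/
def PlaneGraph.encode (G : PlaneGraph) : List Bool :=
  dartCode G.outer ++ (List.finRange G.numEdges).flatMap fun e =>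
    dartCode (G.next (e, false)) ++ dartCode (G.next (e, true))

/-- As for plane graphs, with the color of the start of `(e, false)` before the data of the
edge `e`. -/
def BipartitePlaneGraph.encode (G : BipartitePlaneGraph) : List Bool :=
  dartCode G.outer ++ (List.finRange G.numEdges).flatMap fun e =>
    G.white (G.origin (e, false)) ::
      (dartCode (G.next (e, false)) ++ dartCode (G.next (e, true)))

open Classical in
/-- The property `P` of objects, given to the machine as bit strings by `enc`, is decided by a
Turing machine whose number of steps is at most a polynomial in the length of the input. -/
def PolyTimeRecognizable {α : Type} (enc : α → List Bool) (P : α → Prop) : Prop :=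
  Nonempty (Turing.TM2ComputableInPolyTime enc Computability.encodeBool fun a => decide (P a))

/-! Record a labeling by its changes: `S d` tells whether the labels differ across the dart `d` at
its origin, and `T d` whether they differ along its left side. The interval rules only count changes
(`twoIntervals_iff`): two around every face and every ordinary vertex, none around a special vertex.
The edge rule says that `S` picks exactly one dart of every edge, and then `T` does so as well,
because the four changes around an edge sum to zero modulo 2.

Conversely, changes that are even in number around every vertex, face and edge come from a labeling.
This is the vanishing of the first cohomology of the sphere modulo 2; `exists_potential` obtains it
from connectedness and Euler's formula by comparing dimensions. Hence `S` and `T` can be chosen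
independently. The two special vertices get different labels iff each of the two boundary parts of
the outer face between them contains one of its two changes. Once the special vertices are guessed,
a weak labeling therefore amounts to two problems of the same kind (`admitsWeakLabeling_iff`):
select one dart of every edge, with prescribed numbers in the classes of a partition of the darts.

For generalized strong labelings every edge has three possible events: a change at either end, and
no change on the left of its dart from black to white. The six patterns are those in which exactly
one event fails. The demands are two events at every face and every ordinary vertex and none at
special vertices; all other clauses follow from the 2-coloring
(`admitsGeneralizedStrongLabeling_iff`).

Such a selection is a system of distinct representatives (`solvable_iff`). An auction with unit bids
decides whether there is one (`hasSDR_iff`): if there is, Hall's condition keeps the prices low, so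
the auction ends after quadratically many bids.

For the Turing machines, a small structured stack language is compiled to `FinTM2` (`Run.steps`). On
top of it, `PolyTime` is a class of functions on tree-coded data that is closed under composition,
pairing, branching and folds of bounded size. The decision procedures are ordinary list functions,
whose membership in this class follows their definitions. -/

/-! ### Structured stack programs and their compilation to `FinTM2` -/

/-- Structured programs that work on four stacks of bits. -/
inductive Prog
  | skip
  /-- push the bit `b` on stack `k` -/
  | push (k : Fin 4) (b : Bool)
  | seq (p q : Prog)
  /-- pop stack `k` and branch: top bit `0`, top bit `1`, stack empty -/
  | case (k : Fin 4) (p₀ p₁ p₂ : Prog)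
  /-- as long as a bit `1` can be popped from stack `k`, run `p` -/
  | loop (k : Fin 4) (p : Prog)

namespace Prog

abbrev Stacks : Type := Fin 4 → List Bool

/-- `Run p S T t`: the program `p` transforms the stacks `S` into `T` in `t` steps. -/
inductive Run : Prog → Stacks → Stacks → ℕ → Prop
  | skip (S) : Run skip S S 1
  | push (k b S) : Run (push k b) S (Function.update S k (b :: S k)) 1
  | seq {p q S T U t u} : Run p S T t → Run q T U u → Run (seq p q) S U (t + u)
  | case_false {k p₀ p₁ p₂ S T t l} : S k = false :: l → Run p₀ (Function.update S k l) T t →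
      Run (case k p₀ p₁ p₂) S T (t + 1)
  | case_true {k p₀ p₁ p₂ S T t l} : S k = true :: l → Run p₁ (Function.update S k l) T t →
      Run (case k p₀ p₁ p₂) S T (t + 1)
  | case_nil {k p₀ p₁ p₂ S T t} : S k = [] → Run p₂ S T t → Run (case k p₀ p₁ p₂) S T (t + 1)
  -- No rule covers a `0` on top of stack `k`. The compiled code would leave the loop, but the
  -- programs below loop only on stack `3`, which never contains anything but `1`s.
  | loop_true {k p S T U t u l} : S k = true :: l → Run p (Function.update S k l) T t →
      Run (loop k p) T U u → Run (loop k p) S U (u + t + 1)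
  | loop_nil {k p S} : S k = [] → Run (loop k p) S S 1

/-- The labels of the machine code of a program. -/
def Label : Prog → Type
  | skip => Unit
  | push _ _ => Unit
  | seq p q => Label p ⊕ Label q
  | case _ p₀ p₁ p₂ => Option (Label p₀ ⊕ Label p₁ ⊕ Label p₂)
  | loop _ p => Option (Label p)

noncomputable instance Label.fintype : ∀ p : Prog, Fintype (Label p)
  | skip => inferInstanceAs (Fintype Unit)
  | push _ _ => inferInstanceAs (Fintype Unit)
  | seq p q =>
    have := Label.fintype p
    have := Label.fintype q
    inferInstanceAs (Fintype (Label p ⊕ Label q))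
  | case _ p₀ p₁ p₂ =>
    have := Label.fintype p₀
    have := Label.fintype p₁
    have := Label.fintype p₂
    inferInstanceAs (Fintype (Option (Label p₀ ⊕ Label p₁ ⊕ Label p₂)))
  | loop _ p =>
    have := Label.fintype p
    inferInstanceAs (Fintype (Option (Label p)))

/-- The label at which the machine code of a program starts. -/
def entry : ∀ p : Prog, Label p
  | skip => ()
  | push _ _ => ()
  | seq p _ => Sum.inl (entry p)
  | case _ _ _ _ => none
  | loop _ _ => none

abbrev Code (Λ : Type) : Type := Turing.TM2.Stmt (fun _ : Fin 4 => Bool) Λ (Option Bool)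

/-- The machine code of a program inside a machine with labels `Λ`, where `emb` places the labels of
the program and `exit` is the label of the continuation. -/
def code {Λ : Type} : ∀ p : Prog, (Label p → Λ) → Λ → Label p → Code Λ
  | skip, _, exit, _ => .goto fun _ => exit
  | push k b, _, exit, _ => .push k (fun _ => b) (.goto fun _ => exit)
  | seq p q, emb, exit, l =>
    match l with
    | Sum.inl l => code p (fun x => emb (Sum.inl x)) (emb (Sum.inr (entry q))) l
    | Sum.inr l => code q (fun x => emb (Sum.inr x)) exit l
  | case k p₀ p₁ p₂, emb, exit, l =>
    match l with
    | none => .pop k (fun _ x => x) (.goto fun v =>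
        match v with
        | some false => emb (some (Sum.inl (entry p₀)))
        | some true => emb (some (Sum.inr (Sum.inl (entry p₁))))
        | none => emb (some (Sum.inr (Sum.inr (entry p₂)))))
    | some (Sum.inl l) => code p₀ (fun x => emb (some (Sum.inl x))) exit l
    | some (Sum.inr (Sum.inl l)) => code p₁ (fun x => emb (some (Sum.inr (Sum.inl x)))) exit l
    | some (Sum.inr (Sum.inr l)) => code p₂ (fun x => emb (some (Sum.inr (Sum.inr x)))) exit l
  | loop k p, emb, exit, l =>
    match l with
    | none => .pop k (fun _ x => x) (.goto fun v =>
        match v with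
        | some true => emb (some (entry p))
        | _ => exit)
    | some l => code p (fun x => emb (some x)) (emb none) l

abbrev Conf (Λ : Type) : Type := Turing.TM2.Cfg (fun _ : Fin 4 => Bool) Λ (Option Bool)

/-- The machine `M` gets from `c` to `c'` in `t` steps. -/
def Steps {Λ : Type} (M : Λ → Code Λ) (t : ℕ) (c c' : Conf Λ) : Prop :=
  (flip bind (Turing.TM2.step M))^[t] (some c) = some c'

theorem Steps.trans {Λ : Type} {M : Λ → Code Λ} {t u : ℕ} {c₁ c₂ c₃ : Conf Λ}
    (h₁ : Steps M t c₁ c₂) (h₂ : Steps M u c₂ c₃) : Steps M (t + u) c₁ c₃ := by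
  unfold Steps at *
  rw [add_comm, Function.iterate_add_apply, h₁, h₂]

theorem Steps.one {Λ : Type} {M : Λ → Code Λ} {l : Λ} {v : Option Bool} {S : Stacks} {c : Conf Λ}
    (h : Turing.TM2.stepAux (M l) v S = c) : Steps M 1 ⟨some l, v, S⟩ c := by
  subst h
  rfl

/-- Induction over the run. The surrounding machine, the placement of the labels and the exit label
are arbitrary, since the code of a subprogram sits inside a larger machine and continues there. The
register only passes on the bit popped last, so its value at the start does not matter. -/
theorem Run.steps {p : Prog} {S T : Stacks} {t : ℕ} (h : Run p S T t) :
    ∀ {Λ : Type} (M : Λ → Code Λ) (emb : Label p → Λ) (exit : Λ),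
      (∀ l, M (emb l) = code p emb exit l) → ∀ v : Option Bool,
        ∃ v', Steps M t ⟨some (emb (entry p)), v, S⟩ ⟨some exit, v', T⟩ := by
  induction h with
  | skip S =>
    intro Λ M emb exit hM v
    exact ⟨v, Steps.one (by rw [hM]; rfl)⟩
  | push k b S =>
    intro Λ M emb exit hM v
    exact ⟨v, Steps.one (by rw [hM]; rfl)⟩
  | @seq p q S T U t u _ _ ihp ihq =>
    intro Λ M emb exit hM v
    obtain ⟨v₁, h₁⟩ := ihp M (fun x => emb (Sum.inl x)) (emb (Sum.inr (entry q)))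
      (fun l => hM (Sum.inl l)) v
    obtain ⟨v₂, h₂⟩ := ihq M (fun x => emb (Sum.inr x)) exit (fun l => hM (Sum.inr l)) v₁
    exact ⟨v₂, h₁.trans h₂⟩
  | @case_false k p₀ p₁ p₂ S T t l hS _ ih =>
    intro Λ M emb exit hM v
    obtain ⟨v₁, h₁⟩ := ih M (fun x => emb (some (Sum.inl x))) exit
      (fun l => hM (some (Sum.inl l))) (some false)
    refine ⟨v₁, ?_⟩
    rw [add_comm]
    refine Steps.trans (Steps.one ?_) h₁
    rw [hM]
    simp [entry, code, hS]
  | @case_true k p₀ p₁ p₂ S T t l hS _ ih =>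
    intro Λ M emb exit hM v
    obtain ⟨v₁, h₁⟩ := ih M (fun x => emb (some (Sum.inr (Sum.inl x)))) exit
      (fun l => hM (some (Sum.inr (Sum.inl l)))) (some true)
    refine ⟨v₁, ?_⟩
    rw [add_comm]
    refine Steps.trans (Steps.one ?_) h₁
    rw [hM]
    simp [entry, code, hS]
  | @case_nil k p₀ p₁ p₂ S T t hS _ ih =>
    intro Λ M emb exit hM v
    obtain ⟨v₁, h₁⟩ := ih M (fun x => emb (some (Sum.inr (Sum.inr x)))) exit
      (fun l => hM (some (Sum.inr (Sum.inr l)))) none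
    refine ⟨v₁, ?_⟩
    rw [add_comm]
    refine Steps.trans (Steps.one ?_) h₁
    rw [hM]
    have : Function.update S k [] = S := by rw [← hS, Function.update_eq_self]
    simp [entry, code, hS, this]
  | @loop_true k p S T U t u l hS _ _ ih₁ ih₂ =>
    intro Λ M emb exit hM v
    obtain ⟨v₁, h₁⟩ := ih₁ M (fun x => emb (some x)) (emb none)
      (fun l => hM (some l)) (some true)
    obtain ⟨v₂, h₂⟩ := ih₂ M emb exit hM v₁
    refine ⟨v₂, ?_⟩
    rw [add_comm, add_comm u]
    refine Steps.trans (Steps.one ?_) (Steps.trans h₁ h₂)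
    rw [hM]
    simp [entry, code, hS]
  | @loop_nil k p S hS =>
    intro Λ M emb exit hM v
    refine ⟨none, Steps.one ?_⟩
    rw [hM]
    have : Function.update S k [] = S := by rw [← hS, Function.update_eq_self]
    simp [entry, code, hS, this]

/-- The stacks with contents `a`, `b`, `c`, `d`. -/
def quad (a b c d : List Bool) : Stacks := ![a, b, c, d]

@[simp] theorem quad_zero (a b c d) : quad a b c d 0 = a := rfl
@[simp] theorem quad_one (a b c d) : quad a b c d 1 = b := rfl
@[simp] theorem quad_two (a b c d) : quad a b c d 2 = c := rfl
@[simp] theorem quad_three (a b c d) : quad a b c d 3 = d := rfl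

@[simp] theorem update_quad_zero (a b c d x) :
    Function.update (quad a b c d) 0 x = quad x b c d := by
  funext i; fin_cases i <;> rfl

@[simp] theorem update_quad_one (a b c d x) :
    Function.update (quad a b c d) 1 x = quad a x c d := by
  funext i; fin_cases i <;> rfl

@[simp] theorem update_quad_two (a b c d x) :
    Function.update (quad a b c d) 2 x = quad a b x d := by
  funext i; fin_cases i <;> rfl

@[simp] theorem update_quad_three (a b c d x) :
    Function.update (quad a b c d) 3 x = quad a b c x := by
  funext i; fin_cases i <;> rfl

/-- The machine that runs the program `p` and halts; stack `0` is for input and output. -/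
noncomputable def machine (p : Prog) : Turing.FinTM2 where
  K := Fin 4
  k₀ := 0
  k₁ := 0
  Γ _ := Bool
  Λ := Option (Label p)
  main := some (entry p)
  σ := Option Bool
  initialState := none
  m l := match l with
    | none => .load (fun _ => none) .halt
    | some l => code p some none l

/-- The one additional step is taken at the label `none`: it resets the register to its initial
value, as the final configuration of a `FinTM2` requires, and halts. -/
theorem Run.outputs {p : Prog} {x y : List Bool} {t : ℕ}
    (h : Run p (quad x [] [] []) (quad y [] [] []) t) :
    Nonempty (Turing.TM2OutputsInTime (machine p) x (some y) (t + 1)) := by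
  obtain ⟨v, hv⟩ := h.steps (machine p).m some none (fun l => rfl) none
  have hfin : Steps (machine p).m 1 ⟨some none, v, quad y [] [] []⟩
      ⟨none, none, quad y [] [] []⟩ := rfl
  have hstk : ∀ z : List Bool, quad z [] [] [] = fun k => if k = (0 : Fin 4) then z else [] := by
    intro z
    funext i
    fin_cases i <;> rfl
  refine ⟨⟨⟨t + 1, ?_⟩, le_rfl⟩⟩
  have key := hv.trans hfin
  rw [hstk x, hstk y] at key
  exact key

end Prog

/-! ### Basic programs on binary trees in prefix code -/

/-- Binary trees, the data on which programs work. -/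
inductive BinTree
  | leaf
  | node (x y : BinTree)

namespace BinTree

/-- The prefix code of a binary tree. -/
def bits : BinTree → List Bool
  | leaf => [false]
  | node x y => true :: (bits x ++ bits y)

theorem length_bits_pos (x : BinTree) : 0 < x.bits.length := by
  cases x <;> simp [bits]

end BinTree

namespace Prog

/-- The program `p` transforms the stacks `S` into `T` in at most `n` steps. -/
def RunLe (p : Prog) (S T : Stacks) (n : ℕ) : Prop := ∃ t ≤ n, Run p S T t

theorem RunLe.mono {p : Prog} {S T : Stacks} {n n' : ℕ} (h : RunLe p S T n) (hn : n ≤ n') :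
    RunLe p S T n' :=
  let ⟨t, ht, hr⟩ := h
  ⟨t, ht.trans hn, hr⟩

theorem runLe_skip (S : Stacks) : RunLe skip S S 1 := ⟨1, le_rfl, .skip S⟩

theorem RunLe.seq {p q : Prog} {S T U : Stacks} {n m : ℕ} (h₁ : RunLe p S T n)
    (h₂ : RunLe q T U m) : RunLe (.seq p q) S U (n + m) :=
  let ⟨_, ht, hr⟩ := h₁
  let ⟨_, hu, hs⟩ := h₂
  ⟨_, add_le_add ht hu, .seq hr hs⟩

section
variable {a b c d : List Bool} {p₀ p₁ p₂ : Prog} {T U : Stacks} {n m : ℕ}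

theorem push_zero (x : Bool) : RunLe (push 0 x) (quad a b c d) (quad (x :: a) b c d) 1 :=
  ⟨1, le_rfl, by simpa using Run.push 0 x (quad a b c d)⟩

theorem push_one (x : Bool) : RunLe (push 1 x) (quad a b c d) (quad a (x :: b) c d) 1 :=
  ⟨1, le_rfl, by simpa using Run.push 1 x (quad a b c d)⟩

theorem push_two (x : Bool) : RunLe (push 2 x) (quad a b c d) (quad a b (x :: c) d) 1 :=
  ⟨1, le_rfl, by simpa using Run.push 2 x (quad a b c d)⟩

theorem push_three (x : Bool) : RunLe (push 3 x) (quad a b c d) (quad a b c (x :: d)) 1 :=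
  ⟨1, le_rfl, by simpa using Run.push 3 x (quad a b c d)⟩

theorem case_zero_false (h : RunLe p₀ (quad a b c d) T n) :
    RunLe (case 0 p₀ p₁ p₂) (quad (false :: a) b c d) T (n + 1) :=
  let ⟨_, ht, hr⟩ := h
  ⟨_, Nat.succ_le_succ ht, .case_false (l := a) rfl (by simpa using hr)⟩

theorem case_zero_true (h : RunLe p₁ (quad a b c d) T n) :
    RunLe (case 0 p₀ p₁ p₂) (quad (true :: a) b c d) T (n + 1) :=
  let ⟨_, ht, hr⟩ := h
  ⟨_, Nat.succ_le_succ ht, .case_true (l := a) rfl (by simpa using hr)⟩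

theorem case_zero_nil (h : RunLe p₂ (quad [] b c d) T n) :
    RunLe (case 0 p₀ p₁ p₂) (quad [] b c d) T (n + 1) :=
  let ⟨_, ht, hr⟩ := h
  ⟨_, Nat.succ_le_succ ht, .case_nil rfl hr⟩

theorem case_one_false (h : RunLe p₀ (quad a b c d) T n) :
    RunLe (case 1 p₀ p₁ p₂) (quad a (false :: b) c d) T (n + 1) :=
  let ⟨_, ht, hr⟩ := h
  ⟨_, Nat.succ_le_succ ht, .case_false (l := b) rfl (by simpa using hr)⟩

theorem case_one_true (h : RunLe p₁ (quad a b c d) T n) :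
    RunLe (case 1 p₀ p₁ p₂) (quad a (true :: b) c d) T (n + 1) :=
  let ⟨_, ht, hr⟩ := h
  ⟨_, Nat.succ_le_succ ht, .case_true (l := b) rfl (by simpa using hr)⟩

theorem case_one_nil (h : RunLe p₂ (quad a [] c d) T n) :
    RunLe (case 1 p₀ p₁ p₂) (quad a [] c d) T (n + 1) :=
  let ⟨_, ht, hr⟩ := h
  ⟨_, Nat.succ_le_succ ht, .case_nil rfl hr⟩

theorem case_two_false (h : RunLe p₀ (quad a b c d) T n) :
    RunLe (case 2 p₀ p₁ p₂) (quad a b (false :: c) d) T (n + 1) :=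
  let ⟨_, ht, hr⟩ := h
  ⟨_, Nat.succ_le_succ ht, .case_false (l := c) rfl (by simpa using hr)⟩

theorem case_two_true (h : RunLe p₁ (quad a b c d) T n) :
    RunLe (case 2 p₀ p₁ p₂) (quad a b (true :: c) d) T (n + 1) :=
  let ⟨_, ht, hr⟩ := h
  ⟨_, Nat.succ_le_succ ht, .case_true (l := c) rfl (by simpa using hr)⟩

theorem case_two_nil (h : RunLe p₂ (quad a b [] d) T n) :
    RunLe (case 2 p₀ p₁ p₂) (quad a b [] d) T (n + 1) :=
  let ⟨_, ht, hr⟩ := h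
  ⟨_, Nat.succ_le_succ ht, .case_nil rfl hr⟩

theorem loop_three_true (h : RunLe p₀ (quad a b c d) T n) (h' : RunLe (loop 3 p₀) T U m) :
    RunLe (loop 3 p₀) (quad a b c (true :: d)) U (n + m + 1) :=
  let ⟨_, ht, hr⟩ := h
  let ⟨_, hu, hs⟩ := h'
  have hle : ∀ {t u : ℕ}, t ≤ n → u ≤ m → u + t + 1 ≤ n + m + 1 := by omega
  ⟨_, hle ht hu, .loop_true (l := d) rfl (by simpa using hr) hs⟩

theorem loop_three_nil : RunLe (loop 3 p₀) (quad a b c []) (quad a b c []) 1 :=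
  ⟨1, le_rfl, .loop_nil rfl⟩

end

/-- Move the tree on top of stack `0` to stack `k`, reversed. -/
def moveTree (k : Fin 4) : Prog :=
  seq (push 3 true) (loop 3 (case 0 (push k false)
    (seq (push k true) (seq (push 3 true) (push 3 true))) skip))

/-- Stack `3` counts the trees still to be read: every bit read settles one of them, and an inner
node opens two new ones. The rest of the loop is a hypothesis, in the manner of a continuation, so
that the induction can treat the two subtrees of a node one after the other. -/
theorem moveTree_one_aux (x : BinTree) : ∀ {a b c d : List Bool} {U : Stacks} {m : ℕ},
    RunLe (loop 3 (case 0 (push 1 false)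
      (seq (push 1 true) (seq (push 3 true) (push 3 true))) skip))
        (quad a (x.bits.reverse ++ b) c d) U m →
    RunLe (loop 3 (case 0 (push 1 false)
      (seq (push 1 true) (seq (push 3 true) (push 3 true))) skip))
        (quad (x.bits ++ a) b c (true :: d)) U (5 * x.bits.length + m) := by
  induction x with
  | leaf =>
    intro a b c d U m h
    exact (loop_three_true (case_zero_false (push_one _)) h).mono (by simp [BinTree.bits])
  | node x y ihx ihy =>
    intro a b c d U m h
    have h' := ihx (a := y.bits ++ a) (b := true :: b) (c := c) (d := true :: d) (ihy (by
      simpa [BinTree.bits] using h))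
    refine (loop_three_true (T := quad (x.bits ++ (y.bits ++ a)) (true :: b) c
      (true :: true :: d)) ?_ h').mono ?_ (n := 4 + _ + 1)
    · simpa [BinTree.bits] using
        case_zero_true ((push_one true).seq ((push_three true).seq (push_three true)))
    · simp only [BinTree.bits, List.length_cons, List.length_append]
      omega

theorem moveTree_one (x : BinTree) {a b c : List Bool} :
    RunLe (moveTree 1) (quad (x.bits ++ a) b c []) (quad a (x.bits.reverse ++ b) c [])
      (5 * x.bits.length + 2) :=
  ((push_three true).seq (moveTree_one_aux x loop_three_nil)).mono (by omega)

theorem moveTree_two_aux (x : BinTree) : ∀ {a b c d : List Bool} {U : Stacks} {m : ℕ},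
    RunLe (loop 3 (case 0 (push 2 false)
      (seq (push 2 true) (seq (push 3 true) (push 3 true))) skip))
        (quad a b (x.bits.reverse ++ c) d) U m →
    RunLe (loop 3 (case 0 (push 2 false)
      (seq (push 2 true) (seq (push 3 true) (push 3 true))) skip))
        (quad (x.bits ++ a) b c (true :: d)) U (5 * x.bits.length + m) := by
  induction x with
  | leaf =>
    intro a b c d U m h
    exact (loop_three_true (case_zero_false (push_two _)) h).mono (by simp [BinTree.bits])
  | node x y ihx ihy =>
    intro a b c d U m h
    have h' := ihx (a := y.bits ++ a) (b := b) (c := true :: c) (d := true :: d) (ihy (by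
      simpa [BinTree.bits] using h))
    refine (loop_three_true (T := quad (x.bits ++ (y.bits ++ a)) b (true :: c)
      (true :: true :: d)) ?_ h').mono ?_ (n := 4 + _ + 1)
    · simpa [BinTree.bits] using
        case_zero_true ((push_two true).seq ((push_three true).seq (push_three true)))
    · simp only [BinTree.bits, List.length_cons, List.length_append]
      omega

theorem moveTree_two (x : BinTree) {a b c : List Bool} :
    RunLe (moveTree 2) (quad (x.bits ++ a) b c []) (quad a b (x.bits.reverse ++ c) [])
      (5 * x.bits.length + 2) :=
  ((push_three true).seq (moveTree_two_aux x loop_three_nil)).mono (by omega)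

/-- Empty stack `k`, running `f b` for every popped bit `b`. -/
def pourBody (k : Fin 4) (f : Bool → Prog) : Prog :=
  case k (seq (f false) (push 3 true)) (seq (f true) (push 3 true)) skip

def pour (k : Fin 4) (f : Bool → Prog) : Prog := seq (push 3 true) (loop 3 (pourBody k f))

/-- A loop that pours stack `0`, when the effect of the bit `x` on the stacks `1`, `2` is `g x`. -/
theorem pour_zero {f : Bool → Prog} {g : Bool → List Bool × List Bool → List Bool × List Bool}
    {n : ℕ} (hf : ∀ x a b c, RunLe (f x) (quad a b c [])
      (quad a (g x (b, c)).1 (g x (b, c)).2 []) n) (l b c : List Bool) :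
    RunLe (pour 0 f) (quad l b c []) (quad [] (l.foldl (fun s x => g x s) (b, c)).1
      (l.foldl (fun s x => g x s) (b, c)).2 []) ((n + 3) * l.length + 5) := by
  have key : ∀ (l b c : List Bool), RunLe (loop 3 (pourBody 0 f)) (quad l b c [true])
      (quad [] (l.foldl (fun s x => g x s) (b, c)).1 (l.foldl (fun s x => g x s) (b, c)).2 [])
      ((n + 3) * l.length + 4) := by
    intro l
    induction l with
    | nil =>
      intro b c
      exact (loop_three_true (case_zero_nil (runLe_skip _)) loop_three_nil).mono (by simp)
    | cons x l ih =>
      intro b c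
      refine (loop_three_true (n := n + 1 + 1) ?_ (ih (g x (b, c)).1 (g x (b, c)).2)).mono ?_
      · cases x
        · exact case_zero_false ((hf _ _ _ _).seq (push_three true))
        · exact case_zero_true ((hf _ _ _ _).seq (push_three true))
      · simp only [List.length_cons]
        ring_nf
        omega
  exact ((push_three true).seq (key l b c)).mono (by omega)

theorem pour_one {f : Bool → Prog} {g : Bool → List Bool × List Bool → List Bool × List Bool}
    {n : ℕ} (hf : ∀ x a b c, RunLe (f x) (quad a b c [])
      (quad (g x (a, c)).1 b (g x (a, c)).2 []) n) (l a c : List Bool) :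
    RunLe (pour 1 f) (quad a l c []) (quad (l.foldl (fun s x => g x s) (a, c)).1 []
      (l.foldl (fun s x => g x s) (a, c)).2 []) ((n + 3) * l.length + 5) := by
  have key : ∀ (l a c : List Bool), RunLe (loop 3 (pourBody 1 f)) (quad a l c [true])
      (quad (l.foldl (fun s x => g x s) (a, c)).1 [] (l.foldl (fun s x => g x s) (a, c)).2 [])
      ((n + 3) * l.length + 4) := by
    intro l
    induction l with
    | nil =>
      intro b c
      exact (loop_three_true (case_one_nil (runLe_skip _)) loop_three_nil).mono (by simp)
    | cons x l ih =>
      intro b c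
      refine (loop_three_true (n := n + 1 + 1) ?_ (ih (g x (b, c)).1 (g x (b, c)).2)).mono ?_
      · cases x
        · exact case_one_false ((hf _ _ _ _).seq (push_three true))
        · exact case_one_true ((hf _ _ _ _).seq (push_three true))
      · simp only [List.length_cons]
        ring_nf
        omega
  exact ((push_three true).seq (key l a c)).mono (by omega)

theorem pour_two {f : Bool → Prog} {g : Bool → List Bool × List Bool → List Bool × List Bool}
    {n : ℕ} (hf : ∀ x a b c, RunLe (f x) (quad a b c [])
      (quad (g x (a, b)).1 (g x (a, b)).2 c []) n) (l a b : List Bool) :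
    RunLe (pour 2 f) (quad a b l []) (quad (l.foldl (fun s x => g x s) (a, b)).1
      (l.foldl (fun s x => g x s) (a, b)).2 [] []) ((n + 3) * l.length + 5) := by
  have key : ∀ (l a b : List Bool), RunLe (loop 3 (pourBody 2 f)) (quad a b l [true])
      (quad (l.foldl (fun s x => g x s) (a, b)).1 (l.foldl (fun s x => g x s) (a, b)).2 [] [])
      ((n + 3) * l.length + 4) := by
    intro l
    induction l with
    | nil =>
      intro b c
      exact (loop_three_true (case_two_nil (runLe_skip _)) loop_three_nil).mono (by simp)
    | cons x l ih =>
      intro b c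
      refine (loop_three_true (n := n + 1 + 1) ?_ (ih (g x (b, c)).1 (g x (b, c)).2)).mono ?_
      · cases x
        · exact case_two_false ((hf _ _ _ _).seq (push_three true))
        · exact case_two_true ((hf _ _ _ _).seq (push_three true))
      · simp only [List.length_cons]
        ring_nf
        omega
  exact ((push_three true).seq (key l a b)).mono (by omega)

theorem foldl_push_fst {α : Type} (l a : List Bool) (c : α) :
    l.foldl (fun (s : List Bool × α) x => (x :: s.1, s.2)) (a, c) = (l.reverse ++ a, c) := by
  induction l generalizing a with
  | nil => rfl
  | cons x l ih => simp [ih]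

theorem foldl_push_both (l a c : List Bool) :
    l.foldl (fun (s : List Bool × List Bool) x => (x :: s.1, x :: s.2)) (a, c) =
      (l.reverse ++ a, l.reverse ++ c) := by
  induction l generalizing a c with
  | nil => rfl
  | cons x l ih => simp [ih]

theorem pour_zero_one (l b c : List Bool) :
    RunLe (pour 0 (push 1)) (quad l b c []) (quad [] (l.reverse ++ b) c []) (4 * l.length + 5) := by
  have := pour_zero (f := push 1) (g := fun x s => (x :: s.1, s.2)) (n := 1)
    (fun x a b c => push_one x) l b c
  simpa only [foldl_push_fst] using this

theorem pour_one_zero (l a c : List Bool) :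
    RunLe (pour 1 (push 0)) (quad a l c []) (quad (l.reverse ++ a) [] c []) (4 * l.length + 5) := by
  have := pour_one (f := push 0) (g := fun x s => (x :: s.1, s.2)) (n := 1)
    (fun x a b c => push_zero x) l a c
  simpa only [foldl_push_fst] using this

theorem pour_two_zero (l a b : List Bool) :
    RunLe (pour 2 (push 0)) (quad a b l []) (quad (l.reverse ++ a) b [] []) (4 * l.length + 5) := by
  have := pour_two (f := push 0) (g := fun x s => (x :: s.1, s.2)) (n := 1)
    (fun x a b c => push_zero x) l a b
  simpa only [foldl_push_fst] using this

theorem pour_one_both (l a c : List Bool) :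
    RunLe (pour 1 fun x => seq (push 0 x) (push 2 x)) (quad a l c [])
      (quad (l.reverse ++ a) [] (l.reverse ++ c) []) (5 * l.length + 5) := by
  have := pour_one (f := fun x => seq (push 0 x) (push 2 x))
    (g := fun x s => (x :: s.1, x :: s.2)) (n := 2)
    (fun x a b c => (push_zero x).seq (push_two x)) l a c
  simpa only [foldl_push_both] using this

theorem pour_two_one (l a b : List Bool) :
    RunLe (pour 2 (push 1)) (quad a b l []) (quad a (l.reverse ++ b) [] []) (4 * l.length + 5) := by
  have h : ∀ l a b : List Bool, l.foldl (fun (s : List Bool × List Bool) x => (s.1, x :: s.2))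
      (a, b) = (a, l.reverse ++ b) := by
    intro l
    induction l with
    | nil => simp
    | cons x l ih => simp [ih]
  have := pour_two (f := push 1) (g := fun x s => (s.1, x :: s.2)) (n := 1)
    (fun x a b c => push_one x) l a b
  simpa only [h] using this

/-- Duplicate the tree on top of stack `0`. -/
def dup : Prog :=
  seq (moveTree 1) (seq (pour 1 fun x => seq (push 0 x) (push 2 x))
    (seq (pour 2 (push 1)) (pour 1 (push 0))))

theorem runLe_dup (x : BinTree) (r : List Bool) :
    RunLe dup (quad (x.bits ++ r) [] [] []) (quad (x.bits ++ (x.bits ++ r)) [] [] [])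
      (18 * x.bits.length + 17) := by
  have h₁ := moveTree_one x (a := r) (b := []) (c := [])
  have h₂ := pour_one_both (x.bits.reverse ++ []) r []
  have h₃ := pour_two_one (x.bits.reverse.reverse) (x.bits ++ r) []
  have h₄ := pour_one_zero (x.bits.reverse) (x.bits ++ r) []
  simp only [List.append_nil, List.reverse_reverse, List.length_reverse] at h₁ h₂ h₃ h₄
  exact (h₁.seq (h₂.seq (h₃.seq h₄))).mono (by omega)

/-- Exchange the two trees on top of stack `0`. -/
def swap : Prog :=
  seq (moveTree 1) (seq (moveTree 2) (seq (pour 1 (push 0)) (pour 2 (push 0))))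

theorem runLe_swap (x y : BinTree) (r : List Bool) :
    RunLe swap (quad (x.bits ++ (y.bits ++ r)) [] [] []) (quad (y.bits ++ (x.bits ++ r)) [] [] [])
      (9 * (x.bits.length + y.bits.length) + 14) := by
  have h₁ := moveTree_one x (a := y.bits ++ r) (b := []) (c := [])
  have h₂ := moveTree_two y (a := r) (b := x.bits.reverse ++ []) (c := [])
  have h₃ := pour_one_zero (x.bits.reverse ++ []) r (y.bits.reverse ++ [])
  have h₄ := pour_two_zero (y.bits.reverse ++ []) (x.bits ++ r) []
  simp only [List.append_nil, List.reverse_reverse, List.length_reverse] at h₁ h₂ h₃ h₄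
  exact (h₁.seq (h₂.seq (h₃.seq h₄))).mono (by omega)

/-- Remove the tree on top of stack `0`. -/
def drop : Prog := seq (moveTree 1) (pour 1 fun _ => skip)

theorem runLe_drop (x : BinTree) (r : List Bool) :
    RunLe drop (quad (x.bits ++ r) [] [] []) (quad r [] [] []) (9 * x.bits.length + 7) := by
  have h₁ := moveTree_one x (a := r) (b := []) (c := [])
  have h₂ := pour_one (f := fun _ => skip) (g := fun _ s => s) (n := 1)
    (fun x a b c => runLe_skip _) (x.bits.reverse ++ []) r []
  have h : ∀ (l : List Bool) (s : List Bool × List Bool), l.foldl (fun s _ => s) s = s := by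
    intro l s
    induction l <;> simp_all
  simp only [List.append_nil, h, List.length_reverse] at h₁ h₂
  exact (h₁.seq h₂).mono (by omega)

/-- Put a bit string on stack `0`. -/
def pushBits : List Bool → Prog
  | [] => skip
  | x :: l => seq (pushBits l) (push 0 x)

theorem runLe_pushBits (l r : List Bool) :
    RunLe (pushBits l) (quad r [] [] []) (quad (l ++ r) [] [] []) (l.length + 1) := by
  induction l with
  | nil => exact runLe_skip _
  | cons x l ih => exact (ih.seq (push_zero x)).mono (by simp)

end Prog

/-! ### Polynomial-time functions between types coded by binary trees -/

/-- Types whose elements are coded by binary trees. -/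
class Enc (α : Type) where
  enc : α → BinTree

namespace Enc

variable {α β : Type}

/-- The bit string that codes `a`. -/
def bits [Enc α] (a : α) : List Bool := (enc a).bits

/-- The length of the code of `a`. -/
def size [Enc α] (a : α) : ℕ := (bits a).length

instance [Enc α] [Enc β] : Enc (α × β) := ⟨fun x => .node (enc x.1) (enc x.2)⟩

instance : Enc Bool := ⟨fun b => if b then .node .leaf .leaf else .leaf⟩

def encNat : ℕ → BinTree
  | 0 => .leaf
  | n + 1 => .node .leaf (encNat n)

instance : Enc ℕ := ⟨encNat⟩

/-- A nonempty list has the same code as the pair of its head and tail, and a number the same code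
as a list of that many `false`s. Programs can thus be shared between these types. -/
def encList [Enc α] : List α → BinTree
  | [] => .leaf
  | x :: l => .node (enc x) (encList l)

instance [Enc α] : Enc (List α) := ⟨encList⟩

theorem size_pair [Enc α] [Enc β] (x : α × β) : size x = size x.1 + size x.2 + 1 := by
  simp [size, bits, enc, BinTree.bits]

theorem size_nil [Enc α] : size ([] : List α) = 1 := rfl

theorem size_cons [Enc α] (x : α) (l : List α) : size (x :: l) = size x + size l + 1 := by
  simp [size, bits, enc, encList, BinTree.bits]

theorem size_append [Enc α] (l l' : List α) : size (l ++ l') + 1 = size l + size l' := by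
  induction l with
  | nil => simp [size_nil, add_comm]
  | cons x l ih => simp only [List.cons_append, size_cons]; omega

theorem size_nat (n : ℕ) : size n = 2 * n + 1 := by
  induction n with
  | zero => rfl
  | succ n ih =>
    have : size (n + 1) = size n + 2 := by
      simp [size, bits, enc, encNat, BinTree.bits]
    omega

theorem size_bool (b : Bool) : size b ≤ 3 := by cases b <;> decide

theorem size_pos [Enc α] (a : α) : 0 < size a := BinTree.length_bits_pos _

theorem length_le_size [Enc α] (l : List α) : l.length ≤ size l := by
  induction l with
  | nil => simp
  | cons x l ih => simp only [List.length_cons, size_cons]; omega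

theorem size_le_of_mem [Enc α] {l : List α} {x : α} (h : x ∈ l) : size x ≤ size l := by
  induction l with
  | nil => simp at h
  | cons y l ih =>
    rw [size_cons]
    rcases List.mem_cons.1 h with rfl | h
    · omega
    · have := ih h; omega

end Enc

open Enc

theorem Polynomial.eval_mono_nat (q : Polynomial ℕ) {m n : ℕ} (h : m ≤ n) :
    q.eval m ≤ q.eval n := by
  induction q using Polynomial.induction_on' with
  | add p q hp hq => simpa using add_le_add hp hq
  | monomial k a => simpa using Nat.mul_le_mul_left _ (Nat.pow_le_pow_left h k)

/-- A program computes `f` in polynomial time on codes on top of stack `0`. -/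
def PolyTime {α β : Type} [Enc α] [Enc β] (f : α → β) : Prop :=
  ∃ (p : Prog) (q : Polynomial ℕ), ∀ a, size (f a) ≤ q.eval (size a) ∧
    ∀ r, p.RunLe (Prog.quad (bits a ++ r) [] [] []) (Prog.quad (bits (f a) ++ r) [] [] [])
      (q.eval (size a))

namespace PolyTime

variable {α β γ δ σ : Type} [Enc α] [Enc β] [Enc γ] [Enc δ] [Enc σ]

theorem of_le {f : α → β} (p : Prog) (q₁ q₂ : Polynomial ℕ)
    (h₁ : ∀ a, size (f a) ≤ q₁.eval (size a))
    (h₂ : ∀ a r, p.RunLe (Prog.quad (bits a ++ r) [] [] [])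
      (Prog.quad (bits (f a) ++ r) [] [] []) (q₂.eval (size a))) : PolyTime f :=
  ⟨p, q₁ + q₂, fun a => ⟨by simpa using (h₁ a).trans (Nat.le_add_right _ _),
    fun r => (h₂ a r).mono (by simp)⟩⟩

theorem size_le {f : α → β} (h : PolyTime f) : ∃ q : Polynomial ℕ, ∀ a, size (f a) ≤ q.eval (size a) :=
  let ⟨_, q, hq⟩ := h
  ⟨q, fun a => (hq a).1⟩

/-- A program sees only codes, so even the type of the values may change as long as the code does
not. -/
theorem congr_enc {f : α → β} {g : α → γ} (hf : PolyTime f) (h : ∀ a, enc (f a) = enc (g a)) :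
    PolyTime g := by
  obtain ⟨p, q, hq⟩ := hf
  refine ⟨p, q, fun a => ?_⟩
  have : bits (g a) = bits (f a) := by rw [bits, bits, h]
  rw [size, this]
  exact hq a

theorem of_enc_eq {f : α → β} (h : ∀ a, enc (f a) = enc a) : PolyTime f := by
  refine of_le .skip Polynomial.X 1 (fun a => ?_) fun a r => ?_
  · simp [size, bits, h]
  · rw [bits, bits, h]
    exact (Prog.runLe_skip _).mono (by simp)

theorem id : PolyTime fun a : α => a := of_enc_eq fun _ => rfl

theorem comp {f : β → γ} {g : α → β} (hf : PolyTime f) (hg : PolyTime g) :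
    PolyTime fun a => f (g a) := by
  obtain ⟨p, q, hq⟩ := hf
  obtain ⟨p', q', hq'⟩ := hg
  refine of_le (.seq p' p) (q.comp q') (q' + q.comp q') (fun a => ?_) fun a r => ?_
  · exact (hq _).1.trans (by simpa using q.eval_mono_nat (hq' a).1)
  · exact (((hq' a).2 r).seq ((hq _).2 r)).mono (by simpa using q.eval_mono_nat (hq' a).1)

theorem const (b : β) : PolyTime fun _ : α => b := by
  refine of_le (.seq .drop (Prog.pushBits (bits b))) (Polynomial.C (size b))
    (9 * Polynomial.X + 7 + Polynomial.C (size b + 1)) (fun a => by simp) fun a r => ?_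
  exact ((Prog.runLe_drop (enc a) r).seq (Prog.runLe_pushBits (bits b) r)).mono
    (by simp [size, bits])

/-- While `g` is computed on a copy, the argument waits below it on stack `0`, and while `f` is
computed, the value of `g` does. This is why `PolyTime` asks programs to respect an arbitrary rest
`r` of the stack. -/
theorem pair {f : α → β} {g : α → γ} (hf : PolyTime f) (hg : PolyTime g) :
    PolyTime fun a => (f a, g a) := by
  obtain ⟨p, q, hq⟩ := hf
  obtain ⟨p', q', hq'⟩ := hg
  refine of_le (.seq .dup (.seq p' (.seq .swap (.seq p (.push 0 true))))) (q + q' + 1)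
    (18 * Polynomial.X + 17 + (q' + (9 * (q' + Polynomial.X) + 14 + (q + 1))))
    (fun a => ?_) fun a r => ?_
  · have := (hq a).1
    have := (hq' a).1
    simp only [size_pair, Polynomial.eval_add, Polynomial.eval_one]
    omega
  · have h₁ := Prog.runLe_dup (enc a) r
    have h₂ := (hq' a).2 (bits a ++ r)
    have h₃ := Prog.runLe_swap (enc (g a)) (enc a) r
    have h₄ := (hq a).2 (bits (g a) ++ r)
    have h₅ := Prog.push_zero (a := bits (f a) ++ (bits (g a) ++ r)) (b := []) (c := []) (d := [])
      true
    have hs := (hq' a).1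
    have key := h₁.seq (h₂.seq (h₃.seq (h₄.seq h₅)))
    have e : bits (f a, g a) ++ r = true :: (bits (f a) ++ (bits (g a) ++ r)) := by
      simp [bits, enc, BinTree.bits]
    rw [e]
    refine key.mono ?_
    simp only [Polynomial.eval_add, Polynomial.eval_mul, Polynomial.eval_X, Polynomial.eval_one,
      Polynomial.eval_ofNat]
    simp only [size, bits] at *
    omega

theorem fst : PolyTime fun x : α × β => x.1 := by
  refine of_le (.seq (.case 0 .skip .skip .skip) (.seq .swap .drop)) Polynomial.X
    (18 * Polynomial.X + 40) (fun x => by simp [size_pair]; omega) fun x r => ?_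
  have h₁ := Prog.case_zero_true (p₀ := .skip) (p₂ := .skip)
    (Prog.runLe_skip (Prog.quad (bits x.1 ++ (bits x.2 ++ r)) [] [] []))
  have h₂ := Prog.runLe_swap (enc x.1) (enc x.2) r
  have h₃ := Prog.runLe_drop (enc x.2) (bits x.1 ++ r)
  have e : bits x ++ r = true :: (bits x.1 ++ (bits x.2 ++ r)) := by
    simp [bits, enc, BinTree.bits]
  rw [e]
  refine (h₁.seq (h₂.seq h₃)).mono ?_
  rw [size_pair]
  simp only [Polynomial.eval_add, Polynomial.eval_mul, Polynomial.eval_X, Polynomial.eval_ofNat,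
    size, bits]
  omega

theorem snd : PolyTime fun x : α × β => x.2 := by
  refine of_le (.seq (.case 0 .skip .skip .skip) .drop) Polynomial.X
    (9 * Polynomial.X + 40) (fun x => by simp [size_pair]; omega) fun x r => ?_
  have h₁ := Prog.case_zero_true (p₀ := .skip) (p₂ := .skip)
    (Prog.runLe_skip (Prog.quad (bits x.1 ++ (bits x.2 ++ r)) [] [] []))
  have h₃ := Prog.runLe_drop (enc x.1) (bits x.2 ++ r)
  have e : bits x ++ r = true :: (bits x.1 ++ (bits x.2 ++ r)) := by
    simp [bits, enc, BinTree.bits]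
  rw [e]
  refine (h₁.seq h₃).mono ?_
  rw [size_pair]
  simp only [Polynomial.eval_add, Polynomial.eval_mul, Polynomial.eval_X, Polynomial.eval_ofNat,
    size, bits]
  omega

theorem cond {c : α → Bool} {f g : α → β} (hc : PolyTime c) (hf : PolyTime f) (hg : PolyTime g) :
    PolyTime fun a => bif c a then f a else g a := by
  obtain ⟨p, q, hq⟩ := hc
  obtain ⟨p₁, q₁, hq₁⟩ := hf
  obtain ⟨p₂, q₂, hq₂⟩ := hg
  -- The code of `true` consists of the bits 1, 0, 0; after the branch on the first one, the two 0s
  -- still have to be popped.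
  refine of_le (.seq .dup (.seq p (.case 0 p₂ (.seq (.case 0 .skip .skip .skip)
    (.seq (.case 0 .skip .skip .skip) p₁)) .skip))) (q₁ + q₂)
    (18 * Polynomial.X + 17 + (q + (4 + q₁ + 1 + q₂))) (fun a => ?_) fun a r => ?_
  · have h₁ := (hq₁ a).1
    have h₂ := (hq₂ a).1
    rw [Polynomial.eval_add]
    cases c a
    · exact h₂.trans (Nat.le_add_left _ _)
    · exact h₁.trans (Nat.le_add_right _ _)
  · have h₁ := (hq a).2 (bits a ++ r)
    have h₂ := Prog.runLe_dup (enc a) r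
    have h₃ := (hq₁ a).2 r
    have h₄ := (hq₂ a).2 r
    have e : (18 * Polynomial.X + 17 + (q + (4 + q₁ + 1 + q₂))).eval (size a) =
      18 * size a + 17 + (q.eval (size a) + (4 + q₁.eval (size a) + 1 + q₂.eval (size a))) := by
      simp
    rw [e]
    cases h : c a
    · rw [h] at h₁
      refine (h₂.seq (h₁.seq (Prog.case_zero_false h₄))).mono ?_
      simp only [size, bits]
      omega
    · rw [h] at h₁
      refine (h₂.seq (h₁.seq (Prog.case_zero_true ((Prog.case_zero_false (Prog.runLe_skip _)).seq
        ((Prog.case_zero_false (Prog.runLe_skip _)).seq h₃))))).mono ?_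
      simp only [size, bits]
      omega

theorem bits_cons (x : α) (l : List α) (r : List Bool) :
    bits (x :: l) ++ r = true :: (bits x ++ (bits l ++ r)) := by
  simp [bits, enc, encList, BinTree.bits]

theorem isEmpty : PolyTime fun l : List α => l.isEmpty := by
  refine of_le (.case 0 (Prog.pushBits (bits true))
    (.seq .drop (.seq .drop (Prog.pushBits (bits false)))) .skip) 3
    (9 * Polynomial.X + 100) (fun a => by simpa using size_bool _) fun l r => ?_
  have e : (9 * Polynomial.X + 100 : Polynomial ℕ).eval (size l) = 9 * size l + 100 := by simp
  rw [e]
  cases l with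
  | nil =>
    refine (Prog.case_zero_false (Prog.runLe_pushBits (bits true) r)).mono ?_
    have : (bits true).length = 3 := rfl
    omega
  | cons x l =>
    rw [bits_cons, size_cons]
    refine (Prog.case_zero_true ((Prog.runLe_drop (enc x) _).seq
      ((Prog.runLe_drop (enc l) _).seq (Prog.runLe_pushBits (bits false) r)))).mono ?_
    have : (bits false).length = 1 := rfl
    simp only [size, bits] at *
    omega

theorem tail : PolyTime fun l : List α => l.tail := by
  refine of_le (.case 0 (.push 0 false) .drop .skip) Polynomial.X
    (9 * Polynomial.X + 100) (fun l => ?_) fun l r => ?_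
  · cases l
    · simp
    · simp [size_cons]; omega
  have e : (9 * Polynomial.X + 100 : Polynomial ℕ).eval (size l) = 9 * size l + 100 := by simp
  rw [e]
  cases l with
  | nil => exact (Prog.case_zero_false (Prog.push_zero false)).mono (by omega)
  | cons x l =>
    rw [bits_cons, size_cons]
    refine (Prog.case_zero_true (Prog.runLe_drop (enc x) (bits l ++ r))).mono ?_
    simp only [size, bits] at *
    omega

theorem headD (d : α) : PolyTime fun l : List α => l.headD d := by
  refine of_le (.case 0 (Prog.pushBits (bits d)) (.seq .swap .drop) .skip)
    (Polynomial.X + Polynomial.C (size d))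
    (18 * Polynomial.X + 100 + Polynomial.C (size d)) (fun l => ?_) fun l r => ?_
  · cases l
    · simp
    · simp [size_cons]; omega
  have e : (18 * Polynomial.X + 100 + Polynomial.C (size d) : Polynomial ℕ).eval (size l) =
    18 * size l + 100 + size d := by simp
  rw [e]
  cases l with
  | nil =>
    refine (Prog.case_zero_false (Prog.runLe_pushBits (bits d) r)).mono ?_
    simp only [size]
    omega
  | cons x l =>
    rw [bits_cons, size_cons]
    refine (Prog.case_zero_true ((Prog.runLe_swap (enc x) (enc l) r).seq
      (Prog.runLe_drop (enc l) (bits x ++ r)))).mono ?_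
    simp only [size, bits] at *
    omega

theorem cons {f : α → β} {l : α → List β} (hf : PolyTime f) (hl : PolyTime l) :
    PolyTime fun a => f a :: l a :=
  (hf.pair hl).congr_enc fun _ => rfl

/-- Put the truth value of `c`, which `p` computes, on the control stack. -/
def test (p : Prog) : Prog :=
  .seq .dup (.seq p (.case 0 .skip (.seq (.case 0 .skip .skip .skip)
    (.seq (.case 0 .skip .skip .skip) (.push 3 true))) .skip))

theorem runLe_test {c : α → Bool} {p : Prog} {q : Polynomial ℕ}
    (h : ∀ a, size (c a) ≤ q.eval (size a) ∧
      ∀ r, p.RunLe (Prog.quad (bits a ++ r) [] [] []) (Prog.quad (bits (c a) ++ r) [] [] [])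
        (q.eval (size a))) (a : α) (r : List Bool) :
    (test p).RunLe (Prog.quad (bits a ++ r) [] [] [])
      (Prog.quad (bits a ++ r) [] [] (bif c a then [true] else []))
      (18 * size a + 30 + q.eval (size a)) := by
  have h₁ := (h a).2 (bits a ++ r)
  have h₂ := Prog.runLe_dup (enc a) r
  cases hc : c a
  · rw [hc] at h₁
    refine (h₂.seq (h₁.seq (Prog.case_zero_false (Prog.runLe_skip _)))).mono ?_
    simp only [size, bits]
    omega
  · rw [hc] at h₁
    refine (h₂.seq (h₁.seq (Prog.case_zero_true ((Prog.case_zero_false (Prog.runLe_skip _)).seq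
      ((Prog.case_zero_false (Prog.runLe_skip _)).seq (Prog.push_three true)))))).mono ?_
    simp only [size, bits]
    omega

/-- Iteration of `F` as long as `c` holds, if this is the case exactly `k a` times and all
intermediate results are of polynomial size. -/
theorem iterate_while {c : σ → Bool} {F : σ → σ} {g : α → σ} (hc : PolyTime c) (hF : PolyTime F)
    (hg : PolyTime g) (k : α → ℕ) (hk : ∃ Q : Polynomial ℕ, ∀ a, k a ≤ Q.eval (size a))
    (hs : ∃ Q : Polynomial ℕ, ∀ a, ∀ i ≤ k a, size (F^[i] (g a)) ≤ Q.eval (size a))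
    (hlt : ∀ a, ∀ i < k a, c (F^[i] (g a)) = true) (hend : ∀ a, c (F^[k a] (g a)) = false) :
    PolyTime fun a => F^[k a] (g a) := by
  obtain ⟨pc, qc, hqc⟩ := hc
  obtain ⟨p, q, hq⟩ := hF
  obtain ⟨p', q', hq'⟩ := hg
  obtain ⟨K, hK⟩ := hk
  obtain ⟨Q, hQ⟩ := hs
  refine of_le (.seq p' (.seq (test pc) (.loop 3 (.seq p (test pc))))) Q
    (q' + ((18 * Q + 30 + qc.comp Q) +
      ((K + 1) * (q.comp Q + (18 * Q + 30 + qc.comp Q) + 1) + 1)))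
    (fun a => hQ a _ le_rfl) fun a r => ?_
  simp only [Polynomial.eval_add, Polynomial.eval_mul, Polynomial.eval_comp, Polynomial.eval_ofNat,
    Polynomial.eval_one]
  specialize hK a
  specialize hQ a
  generalize Q.eval (size a) = B at hQ ⊢
  generalize K.eval (size a) = N at hK ⊢
  obtain ⟨T, hT⟩ : ∃ T, T = q.eval B + (18 * B + 30 + qc.eval B) + 1 := ⟨_, rfl⟩
  have hstep : ∀ x, size x ≤ B → (test pc).RunLe (Prog.quad (bits x ++ r) [] [] [])
      (Prog.quad (bits x ++ r) [] [] (bif c x then [true] else [])) (18 * B + 30 + qc.eval B) :=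
    fun x hx => (runLe_test hqc x r).mono (by
      have := qc.eval_mono_nat hx
      omega)
  -- Induction on the number `j` of remaining rounds. One round costs at most `T`: an application of
  -- `F`, the next test, and the removal of the control bit.
  have key : ∀ j i, i + j = k a → (Prog.loop 3 (.seq p (test pc))).RunLe
      (Prog.quad (bits (F^[i] (g a)) ++ r) [] [] (bif c (F^[i] (g a)) then [true] else []))
      (Prog.quad (bits (F^[k a] (g a)) ++ r) [] [] []) (j * T + 1) := by
    intro j
    induction j with
    | zero =>
      intro i hi
      obtain rfl : i = k a := by omega
      rw [hend]
      exact Prog.loop_three_nil.mono (by omega)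
    | succ j ih =>
      intro i hi
      rw [hlt a i (by omega)]
      have h₁ := (hq (F^[i] (g a))).2 r
      have h₂ := hstep (F^[i + 1] (g a)) (hQ _ (by omega))
      have h₃ := ih (i + 1) (by omega)
      have h₄ := q.eval_mono_nat (hQ i (by omega))
      rw [Function.iterate_succ_apply'] at h₂ h₃
      refine (Prog.loop_three_true (h₁.seq h₂) h₃).mono ?_
      have : (j + 1) * T = j * T + T := by ring
      omega
  refine (((hq' a).2 r).seq ((hstep _ (hQ 0 (Nat.zero_le _))).seq (key (k a) 0 (by omega)))).mono ?_
  have h₁ : k a * T ≤ (N + 1) * T := Nat.mul_le_mul_right _ (hK.trans (Nat.le_succ _))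
  rw [← hT]
  omega

theorem not {c : α → Bool} (hc : PolyTime c) : PolyTime fun a => !c a := by
  have := cond hc (const (α := α) false) (const (α := α) true)
  refine this.congr_enc fun a => ?_
  cases c a <;> rfl

/-- Folding over a list, if all intermediate results are of polynomial size. -/
theorem foldl_of_size [Inhabited β] {h : α → σ → β → σ} {s : α → σ} {l : α → List β}
    (hh : PolyTime fun x : α × σ × β => h x.1 x.2.1 x.2.2) (hs : PolyTime s) (hl : PolyTime l)
    (hsize : ∃ Q : Polynomial ℕ, ∀ a l₁, l₁ <+: l a →
      size (l₁.foldl (h a) (s a)) ≤ Q.eval (size a)) :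
    PolyTime fun a => (l a).foldl (h a) (s a) := by
  -- The state consists of the unread part of the list, the argument and the accumulator. The
  -- `default` is never reached, as the loop stops at the empty list.
  let F : List β × α × σ → List β × α × σ := fun x =>
    (x.1.tail, x.2.1, h x.2.1 x.2.2 (x.1.headD default))
  have hF : PolyTime F := by
    refine pair (tail.comp fst) (pair (fst.comp snd) ?_)
    exact hh.comp (pair (fst.comp snd) (pair (snd.comp snd) ((headD default).comp fst)))
  have hc : PolyTime fun x : List β × α × σ => !x.1.isEmpty := not (isEmpty.comp fst)
  have hit : ∀ (i : ℕ) (m : List β) (a : α) (t : σ), i ≤ m.length →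
      F^[i] (m, a, t) = (m.drop i, a, (m.take i).foldl (h a) t) := by
    intro i
    induction i with
    | zero => simp
    | succ i ih =>
      intro m a t him
      cases m with
      | nil => simp at him
      | cons x m =>
        rw [Function.iterate_succ_apply]
        simpa [F] using ih m a (h a t x) (by simpa using him)
  obtain ⟨Q, hQ⟩ := hsize
  obtain ⟨R, hR⟩ := hl.size_le
  have hres := iterate_while (g := fun a => (l a, a, s a)) hc hF (pair hl (pair id hs))
    (fun a => (l a).length) ⟨R, fun a => (length_le_size _).trans (hR a)⟩
    ⟨R + Polynomial.X + Q + 2, fun a i hi => ?_⟩ (fun a i hi => ?_) (fun a => ?_)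
  · refine (snd.comp (snd.comp hres)).congr_enc fun a => ?_
    rw [hit _ _ _ _ le_rfl, List.take_length]
  · rw [hit _ _ _ _ hi, size_pair, size_pair]
    have h₁ := hQ a _ (List.take_prefix i (l a))
    have h₂ := hR a
    have h₃ : size ((l a).drop i) ≤ size (l a) := by
      conv_rhs => rw [← List.take_append_drop i (l a)]
      have := size_append ((l a).take i) ((l a).drop i)
      have := size_pos ((l a).take i)
      omega
    simp only [Polynomial.eval_add, Polynomial.eval_X, Polynomial.eval_ofNat]
    omega
  · rw [hit _ _ _ _ hi.le]
    simpa using hi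
  · rw [hit _ _ _ _ le_rfl]
    simp

/-- Folding over a list, if a step enlarges the state by a polynomial in the size of the other
arguments. -/
theorem foldl [Inhabited β] {h : α → σ → β → σ} {s : α → σ} {l : α → List β}
    (hh : PolyTime fun x : α × σ × β => h x.1 x.2.1 x.2.2) (hs : PolyTime s) (hl : PolyTime l)
    (hsize : ∃ Q : Polynomial ℕ, ∀ a t b, size (h a t b) ≤ size t + Q.eval (size a + size b)) :
    PolyTime fun a => (l a).foldl (h a) (s a) := by
  obtain ⟨Q, hQ⟩ := hsize
  obtain ⟨R, hR⟩ := hl.size_le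
  obtain ⟨P, hP⟩ := hs.size_le
  refine foldl_of_size hh hs hl ⟨P + R * Q.comp (Polynomial.X + R), fun a l₁ hl₁ => ?_⟩
  have key : ∀ (m : List β) (t : σ), (∀ b ∈ m, size b ≤ size (l a)) →
      size (m.foldl (h a) t) ≤ size t + m.length * Q.eval (size a + size (l a)) := by
    intro m
    induction m with
    | nil => simp
    | cons b m ih =>
      intro t hm
      have h₁ := ih (h a t b) fun b hb => hm b (List.mem_cons_of_mem _ hb)
      have h₂ := hQ a t b
      have h₃ := Q.eval_mono_nat (Nat.add_le_add_left (hm b List.mem_cons_self) (size a))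
      rw [List.foldl_cons, List.length_cons, Nat.succ_mul]
      omega
  refine (key l₁ (s a) fun b hb => size_le_of_mem (hl₁.subset hb)).trans ?_
  simp only [Polynomial.eval_add, Polynomial.eval_mul, Polynomial.eval_comp, Polynomial.eval_X]
  refine add_le_add (hP a) (Nat.mul_le_mul ?_ (Q.eval_mono_nat (Nat.add_le_add_left (hR a) _)))
  exact hl₁.length_le.trans ((length_le_size _).trans (hR a))

end PolyTime


namespace PolyTime

variable {α β γ δ σ : Type} [Enc α] [Enc β] [Enc γ] [Enc δ] [Enc σ]

/-! ### A library of polynomial-time functions -/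

theorem and {c d : α → Bool} (hc : PolyTime c) (hd : PolyTime d) : PolyTime fun a => c a && d a := by
  refine (cond hc hd (const false)).congr_enc fun a => ?_
  cases c a <;> rfl

theorem or {c d : α → Bool} (hc : PolyTime c) (hd : PolyTime d) : PolyTime fun a => c a || d a := by
  refine (cond hc (const true) hd).congr_enc fun a => ?_
  cases c a <;> rfl

theorem ite {c : α → Prop} [DecidablePred c] {f g : α → β} (hc : PolyTime fun a => decide (c a))
    (hf : PolyTime f) (hg : PolyTime g) : PolyTime fun a => if c a then f a else g a := by
  refine (cond hc hf hg).congr_enc fun a => ?_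
  by_cases h : c a <;> simp [h]

theorem decide_and {c d : α → Prop} [DecidablePred c] [DecidablePred d]
    (hc : PolyTime fun a => decide (c a)) (hd : PolyTime fun a => decide (d a)) :
    PolyTime fun a => decide (c a ∧ d a) :=
  (hc.and hd).congr_enc fun a => by rw [Bool.decide_and]

theorem decide_or {c d : α → Prop} [DecidablePred c] [DecidablePred d]
    (hc : PolyTime fun a => decide (c a)) (hd : PolyTime fun a => decide (d a)) :
    PolyTime fun a => decide (c a ∨ d a) :=
  (hc.or hd).congr_enc fun a => by rw [Bool.decide_or]

theorem decide_not {c : α → Prop} [DecidablePred c] (hc : PolyTime fun a => decide (c a)) :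
    PolyTime fun a => decide (¬ c a) :=
  hc.not.congr_enc fun a => by rw [_root_.decide_not]

theorem foldl_cons_eq {β : Type} (l t : List β) : l.foldl (fun s b => b :: s) t = l.reverse ++ t := by
  induction l generalizing t with
  | nil => rfl
  | cons x l ih => simp [ih]

theorem reverse [Inhabited β] {l : α → List β} (hl : PolyTime l) :
    PolyTime fun a => (l a).reverse := by
  have := foldl (h := fun (_ : α) (s : List β) b => b :: s) (s := fun _ => [])
    (cons (snd.comp snd) (fst.comp snd)) (const []) hl
    ⟨Polynomial.X + 1, fun a t b => by
      rw [size_cons]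
      simp only [Polynomial.eval_add, Polynomial.eval_X, Polynomial.eval_one]
      omega⟩
  simpa only [foldl_cons_eq, List.append_nil] using this

theorem append [Inhabited β] {l l' : α → List β} (hl : PolyTime l) (hl' : PolyTime l') :
    PolyTime fun a => l a ++ l' a := by
  have := foldl (h := fun (_ : α) (s : List β) b => b :: s) (s := l')
    (cons (snd.comp snd) (fst.comp snd)) hl' hl.reverse
    ⟨Polynomial.X + 1, fun a t b => by
      rw [size_cons]
      simp only [Polynomial.eval_add, Polynomial.eval_X, Polynomial.eval_one]
      omega⟩
  simpa only [foldl_cons_eq, List.reverse_reverse] using this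

theorem foldl_append_flatMap {β γ : Type} (g : β → List γ) (l : List β) (t : List γ) :
    l.foldl (fun s b => s ++ g b) t = t ++ l.flatMap g := by
  induction l generalizing t with
  | nil => simp
  | cons x l ih => simp [ih]

theorem flatMap [Inhabited β] [Inhabited γ] {g : α → β → List γ} {l : α → List β}
    (hg : PolyTime fun x : α × β => g x.1 x.2) (hl : PolyTime l) :
    PolyTime fun a => (l a).flatMap (g a) := by
  obtain ⟨q, hq⟩ := hg.size_le
  have := foldl (h := fun a (s : List γ) b => s ++ g a b) (s := fun _ => [])
    (append (fst.comp snd) (hg.comp (pair fst (snd.comp snd)))) (const []) hl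
    ⟨q.comp (Polynomial.X + 1), fun a t b => by
      have h₁ : size (g a b) ≤ q.eval (size a + size b + 1) :=
        (hq (a, b)).trans (by rw [size_pair])
      have h₂ := size_append t (g a b)
      simp only [Polynomial.eval_comp, Polynomial.eval_add, Polynomial.eval_X, Polynomial.eval_one]
      omega⟩
  simpa only [foldl_append_flatMap, List.nil_append] using this

theorem map [Inhabited β] [Inhabited γ] {g : α → β → γ} {l : α → List β}
    (hg : PolyTime fun x : α × β => g x.1 x.2) (hl : PolyTime l) :
    PolyTime fun a => (l a).map (g a) :=
  (flatMap (g := fun a b => [g a b]) (cons hg (const [])) hl).congr_enc fun a => by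
    rw [List.map_eq_flatMap]

theorem filter [Inhabited β] {c : α → β → Bool} {l : α → List β}
    (hc : PolyTime fun x : α × β => c x.1 x.2) (hl : PolyTime l) :
    PolyTime fun a => (l a).filter (c a) := by
  refine (flatMap (g := fun a b => bif c a b then [b] else [])
    (cond hc (cons snd (const [])) (const [])) hl).congr_enc fun a => ?_
  congr 1
  induction l a with
  | nil => rfl
  | cons x m ih =>
    rw [List.flatMap_cons, ih, List.filter_cons]
    cases c a x <;> rfl

theorem all [Inhabited β] {c : α → β → Bool} {l : α → List β}
    (hc : PolyTime fun x : α × β => c x.1 x.2) (hl : PolyTime l) :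
    PolyTime fun a => (l a).all (c a) := by
  refine (isEmpty.comp (filter (c := fun a b => !c a b) hc.not hl)).congr_enc fun a => ?_
  congr 1
  induction l a with
  | nil => rfl
  | cons x m ih => cases h : c a x <;> (simp [h] at ih ⊢; try simp [ih])

theorem any [Inhabited β] {c : α → β → Bool} {l : α → List β}
    (hc : PolyTime fun x : α × β => c x.1 x.2) (hl : PolyTime l) :
    PolyTime fun a => (l a).any (c a) := by
  refine (all (c := fun a b => !c a b) hc.not hl).not.congr_enc fun a => ?_
  rw [List.not_all_eq_any_not]
  simp

theorem decide_forall_mem [Inhabited β] {c : α → β → Prop} [∀ a b, Decidable (c a b)]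
    {l : α → List β} (hc : PolyTime fun x : α × β => decide (c x.1 x.2)) (hl : PolyTime l) :
    PolyTime fun a => decide (∀ b ∈ l a, c a b) :=
  (all (c := fun a b => decide (c a b)) hc hl).congr_enc fun a => by
    congr 1
    rw [Bool.eq_iff_iff]
    simp

theorem decide_exists_mem [Inhabited β] {c : α → β → Prop} [∀ a b, Decidable (c a b)]
    {l : α → List β} (hc : PolyTime fun x : α × β => decide (c x.1 x.2)) (hl : PolyTime l) :
    PolyTime fun a => decide (∃ b ∈ l a, c a b) :=
  (any (c := fun a b => decide (c a b)) hc hl).congr_enc fun a => by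
    congr 1
    rw [Bool.eq_iff_iff]
    simp

theorem enc_replicate (n : ℕ) : enc (List.replicate n false) = enc n := by
  induction n with
  | zero => rfl
  | succ n ih => exact congrArg _ ih

theorem replicate_false {n : α → ℕ} (hn : PolyTime n) :
    PolyTime fun a => List.replicate (n a) false :=
  hn.congr_enc fun _ => (enc_replicate _).symm

theorem length [Inhabited β] {l : α → List β} (hl : PolyTime l) : PolyTime fun a => (l a).length := by
  refine (map (g := fun _ _ => false) (const false) hl).congr_enc fun a => ?_
  rw [← enc_replicate, List.map_const']

/-- This is a fold over `n a` dummy bits. The growth per round is bounded in terms of `a` alone,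
which excludes iterated doubling. -/
theorem iterate {h : α → σ → σ} {s : α → σ} {n : α → ℕ} (hh : PolyTime fun x : α × σ => h x.1 x.2)
    (hs : PolyTime s) (hn : PolyTime n)
    (hsize : ∃ Q : Polynomial ℕ, ∀ a t, size (h a t) ≤ size t + Q.eval (size a)) :
    PolyTime fun a => (h a)^[n a] (s a) := by
  obtain ⟨Q, hQ⟩ := hsize
  refine (foldl (h := fun a t (_ : Bool) => h a t) (l := fun a => List.replicate (n a) false)
    (hh.comp (pair fst (fst.comp snd))) hs hn.replicate_false
    ⟨Q, fun _ t _ => (hQ _ t).trans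
      (Nat.add_le_add_left (Q.eval_mono_nat (Nat.le_add_right _ _)) _)⟩).congr_enc fun a => ?_
  congr 1
  generalize s a = t
  generalize n a = k
  induction k generalizing t with
  | zero => rfl
  | succ k ih => exact ih (h a t)

theorem succ {n : α → ℕ} (hn : PolyTime n) : PolyTime fun a => n a + 1 :=
  (cons (const false) hn.replicate_false).congr_enc fun a => enc_replicate (n a + 1)

theorem pred {n : α → ℕ} (hn : PolyTime n) : PolyTime fun a => n a - 1 := by
  refine (tail.comp hn.replicate_false).congr_enc fun a => ?_
  rw [← enc_replicate]
  simp

theorem decide_eq_zero {n : α → ℕ} (hn : PolyTime n) : PolyTime fun a => decide (n a = 0) := by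
  refine (isEmpty.comp hn.replicate_false).congr_enc fun a => ?_
  congr 1
  cases n a <;> simp [List.replicate_succ]

theorem add {m n : α → ℕ} (hm : PolyTime m) (hn : PolyTime n) : PolyTime fun a => m a + n a := by
  refine (append hm.replicate_false hn.replicate_false).congr_enc fun a => ?_
  rw [List.replicate_append_replicate, enc_replicate]

theorem sub {m n : α → ℕ} (hm : PolyTime m) (hn : PolyTime n) : PolyTime fun a => m a - n a := by
  refine (iterate (h := fun _ k => k - 1) (pred snd) hm hn ⟨0, fun _ t => ?_⟩).congr_enc
    fun a => ?_
  · simp only [size_nat]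
    omega
  · congr 1
    generalize n a = k
    induction k with
    | zero => rfl
    | succ k ih => rw [Function.iterate_succ_apply', ih]; omega

theorem mul {m n : α → ℕ} (hm : PolyTime m) (hn : PolyTime n) : PolyTime fun a => m a * n a := by
  have h := length (flatMap (g := fun a (_ : Bool) => List.replicate (n a) false)
    (l := fun a => List.replicate (m a) false) (hn.comp fst).replicate_false hm.replicate_false)
  refine h.congr_enc fun a => ?_
  simp

theorem decide_le {m n : α → ℕ} (hm : PolyTime m) (hn : PolyTime n) :
    PolyTime fun a => decide (m a ≤ n a) :=
  (decide_eq_zero (hm.sub hn)).congr_enc fun a => by simp only [Nat.sub_eq_zero_iff_le]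

theorem decide_eq {m n : α → ℕ} (hm : PolyTime m) (hn : PolyTime n) :
    PolyTime fun a => decide (m a = n a) :=
  ((decide_le hm hn).decide_and (decide_le hn hm)).congr_enc fun a => by
    simp only [Nat.le_antisymm_iff]

theorem decide_mem {n : α → ℕ} {l : α → List ℕ} (hn : PolyTime n) (hl : PolyTime l) :
    PolyTime fun a => decide (n a ∈ l a) :=
  (decide_exists_mem (c := fun a b => b = n a) (decide_eq snd (hn.comp fst)) hl).congr_enc
    fun a => by simp

theorem range {n : α → ℕ} (hn : PolyTime n) : PolyTime fun a => List.range (n a) := by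
  have key : ∀ l : List Bool, l.foldl (fun (s : ℕ × List ℕ) _ => (s.1 + 1, s.2 ++ [s.1])) (0, []) =
      (l.length, List.range l.length) := by
    intro l
    induction l using List.reverseRecOn with
    | nil => rfl
    | append_singleton l b ih => simp [ih, List.range_succ]
  have hsize : ∀ k : ℕ, size (List.range k) ≤ k * (2 * k + 3) + 1 := by
    intro k
    induction k with
    | zero => rfl
    | succ k ih =>
      have h₁ := size_append (List.range k) [k]
      rw [size_cons, size_nil, size_nat] at h₁
      rw [List.range_succ]
      nlinarith
  obtain ⟨R, hR⟩ := hn.size_le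
  -- The number appended in a round grows with the counter in the state, so `foldl` with its bound
  -- on the growth does not apply; the sizes of the intermediate results are estimated directly.
  have h := foldl_of_size (h := fun (_ : α) (s : ℕ × List ℕ) (_ : Bool) => (s.1 + 1, s.2 ++ [s.1]))
    (s := fun _ => (0, [])) (l := fun a => List.replicate (n a) false)
    (pair (succ (fst.comp (fst.comp snd))) (append (snd.comp (fst.comp snd))
      (cons (fst.comp (fst.comp snd)) (const [])))) (const _) hn.replicate_false
    ⟨R * (2 * R + 3) + 2 * R + 3, fun a l hl => ?_⟩
  · refine (snd.comp h).congr_enc fun a => ?_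
    rw [key, List.length_replicate]
  · have h₁ : l.length ≤ R.eval (size a) := by
      refine hl.length_le.trans ?_
      have := hR a
      rw [size_nat] at this
      rw [List.length_replicate]
      omega
    rw [key, size_pair, size_nat]
    have h₂ := hsize l.length
    have h₃ := Nat.mul_le_mul h₁ (show 2 * l.length + 3 ≤ 2 * R.eval (size a) + 3 by omega)
    simp only [Polynomial.eval_add, Polynomial.eval_mul, Polynomial.eval_ofNat]
    omega

theorem getD {n : α → ℕ} {l : α → List β} [Inhabited β] (hl : PolyTime l) (hn : PolyTime n) (d : β) :
    PolyTime fun a => (l a).getD (n a) d := by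
  have h := iterate (h := fun (_ : α) (t : List β) => t.tail) (tail.comp snd) hl hn
    ⟨0, fun a t => by
      cases t
      · simp
      · simp [size_cons]; omega⟩
  refine ((headD d).comp h).congr_enc fun a => ?_
  congr 1
  have : ∀ (k : ℕ) (t : List β), ((fun t : List β => t.tail)^[k] t).headD d = t.getD k d := by
    intro k
    induction k with
    | zero => intro t; cases t <;> rfl
    | succ k ih =>
      intro t
      rw [Function.iterate_succ_apply, ih]
      cases t <;> simp
  exact this _ _

theorem replicate [Inhabited β] {n : α → ℕ} {f : α → β} (hn : PolyTime n) (hf : PolyTime f) :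
    PolyTime fun a => List.replicate (n a) (f a) :=
  (map (g := fun a (_ : Bool) => f a) (hf.comp fst) hn.replicate_false).congr_enc fun a => by
    simp

end PolyTime


/-! ### From polynomial-time functions to Turing machines -/

namespace Prog

/-- Replace a bit string on stack `0` by its code as a list of Booleans. -/
def encodeInput : Prog :=
  seq (pour 0 (push 1)) (seq (push 0 false) (pour 1 fun x => pushBits (true :: Enc.bits x)))

theorem runLe_encodeInput (l : List Bool) :
    RunLe encodeInput (quad l [] [] []) (quad (Enc.bits l) [] [] []) (12 * l.length + 11) := by
  have h₁ := pour_zero_one l [] []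
  have h₂ := pour_one (f := fun x => pushBits (true :: Enc.bits x))
    (g := fun x s => (true :: Enc.bits x ++ s.1, s.2)) (n := 5)
    (fun x a b c => by
      have : ∀ (l a : List Bool), RunLe (pushBits l) (quad a b c []) (quad (l ++ a) b c [])
          (l.length + 1) := by
        intro l
        induction l with
        | nil => exact fun a => runLe_skip _
        | cons x l ih => exact fun a => ((ih a).seq (push_zero x)).mono (by simp)
      refine (this (true :: Enc.bits x) a).mono ?_
      cases x <;> decide) (l.reverse ++ []) [false] []
  have h₃ : ∀ (l : List Bool), l.reverse.foldl
      (fun (s : List Bool × List Bool) x => (true :: Enc.bits x ++ s.1, s.2)) ([false], []) =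
        (Enc.bits l, []) := by
    intro l
    induction l with
    | nil => rfl
    | cons x l ih =>
      rw [List.reverse_cons, List.foldl_append, ih]
      simpa using (PolyTime.bits_cons x l []).symm
  simp only [List.append_nil, h₃, List.length_reverse] at h₁ h₂
  exact (h₁.seq ((push_zero false).seq h₂)).mono (by omega)

/-- Replace the code of a Boolean on stack `0` by the Boolean. -/
def decodeOutput : Prog :=
  case 0 (push 0 false) (seq (case 0 skip skip skip) (seq (case 0 skip skip skip) (push 0 true)))
    skip

theorem runLe_decodeOutput (b : Bool) :
    RunLe decodeOutput (quad (Enc.bits b) [] [] []) (quad [b] [] [] []) 6 := by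
  cases b
  · exact (case_zero_false (push_zero false)).mono (by omega)
  · exact (case_zero_true ((case_zero_false (runLe_skip _)).seq
      ((case_zero_false (runLe_skip _)).seq (push_zero true)))).mono (by omega)

end Prog

theorem PolyTime.polyTimeRecognizable {α : Type} {e : α → List Bool} {P : α → Prop}
    {f : List Bool → Bool} (hf : PolyTime f) (h : ∀ a, f (e a) = true ↔ P a) :
    PolyTimeRecognizable e P := by
  obtain ⟨p, q, hq⟩ := hf
  -- The summands pay for `encodeInput`, for `p` on a code of length at most `4 * n + 1`, for
  -- `decodeOutput` (6 steps), and for halting.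
  let r : Polynomial ℕ := 12 * Polynomial.X + 11 + (q.comp (4 * Polynomial.X + 1) + 6) + 1
  have hsize : ∀ l : List Bool, size l ≤ 4 * l.length + 1 := by
    intro l
    induction l with
    | nil => simp [size_nil]
    | cons x l ih =>
      have := size_bool x
      rw [size_cons, List.length_cons]
      omega
  have hrun : ∀ a, Nonempty (Turing.TM2OutputsInTime
      (Prog.machine (.seq .encodeInput (.seq p .decodeOutput))) (e a) (some [f (e a)])
        (r.eval (e a).length)) := by
    intro a
    have h₂ := (hq (e a)).2 []
    simp only [List.append_nil] at h₂
    obtain ⟨t, ht, hr⟩ := (Prog.runLe_encodeInput (e a)).seq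
      (h₂.seq (Prog.runLe_decodeOutput (f (e a))))
    obtain ⟨o⟩ := hr.outputs
    refine ⟨⟨o.toEvalsTo, o.steps_le_m.trans ?_⟩⟩
    have := q.eval_mono_nat (hsize (e a))
    simp only [r, Polynomial.eval_add, Polynomial.eval_mul, Polynomial.eval_comp,
      Polynomial.eval_ofNat, Polynomial.eval_X, Polynomial.eval_one]
    omega
  -- In the goal, input and output occur as images under identity maps of the alphabets. With
  -- variables `l`, `l'` in their place, no rewriting inside a dependent type is needed.
  have hout : ∀ a l l', l = e a → l' = [f (e a)] → Nonempty (Turing.TM2OutputsInTime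
      (Prog.machine (.seq .encodeInput (.seq p .decodeOutput))) l (some l')
        (r.eval (e a).length)) := by
    rintro a _ _ rfl rfl
    exact hrun a
  refine ⟨⟨⟨Prog.machine (.seq .encodeInput (.seq p .decodeOutput)), Equiv.refl Bool,
    Equiv.refl Bool⟩, r, fun a => Classical.choice (hout a _ _ (List.map_id _) ?_)⟩⟩
  have : @decide (P a) (Classical.propDecidable _) = f (e a) := by
    rw [Bool.eq_iff_iff, h]
    simp
  rw [this]
  rfl


/-! ### Distinct representatives by an auction -/

namespace Auction

/-- The number of bids on the slot `j` in the history `H` of bids `(slot, bidder)`. -/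
def price (H : List (ℕ × ℕ)) (j : ℕ) : ℕ := (H.filter fun h => decide (h.1 = j)).length

/-- The last bidder for the slot `j`, or `0`. -/
def owner (H : List (ℕ × ℕ)) (j : ℕ) : ℕ := ((H.filter fun h => decide (h.1 = j)).headD (0, 0)).2

/-- The persons that own none of their options; person `i` bids under the name `i + 1`. -/
def unmatched (opts : List (List ℕ)) (H : List (ℕ × ℕ)) : List ℕ :=
  (List.range opts.length).filter fun i => decide (∀ j ∈ opts.getD i [], ¬ owner H j = i + 1)

/-- The cheapest options of a person. -/
def cheapest (opts : List (List ℕ)) (H : List (ℕ × ℕ)) (i : ℕ) : List ℕ :=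
  (opts.getD i []).filter fun j => decide (∀ j' ∈ opts.getD i [], price H j ≤ price H j')

def bids (opts : List (List ℕ)) (H : List (ℕ × ℕ)) : List (ℕ × ℕ) :=
  (unmatched opts H).flatMap fun i => (cheapest opts H i).map fun j => (j, i + 1)

/-- Only one of the available bids is placed, so the length of the history counts the steps until no
bid is left. -/
def step (opts : List (List ℕ)) (H : List (ℕ × ℕ)) : List (ℕ × ℕ) :=
  bif (bids opts H).isEmpty then H else (bids opts H).headD (0, 0) :: H

/-- Decides whether there are distinct representatives for the lists of options. -/
def hasSDR (opts : List (List ℕ)) : Bool :=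
  (unmatched opts ((step opts)^[opts.length * opts.length + 1] [])).isEmpty

theorem price_cons (H : List (ℕ × ℕ)) (j i x : ℕ) :
    price ((j, i) :: H) x = price H x + if j = x then 1 else 0 := by
  unfold price
  by_cases h : j = x <;> simp [h]

theorem owner_cons (H : List (ℕ × ℕ)) (j i x : ℕ) :
    owner ((j, i) :: H) x = if j = x then i else owner H x := by
  unfold owner
  by_cases h : j = x <;> simp [h]

/-- The invariant of the auction. -/
structure Inv (opts : List (List ℕ)) (H : List (ℕ × ℕ)) : Prop where
  -- The owner chose a cheapest option, the bid itself raised its price by one, and all other prices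
  -- can only have risen since.
  option : ∀ j i, owner H j = i + 1 → i < opts.length ∧ j ∈ opts.getD i [] ∧
    ∀ j' ∈ opts.getD i [], price H j ≤ price H j' + 1
  owned : ∀ j, 0 < price H j → owner H j ≠ 0
  inj : ∀ j j', owner H j = owner H j' → owner H j ≠ 0 → j = j'
  price_le : ∀ j, price H j ≤ opts.length

theorem inv_nil (opts : List (List ℕ)) : Inv opts [] :=
  ⟨fun j i h => by simp [owner] at h, fun j h => by simp [price] at h,
    fun j j' _ h => by simp [owner] at h, fun j => by simp [price]⟩

/-- The slots with a bid. -/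
def sold (H : List (ℕ × ℕ)) : Finset ℕ := (H.map Prod.fst).toFinset

theorem price_eq_count (H : List (ℕ × ℕ)) (j : ℕ) : price H j = (H.map Prod.fst).count j := by
  unfold price
  induction H with
  | nil => rfl
  | cons h H ih =>
    rw [List.map_cons, List.count_cons, ← ih, List.filter_cons]
    by_cases hj : h.1 = j <;> simp [hj]

theorem mem_sold {H : List (ℕ × ℕ)} {j : ℕ} : j ∈ sold H ↔ 0 < price H j := by
  rw [sold, List.mem_toFinset, price_eq_count, List.count_pos_iff]

variable {opts : List (List ℕ)} {H : List (ℕ × ℕ)}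

theorem Inv.owner_mem (hH : Inv opts H) {j : ℕ} (hj : j ∈ sold H) :
    ∃ i < opts.length, owner H j = i + 1 := by
  obtain ⟨i, hi⟩ := Nat.exists_eq_succ_of_ne_zero (hH.owned j (mem_sold.1 hj))
  exact ⟨i, (hH.option j i hi).1, hi⟩

/-- Different sold slots have different owners, so at most `opts.length` slots are sold, each after
at most `opts.length` bids. Hence the number of rounds in `hasSDR`, one more than this product. -/
theorem Inv.length_le (hH : Inv opts H) : H.length ≤ opts.length * opts.length := by
  have hcard : (sold H).card ≤ opts.length := by
    rw [← Finset.card_range opts.length]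
    refine Finset.card_le_card_of_injOn (fun j => owner H j - 1) (fun j hj => ?_)
      fun j hj j' hj' h => ?_
    · obtain ⟨i, hi, h⟩ := hH.owner_mem hj
      simp [h, hi]
    · obtain ⟨i, hi, h₁⟩ := hH.owner_mem hj
      obtain ⟨i', hi', h₂⟩ := hH.owner_mem hj'
      exact hH.inj j j' (by simp only at h; omega) (by omega)
  calc H.length = (H.map Prod.fst).length := by simp
    _ = ∑ j ∈ sold H, price H j := by
      simp only [price_eq_count]
      exact (List.sum_toFinset_count_eq_length _).symm
    _ ≤ ∑ _j ∈ sold H, opts.length := Finset.sum_le_sum fun j _ => hH.price_le j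
    _ ≤ opts.length * opts.length := by
      rw [Finset.sum_const, smul_eq_mul]
      exact Nat.mul_le_mul_right _ hcard

theorem mem_unmatched {i : ℕ} : i ∈ unmatched opts H ↔
    i < opts.length ∧ ∀ j ∈ opts.getD i [], ¬ owner H j = i + 1 := by
  simp [unmatched]

/-- If there are distinct representatives, an unmatched person has a cheap option. -/
theorem Inv.exists_price_lt (hH : Inv opts H) {f : ℕ → ℕ}
    (hf : ∀ i < opts.length, f i ∈ opts.getD i [])
    (hinj : ∀ i < opts.length, ∀ i' < opts.length, f i = f i' → i = i') {i : ℕ}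
    (hi : i ∈ unmatched opts H) : ∃ j ∈ opts.getD i [], price H j < opts.length := by
  by_contra! hexp
  obtain ⟨hin, hfree⟩ := mem_unmatched.1 hi
  have hown : ∀ j, owner H j ≠ i + 1 := fun j h => hfree j (hH.option j i h).2.1 h
  have hcard : (sold H).card < opts.length := by
    have h₁ : (sold H).card ≤ ((Finset.range opts.length).erase i).card := by
      refine Finset.card_le_card_of_injOn (fun j => owner H j - 1) (fun j hj => ?_)
        fun j hj j' hj' h => ?_
      · obtain ⟨p, hp, h⟩ := hH.owner_mem hj
        have : p ≠ i := by rintro rfl; exact hown j h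
        simp [h, hp, this]
      · obtain ⟨p, hp, h₁⟩ := hH.owner_mem hj
        obtain ⟨p', hp', h₂⟩ := hH.owner_mem hj'
        exact hH.inj j j' (by simp only at h; omega) (by omega)
    rw [Finset.card_erase_of_mem (by simpa using hin), Finset.card_range] at h₁
    omega
  -- Person `i` owns nothing, so fewer slots are sold than there are persons, and some price level
  -- `k` between 1 and `opts.length` is attained by no slot.
  obtain ⟨k, hk, hkn⟩ : ∃ k ∈ Finset.Icc 1 opts.length, k ∉ (sold H).image (price H) := by
    by_contra! h
    have := (Finset.card_le_card h).trans Finset.card_image_le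
    simp at this
    omega
  rw [Finset.mem_Icc] at hk
  have hne : ∀ j, k ≤ price H j → j ∈ (sold H).filter fun j => k < price H j := by
    intro j hj
    have hs : j ∈ sold H := mem_sold.2 (by omega)
    refine Finset.mem_filter.2 ⟨hs, lt_of_le_of_ne hj ?_⟩
    rintro rfl
    exact hkn (Finset.mem_image_of_mem _ hs)
  set S := (sold H).filter fun j => k < price H j with hS
  -- This violates Hall's condition. The options of `i` cost at least `k` by assumption. Those of an
  -- owner of a slot above `k` also cost at least `k`, being at most one cheaper than the owned
  -- slot. Since nothing costs exactly `k`, all options of the persons in `Q` lie in `S`, which has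
  -- one element less than `Q`.
  set Q := insert i (S.image fun j => owner H j - 1) with hQ
  have hQS : Q.card = S.card + 1 := by
    rw [hQ, Finset.card_insert_of_notMem, Finset.card_image_of_injOn]
    · intro j hj j' hj' h
      obtain ⟨p, hp, h₁⟩ := hH.owner_mem (Finset.mem_filter.1 hj).1
      obtain ⟨p', hp', h₂⟩ := hH.owner_mem (Finset.mem_filter.1 hj').1
      exact hH.inj j j' (by simp only at h; omega) (by omega)
    · intro h
      obtain ⟨j, hj, h⟩ := Finset.mem_image.1 h
      obtain ⟨p, hp, h₁⟩ := hH.owner_mem (Finset.mem_filter.1 hj).1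
      exact hown j (by omega)
  have hQn : ∀ p ∈ Q, p < opts.length ∧ f p ∈ S := by
    intro p hp
    rcases Finset.mem_insert.1 hp with rfl | hp
    · exact ⟨hin, hne _ (hk.2.trans (hexp _ (hf p hin)))⟩
    · obtain ⟨j, hj, rfl⟩ := Finset.mem_image.1 hp
      obtain ⟨hj₁, hj₂⟩ := Finset.mem_filter.1 hj
      obtain ⟨p, hp, h₁⟩ := hH.owner_mem hj₁
      have h₂ := hH.option j p h₁
      have h₃ := h₂.2.2 _ (hf p hp)
      rw [h₁, Nat.add_sub_cancel]
      exact ⟨hp, hne _ (by omega)⟩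
  have := Finset.card_le_card_of_injOn f (fun p hp => (hQn p hp).2)
    fun p hp p' hp' h => hinj p (hQn p hp).1 p' (hQn p' hp').1 h
  omega

theorem bids_spec {b : ℕ × ℕ} (hb : b ∈ bids opts H) : ∃ i ∈ unmatched opts H,
    b.1 ∈ opts.getD i [] ∧ b.2 = i + 1 ∧ ∀ j' ∈ opts.getD i [], price H b.1 ≤ price H j' := by
  simp only [bids, List.mem_flatMap, List.mem_map, cheapest, List.mem_filter, decide_eq_true_eq] at hb
  obtain ⟨i, hi, j, ⟨hj, hmin⟩, rfl⟩ := hb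
  exact ⟨i, hi, hj, rfl, hmin⟩

theorem bids_ne_nil {i : ℕ} (hi : i ∈ unmatched opts H) (hne : opts.getD i [] ≠ []) :
    bids opts H ≠ [] := by
  obtain ⟨j, hj, hmin⟩ := Finset.exists_min_image (opts.getD i []).toFinset (price H)
    (by simpa [List.toFinset_nonempty_iff] using hne)
  refine List.ne_nil_of_mem (a := (j, i + 1)) ?_
  simp only [bids, List.mem_flatMap, List.mem_map, cheapest, List.mem_filter, decide_eq_true_eq]
  exact ⟨i, hi, j, ⟨by simpa using hj, fun j' hj' => hmin j' (by simpa using hj')⟩, rfl⟩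

theorem step_cases : (bids opts H = [] ∧ step opts H = H) ∨
    ∃ b ∈ bids opts H, step opts H = b :: H := by
  unfold step
  cases h : bids opts H with
  | nil => exact Or.inl ⟨rfl, rfl⟩
  | cons b l => exact Or.inr ⟨b, List.mem_cons_self, rfl⟩

/-- The bidder owned nothing before, so ownership stays injective. The distinct representatives
serve only to keep the prices bounded: they guarantee that the cheapest option of an unmatched
person costs less than `opts.length`. -/
theorem Inv.step (hH : Inv opts H) {f : ℕ → ℕ} (hf : ∀ i < opts.length, f i ∈ opts.getD i [])
    (hinj : ∀ i < opts.length, ∀ i' < opts.length, f i = f i' → i = i') :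
    Inv opts (step opts H) := by
  rcases step_cases (opts := opts) (H := H) with ⟨-, h⟩ | ⟨⟨j, p⟩, hb, h⟩
  · rwa [h]
  · rw [h]
    obtain ⟨i, hi, hj, rfl, hmin⟩ := bids_spec hb
    obtain ⟨j₀, hj₀, hlt⟩ := hH.exists_price_lt hf hinj hi
    obtain ⟨hin, hfree⟩ := mem_unmatched.1 hi
    have hown : ∀ j, owner H j ≠ i + 1 := fun j h => hfree j (hH.option j i h).2.1 h
    refine ⟨fun x q hx => ?_, fun x hx => ?_, fun x x' hxx hx => ?_, fun x => ?_⟩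
    · rw [owner_cons] at hx
      split_ifs at hx with hjx
      · obtain rfl : i = q := by omega
        subst hjx
        refine ⟨hin, hj, fun j' hj' => ?_⟩
        have := hmin j' hj'
        simp only [price_cons, if_true]
        simp only at this
        omega
      · obtain ⟨h₁, h₂, h₃⟩ := hH.option x q hx
        refine ⟨h₁, h₂, fun j' hj' => ?_⟩
        have := h₃ j' hj'
        rw [price_cons, price_cons, if_neg hjx]
        omega
    · rw [owner_cons]
      split_ifs with hjx
      · omega
      · rw [price_cons, if_neg hjx] at hx
        exact hH.owned x (by omega)
    · rw [owner_cons] at hxx hx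
      rw [owner_cons] at hxx
      split_ifs at hxx hx with h₁ h₂ h₂
      · exact h₁.symm.trans h₂
      · exact absurd hxx.symm (hown x')
      · exact absurd hxx (hown x)
      · exact hH.inj x x' hxx hx
    · rw [price_cons]
      split_ifs with hjx
      · have := hmin j₀ hj₀
        simp only at this
        subst hjx
        omega
      · simpa using hH.price_le x

/-- If nobody is unmatched at the end, owned options are distinct representatives, whatever happened
before. Conversely, if representatives exist, every person has an option, so a bid is placed in
every step as long as somebody is unmatched; after the last step the history would be longer than
`Inv.length_le` permits. -/
theorem hasSDR_iff : hasSDR opts = true ↔ ∃ f : ℕ → ℕ, (∀ i < opts.length, f i ∈ opts.getD i []) ∧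
    ∀ i < opts.length, ∀ i' < opts.length, f i = f i' → i = i' := by
  constructor
  · intro h
    rw [hasSDR, List.isEmpty_iff] at h
    generalize (Auction.step opts)^[_] [] = H at h
    have : ∀ i, ∃ j, i < opts.length → j ∈ opts.getD i [] ∧ owner H j = i + 1 := by
      intro i
      by_contra! hi
      have : i ∈ unmatched opts H :=
        mem_unmatched.2 ⟨(hi 0).1, fun j hj => (hi j).2 hj⟩
      rw [h] at this
      simp at this
    choose f hf using this
    refine ⟨f, fun i hi => (hf i hi).1, fun i hi i' hi' e => ?_⟩
    have h₁ := (hf i hi).2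
    have h₂ := (hf i' hi').2
    rw [e] at h₁
    omega
  · rintro ⟨f, hf, hinj⟩
    have key : ∀ t, Inv opts ((Auction.step opts)^[t] []) ∧
        (unmatched opts ((Auction.step opts)^[t] []) = [] ∨
          ((Auction.step opts)^[t] []).length = t) := by
      intro t
      induction t with
      | zero => exact ⟨inv_nil opts, Or.inr rfl⟩
      | succ t ih =>
        rw [Function.iterate_succ_apply']
        generalize (Auction.step opts)^[t] [] = H at ih
        refine ⟨ih.1.step hf hinj, ?_⟩
        rcases step_cases (opts := opts) (H := H) with ⟨h₁, h₂⟩ | ⟨b, hb, h₂⟩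
        · left
          rw [h₂]
          by_contra hne
          obtain ⟨i, hi⟩ := List.exists_mem_of_ne_nil _ hne
          exact bids_ne_nil hi (List.ne_nil_of_mem (hf i (mem_unmatched.1 hi).1)) h₁
        · right
          rcases ih.2 with h | h
          · rw [bids, h] at hb
            simp at hb
          · rw [h₂, List.length_cons, h]
    obtain ⟨h₁, h₂⟩ := key (opts.length * opts.length + 1)
    rw [hasSDR, List.isEmpty_iff]
    rcases h₂ with h₂ | h₂
    · exact h₂
    · have := h₁.length_le
      omega

end Auction

namespace PolyTime

open Auction

variable {α : Type} [Enc α]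

theorem price {H : α → List (ℕ × ℕ)} {j : α → ℕ} (hH : PolyTime H) (hj : PolyTime j) :
    PolyTime fun a => price (H a) (j a) :=
  length (filter (c := fun a (h : ℕ × ℕ) => decide (h.1 = j a))
    (decide_eq (fst.comp snd) (hj.comp fst)) hH)

theorem owner {H : α → List (ℕ × ℕ)} {j : α → ℕ} (hH : PolyTime H) (hj : PolyTime j) :
    PolyTime fun a => owner (H a) (j a) :=
  snd.comp ((headD (0, 0)).comp (filter (c := fun a (h : ℕ × ℕ) => decide (h.1 = j a))
    (decide_eq (fst.comp snd) (hj.comp fst)) hH))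

theorem unmatched {opts : α → List (List ℕ)} {H : α → List (ℕ × ℕ)} (ho : PolyTime opts)
    (hH : PolyTime H) : PolyTime fun a => unmatched (opts a) (H a) :=
  filter (c := fun a i => decide (∀ j ∈ (opts a).getD i [], ¬ Auction.owner (H a) j = i + 1))
    (decide_forall_mem (c := fun (x : α × ℕ) j => ¬ Auction.owner (H x.1) j = x.2 + 1)
      (decide_not (decide_eq (owner (hH.comp (fst.comp fst)) snd) (succ (snd.comp fst))))
      (getD (ho.comp fst) snd [])) (range ho.length)

theorem cheapest {opts : α → List (List ℕ)} {H : α → List (ℕ × ℕ)} {i : α → ℕ}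
    (ho : PolyTime opts) (hH : PolyTime H) (hi : PolyTime i) :
    PolyTime fun a => cheapest (opts a) (H a) (i a) :=
  filter (c := fun a j => decide (∀ j' ∈ (opts a).getD (i a) [],
      Auction.price (H a) j ≤ Auction.price (H a) j'))
    (decide_forall_mem (c := fun (x : α × ℕ) j' => Auction.price (H x.1) x.2 ≤
        Auction.price (H x.1) j')
      (decide_le (price (hH.comp (fst.comp fst)) (snd.comp fst))
        (price (hH.comp (fst.comp fst)) snd))
      ((getD ho hi []).comp fst)) (getD ho hi [])

theorem bids {opts : α → List (List ℕ)} {H : α → List (ℕ × ℕ)} (ho : PolyTime opts)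
    (hH : PolyTime H) : PolyTime fun a => bids (opts a) (H a) :=
  flatMap (g := fun a i => (Auction.cheapest (opts a) (H a) i).map fun j => (j, i + 1))
    (map (g := fun (x : α × ℕ) j => (j, x.2 + 1)) (pair snd (succ (snd.comp fst)))
      (cheapest (ho.comp fst) (hH.comp fst) snd)) (unmatched ho hH)

/-- A round adds at most one bid. Its slot is an entry of `opts` and the number of its bidder is at
most the length of `opts`, so the history grows by an amount that does not depend on its own size.
-/
theorem hasSDR {opts : α → List (List ℕ)} (ho : PolyTime opts) :
    PolyTime fun a => hasSDR (opts a) := by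
  have hb : PolyTime fun x : α × List (ℕ × ℕ) => Auction.bids (opts x.1) x.2 :=
    bids (ho.comp fst) snd
  obtain ⟨R, hR⟩ := ho.size_le
  have h := iterate (h := fun a H => step (opts a) H) (s := fun _ => ([] : List (ℕ × ℕ)))
    (n := fun a => (opts a).length * (opts a).length + 1)
    (cond (isEmpty.comp hb) snd (cons ((headD (0, 0)).comp hb) snd)) (const [])
    (succ (mul ho.length ho.length)) ⟨3 * R + 5, fun a H => ?_⟩
  · exact isEmpty.comp (unmatched ho h)
  · simp only [Polynomial.eval_add, Polynomial.eval_mul, Polynomial.eval_ofNat]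
    rcases step_cases (opts := opts a) (H := H) with ⟨-, h⟩ | ⟨⟨j, p⟩, hb, h⟩
    · rw [h]
      omega
    · obtain ⟨i, hi, hj, rfl, -⟩ := bids_spec hb
      obtain ⟨hin, -⟩ := mem_unmatched.1 hi
      have h₁ := length_le_size (opts a)
      have h₂ := size_le_of_mem hj
      have h₃ : (opts a).getD i [] ∈ opts a := by
        rw [List.getD_eq_getElem _ _ hin]
        exact List.getElem_mem hin
      have h₄ := size_le_of_mem h₃
      have h₅ := hR a
      rw [h, size_cons, size_pair, size_nat (i + 1)]
      simp only at h₂ ⊢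
      omega

end PolyTime


/-! ### Selections with prescribed numbers of elements -/

namespace Selection

/-- Every list repeated as often as its demand says. -/
def persons (C : List (List ℕ × ℕ)) : List (List ℕ) := C.flatMap fun p => List.replicate p.2 p.1

/-- Decides whether one can select elements such that all but one element of every list in `E` and
the prescribed number of elements of every list in `C` are selected. -/
def solvable (E : List (List ℕ)) (C : List (List ℕ × ℕ)) : Bool :=
  decide ((E ++ persons C).length = E.flatten.length) && Auction.hasSDR (E ++ persons C)

theorem hasSDR_iff_forall₂ (P : List (List ℕ)) :
    Auction.hasSDR P = true ↔ ∃ L : List ℕ, L.Nodup ∧ List.Forall₂ (· ∈ ·) L P := by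
  rw [Auction.hasSDR_iff]
  constructor
  · rintro ⟨f, hf, hinj⟩
    refine ⟨(List.range P.length).map f, ?_, ?_⟩
    · refine List.Nodup.map_on (fun i hi i' hi' h => ?_) List.nodup_range
      exact hinj i (List.mem_range.1 hi) i' (List.mem_range.1 hi') h
    · rw [List.forall₂_iff_get]
      refine ⟨by simp, fun i h₁ h₂ => ?_⟩
      have := hf i h₂
      rw [List.getD_eq_getElem _ _ h₂] at this
      simpa using this
  · rintro ⟨L, hL, h⟩
    rw [List.forall₂_iff_get] at h
    obtain ⟨hlen, h⟩ := h
    refine ⟨fun i => L.getD i 0, fun i hi => ?_, fun i hi i' hi' e => ?_⟩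
    · have := h i (hlen ▸ hi) hi
      simp only
      rw [List.getD_eq_getElem _ _ hi, List.getD_eq_getElem _ _ (hlen ▸ hi)]
      simpa using this
    · simp only at e
      rw [List.getD_eq_getElem _ _ (hlen ▸ hi), List.getD_eq_getElem _ _ (hlen ▸ hi')] at e
      exact (hL.getElem_inj_iff).1 e

theorem forall₂_append_right {M : List ℕ} {P₁ P₂ : List (List ℕ)}
    (h : List.Forall₂ (· ∈ ·) M (P₁ ++ P₂)) : ∃ M₁ M₂, List.Forall₂ (· ∈ ·) M₁ P₁ ∧
      List.Forall₂ (· ∈ ·) M₂ P₂ ∧ M = M₁ ++ M₂ :=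
  ⟨_, _, List.forall₂_take_append M P₁ P₂ h, List.forall₂_drop_append M P₁ P₂ h,
    (List.take_append_drop _ _).symm⟩

theorem persons_cons (p : List ℕ × ℕ) (C : List (List ℕ × ℕ)) :
    persons (p :: C) = List.replicate p.2 p.1 ++ persons C := rfl

theorem forall₂_mem_replicate {M l : List ℕ} {k : ℕ} :
    List.Forall₂ (· ∈ ·) M (List.replicate k l) ↔ M.length = k ∧ ∀ x ∈ M, x ∈ l := by
  induction M generalizing k with
  | nil => cases k <;> simp [List.replicate_succ]
  | cons x M ih => cases k <;> simp [List.replicate_succ, ih, and_left_comm]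

theorem mem_flatten_of_forall₂ {C : List (List ℕ × ℕ)} {M : List ℕ}
    (h : List.Forall₂ (· ∈ ·) M (persons C)) {x : ℕ} (hx : x ∈ M) :
    x ∈ (C.map Prod.fst).flatten := by
  induction C generalizing M with
  | nil =>
    simp [persons] at h
    simp [h] at hx
  | cons p C ih =>
    rw [persons_cons] at h
    obtain ⟨M₁, M₂, h₁, h₂, rfl⟩ := forall₂_append_right h
    rw [List.map_cons, List.flatten_cons, List.mem_append]
    rcases List.mem_append.1 hx with hx | hx
    · exact Or.inl ((forall₂_mem_replicate.1 h₁).2 x hx)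
    · exact Or.inr (ih h₂ hx)

/-- As the lists are disjoint, the elements of `M` that lie in one of them are exactly the
representatives of its own copies. -/
theorem countP_of_forall₂ {C : List (List ℕ × ℕ)} {M : List ℕ}
    (hC : (C.map Prod.fst).flatten.Nodup) (hM : M.Nodup)
    (h : List.Forall₂ (· ∈ ·) M (persons C)) :
    ∀ p ∈ C, p.1.countP (fun x => decide (x ∈ M)) = p.2 := by
  induction C generalizing M with
  | nil => simp
  | cons p C ih =>
    rw [persons_cons] at h
    obtain ⟨M₁, M₂, h₁, h₂, rfl⟩ := forall₂_append_right h
    rw [List.map_cons, List.flatten_cons, List.nodup_append] at hC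
    obtain ⟨hp, hC', hdis⟩ := hC
    obtain ⟨hM₁, hM₂, -⟩ := List.nodup_append.1 hM
    obtain ⟨hlen, hmem⟩ := forall₂_mem_replicate.1 h₁
    intro q hq
    rcases List.mem_cons.1 hq with rfl | hq
    · rw [← hlen, List.countP_eq_length_filter]
      refine List.Perm.length_eq ((List.perm_ext_iff_of_nodup (hp.filter _) hM₁).2 fun x => ?_)
      simp only [List.mem_filter, decide_eq_true_eq, List.mem_append]
      refine ⟨?_, fun hx => ⟨hmem x hx, Or.inl hx⟩⟩
      rintro ⟨hx, hx' | hx'⟩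
      · exact hx'
      · exact absurd rfl (hdis x hx x (mem_flatten_of_forall₂ h₂ hx'))
    · rw [← ih hC' hM₂ h₂ q hq]
      refine List.countP_congr fun x hx => ?_
      simp only [decide_eq_true_eq, List.mem_append]
      refine or_iff_right fun hx' => ?_
      exact hdis x (hmem x hx') x
        (List.mem_flatten.2 ⟨q.1, List.mem_map.2 ⟨q, hq, rfl⟩, hx⟩) rfl

theorem forall₂_flatMap_filter {C : List (List ℕ × ℕ)} {S : ℕ → Bool}
    (h : ∀ p ∈ C, p.1.countP S = p.2) :
    List.Forall₂ (· ∈ ·) ((C.map Prod.fst).flatten.filter S) (persons C) := by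
  induction C with
  | nil => simp [persons]
  | cons p C ih =>
    rw [persons_cons, List.map_cons, List.flatten_cons, List.filter_append]
    refine List.rel_append ?_ (ih fun q hq => h q (List.mem_cons_of_mem _ hq))
    rw [forall₂_mem_replicate, ← List.countP_eq_length_filter]
    exact ⟨h p List.mem_cons_self, fun x hx => (List.mem_filter.1 hx).1⟩

theorem persons_map_one (E : List (List ℕ)) : persons (E.map fun l => (l, 1)) = E := by
  induction E with
  | nil => rfl
  | cons l E ih => rw [List.map_cons, persons_cons, ih]; rfl

/-- There are as many persons as elements, so distinct representatives use up every element. Those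
that represent a list in `E` are the elements left out, and those that represent a copy of a list in
`C` are the selected ones. -/
theorem solvable_iff {E : List (List ℕ)} {C : List (List ℕ × ℕ)} (hE : E.flatten.Nodup)
    (hC : (C.map Prod.fst).flatten.Perm E.flatten) :
    solvable E C = true ↔ ∃ S : ℕ → Bool, (∀ l ∈ E, l.countP (fun x => !S x) = 1) ∧
      ∀ p ∈ C, p.1.countP S = p.2 := by
  have hE₁ : ((E.map fun l => (l, 1)).map Prod.fst) = E := by simp [Function.comp_def]
  rw [solvable, Bool.and_eq_true, decide_eq_true_eq, hasSDR_iff_forall₂]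
  constructor
  · rintro ⟨hlen, L, hL, h⟩
    obtain ⟨L₁, L₂, h₁, h₂, rfl⟩ := forall₂_append_right h
    obtain ⟨hL₁, hL₂, hdis⟩ := List.nodup_append.1 hL
    rw [← persons_map_one E] at h₁
    have hsub : ∀ x ∈ L₁ ++ L₂, x ∈ E.flatten := by
      intro x hx
      rcases List.mem_append.1 hx with hx | hx
      · simpa only [hE₁] using mem_flatten_of_forall₂ h₁ hx
      · exact hC.subset (mem_flatten_of_forall₂ h₂ hx)
    have hperm : (L₁ ++ L₂).Perm E.flatten := by
      refine List.Subperm.perm_of_length_le (hL.subperm hsub) ?_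
      rw [← hlen, h.length_eq]
    refine ⟨fun x => decide (x ∈ L₂), fun l hl => ?_,
      countP_of_forall₂ (hC.nodup_iff.2 hE) hL₂ h₂⟩
    have := countP_of_forall₂ (by rwa [hE₁]) hL₁ h₁ (l, 1) (List.mem_map.2 ⟨l, hl, rfl⟩)
    refine Eq.trans (List.countP_congr fun x hx => ?_) this
    have hx' := hperm.symm.subset (List.mem_flatten.2 ⟨l, hl, hx⟩)
    simp only [Bool.not_eq_true', decide_eq_false_iff_not, decide_eq_true_eq]
    refine ⟨fun hn => (List.mem_append.1 hx').resolve_right hn, fun hx₁ hx₂ => ?_⟩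
    exact hdis x hx₁ x hx₂ rfl
  · rintro ⟨S, hS₁, hS₂⟩
    have h₁ := forall₂_flatMap_filter (C := E.map fun l => (l, 1)) (S := fun x => !S x) (by
      simpa using hS₁)
    have h₂ := forall₂_flatMap_filter hS₂
    rw [persons_map_one, hE₁] at h₁
    have h := List.rel_append h₁ h₂
    have hperm : (E.flatten.filter (fun x => !S x) ++
        (C.map Prod.fst).flatten.filter S).Perm E.flatten :=
      (List.perm_append_comm.trans ((hC.filter S).append_right _)).trans
        (List.filter_append_perm S E.flatten)
    exact ⟨by rw [← h.length_eq, hperm.length_eq], _, hperm.nodup_iff.2 hE, h⟩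

end Selection

namespace PolyTime

variable {α : Type} [Enc α]

theorem solvable {E : α → List (List ℕ)} {C : α → List (List ℕ × ℕ)} (hE : PolyTime E)
    (hC : PolyTime C) : PolyTime fun a => Selection.solvable (E a) (C a) := by
  have hP : PolyTime fun a => E a ++ Selection.persons (C a) :=
    append hE (flatMap (g := fun _ (p : List ℕ × ℕ) => List.replicate p.2 p.1)
      (replicate (snd.comp snd) (fst.comp snd)) hC)
  have hflat : PolyTime fun a => (E a).flatten :=
    (flatMap (g := fun _ (l : List ℕ) => l) snd hE).congr_enc fun a => by
      rw [← List.flatMap_id]; rfl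
  exact and (decide_eq hP.length hflat.length) (hasSDR hP)

end PolyTime

/-! ### Labels around a cycle of a permutation -/

section Cycles

variable {α : Type} [Fintype α] (f : Equiv.Perm α)

open Classical in
/-- The elements of the cycle of `f` that contains `x`. -/
noncomputable def cyc (x : α) : Finset α := Finset.univ.filter fun y => f.SameCycle x y

variable {f}

theorem mem_cyc {x y : α} : y ∈ cyc f x ↔ f.SameCycle x y := by simp [cyc]

theorem cyc_eq_of_sameCycle {x y : α} (h : f.SameCycle x y) : cyc f x = cyc f y := by
  ext z
  rw [mem_cyc, mem_cyc]
  exact ⟨fun h' => h.symm.trans h', fun h' => h.trans h'⟩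

theorem apply_mem_cyc {x y : α} : f y ∈ cyc f x ↔ y ∈ cyc f x := by
  rw [mem_cyc, mem_cyc, Equiv.Perm.sameCycle_apply_right]

theorem minimalPeriod_pos (x : α) : 0 < Function.minimalPeriod f x :=
  Function.minimalPeriod_pos_of_mem_periodicPts
    (f.injective.mem_periodicPts x)

theorem mem_cyc_iff_exists_iterate {x y : α} :
    y ∈ cyc f x ↔ ∃ i < Function.minimalPeriod f x, f^[i] x = y := by
  rw [mem_cyc]
  constructor
  · intro h
    obtain ⟨i, -, hi⟩ := h.exists_pow_eq'
    refine ⟨i % Function.minimalPeriod f x, Nat.mod_lt _ (minimalPeriod_pos x), ?_⟩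
    rw [Function.iterate_mod_minimalPeriod_eq, ← hi, Equiv.Perm.iterate_eq_pow]
  · rintro ⟨i, -, rfl⟩
    rw [Equiv.Perm.iterate_eq_pow]
    exact ⟨i, by simp⟩

theorem iterate_mem_cyc (x : α) (i : ℕ) : f^[i] x ∈ cyc f x := by
  rw [mem_cyc, Equiv.Perm.iterate_eq_pow]
  exact ⟨i, by simp⟩

theorem iterate_inj {α : Type} {f : Equiv.Perm α} {x : α} {i j : ℕ} (hi : i < Function.minimalPeriod f x)
    (hj : j < Function.minimalPeriod f x) (h : f^[i] x = f^[j] x) : i = j :=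
  Function.iterate_injOn_Iio_minimalPeriod hi hj h

theorem card_filter_comp_apply (x : α) (p : α → Prop) [DecidablePred p] :
    ((cyc f x).filter fun y => p (f y)).card = ((cyc f x).filter p).card := by
  refine Finset.card_bij (fun y _ => f y) (fun y hy => ?_) (fun y _ y' _ h => f.injective h)
    fun y hy => ⟨f.symm y, ?_, f.apply_symm_apply y⟩
  · rw [Finset.mem_filter] at hy ⊢
    exact ⟨apply_mem_cyc.2 hy.1, hy.2⟩
  · rw [Finset.mem_filter] at hy ⊢
    rw [f.apply_symm_apply, ← apply_mem_cyc, f.apply_symm_apply]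
    exact hy

/-- Around a cycle there are as many changes from `false` to `true` as from `true` to `false`. -/
theorem card_up_eq_card_down (x : α) (l : α → Bool) :
    ((cyc f x).filter fun y => l y = false ∧ l (f y) = true).card =
      ((cyc f x).filter fun y => l y = true ∧ l (f y) = false).card := by
  have h₁ := card_filter_comp_apply (f := f) x (fun y => l y = true)
  have h₂ := Finset.card_filter_add_card_filter_not (s := (cyc f x).filter fun y => l (f y) = true)
    (fun y => l y = false)
  have h₃ := Finset.card_filter_add_card_filter_not (s := (cyc f x).filter fun y => l y = true)
    (fun y => l (f y) = false)
  simp only [Finset.filter_filter, Bool.not_eq_false] at h₂ h₃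
  have h₄ : ((cyc f x).filter fun y => l (f y) = true ∧ l y = true) =
      (cyc f x).filter fun y => l y = true ∧ l (f y) = true :=
    Finset.filter_congr fun y _ => and_comm
  have h₅ : ((cyc f x).filter fun y => l (f y) = true ∧ l y = false) =
      (cyc f x).filter fun y => l y = false ∧ l (f y) = true :=
    Finset.filter_congr fun y _ => and_comm
  rw [h₄, h₅] at h₂
  omega

/-- Changes from `false` to `true` and back are equally frequent around a cycle, so it suffices to
count one kind. -/
theorem card_changes (x : α) (l : α → Bool) :
    ((cyc f x).filter fun y => l y ≠ l (f y)).card =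
      2 * ((cyc f x).filter fun y => l y = true ∧ l (f y) = false).card := by
  have h₁ := Finset.card_filter_add_card_filter_not (s := (cyc f x).filter fun y => l y ≠ l (f y))
    (fun y => l y = false)
  have h₂ := card_up_eq_card_down (f := f) x l
  simp only [Finset.filter_filter] at h₁
  have h₄ : ((cyc f x).filter fun y => l y ≠ l (f y) ∧ l y = false) =
      (cyc f x).filter fun y => l y = false ∧ l (f y) = true :=
    Finset.filter_congr fun y _ => by cases l y <;> cases l (f y) <;> simp
  have h₅ : ((cyc f x).filter fun y => l y ≠ l (f y) ∧ ¬ l y = false) =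
      (cyc f x).filter fun y => l y = true ∧ l (f y) = false :=
    Finset.filter_congr fun y _ => by cases l y <;> cases l (f y) <;> simp
  rw [h₄, h₅] at h₁
  omega

/-- Two changes mean a single change from `true` to `false`, say between `u` and `f u`. Read from `f
u` on, the labels are `false` up to the first `true`, and from there they cannot drop again before
the cycle closes at `u`. -/
theorem twoIntervals_iff (x : α) (l : α → Bool) : PlaneGraph.TwoIntervals f l x ↔
    ((cyc f x).filter fun y => l y ≠ l (f y)).card = 2 := by
  rw [card_changes]
  constructor
  · rintro ⟨y, hxy, a, b, ha, hb, hab, h₀, h₁⟩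
    rw [← card_up_eq_card_down, cyc_eq_of_sameCycle hxy]
    suffices ((cyc f y).filter fun y => l y = false ∧ l (f y) = true) = {f^[a - 1] y} by
      rw [this, Finset.card_singleton]
    ext z
    rw [Finset.mem_filter, Finset.mem_singleton, mem_cyc_iff_exists_iterate]
    constructor
    · rintro ⟨⟨i, hi, rfl⟩, hz₀, hz₁⟩
      rw [← Function.iterate_succ_apply' f] at hz₁
      have hia : i < a := by
        by_contra hia
        have := h₁ (i - a) (by omega)
        rw [Nat.add_sub_cancel' (by omega), hz₀] at this
        exact Bool.false_ne_true this
      have hia' : ¬ i + 1 < a := fun h => by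
        rw [h₀ _ h] at hz₁
        exact Bool.false_ne_true hz₁
      rw [show a - 1 = i by omega]
    · rintro rfl
      refine ⟨⟨a - 1, by omega, rfl⟩, h₀ _ (by omega), ?_⟩
      rw [← Function.iterate_succ_apply' f, Nat.succ_eq_add_one, Nat.sub_add_cancel ha]
      exact h₁ 0 hb
  · intro h
    obtain ⟨u, hu⟩ := Finset.card_eq_one.1 (Nat.eq_of_mul_eq_mul_left two_pos h)
    have hu' := Finset.mem_singleton_self u
    rw [← hu, Finset.mem_filter] at hu'
    obtain ⟨hxu, hu₁, hu₀⟩ := hu'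
    have hxy : f.SameCycle x (f u) := mem_cyc.1 (apply_mem_cyc.2 hxu)
    obtain ⟨j, hj, hju⟩ := mem_cyc_iff_exists_iterate.1
      (mem_cyc.2 (Equiv.Perm.sameCycle_apply_left.2 (Equiv.Perm.SameCycle.refl f u)))
    have hex : ∃ i, l (f^[i] (f u)) = true := ⟨j, by rw [hju, hu₁]⟩
    have hjp : j + 1 = Function.minimalPeriod f (f u) := by
      refine le_antisymm hj ?_
      refine Function.IsPeriodicPt.minimalPeriod_le (Nat.succ_pos j) ?_
      rw [Function.IsPeriodicPt, Function.IsFixedPt, Function.iterate_succ_apply', hju]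
    set a := Nat.find hex with ha
    have haj : a ≤ j := Nat.find_min' hex (by rw [hju, hu₁])
    have ha0 : 0 < a := by
      rw [Nat.pos_iff_ne_zero]
      intro h0
      have := Nat.find_spec hex
      rw [← ha, h0, Function.iterate_zero_apply, hu₀] at this
      exact Bool.false_ne_true this
    refine ⟨f u, hxy, a, Function.minimalPeriod f (f u) - a, ha0, by omega, by omega,
      fun i hi => ?_, fun i => ?_⟩
    · simpa using Nat.find_min hex hi
    · induction i with
      | zero => exact fun _ => Nat.find_spec hex
      | succ i ih =>
        intro hi
        by_contra hne
        have hi' := ih (by omega)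
        have : f^[a + i] (f u) ∈ (cyc f x).filter fun y => l y = true ∧ l (f y) = false := by
          rw [Finset.mem_filter, ← Function.iterate_succ_apply' f, cyc_eq_of_sameCycle hxy]
          exact ⟨iterate_mem_cyc _ _, hi', by simpa [← add_assoc] using hne⟩
        rw [hu, Finset.mem_singleton] at this
        have := iterate_inj (by omega) hj (this.trans hju.symm)
        omega

/-- Needed at vertices, where `S` compares an angle with its predecessor under `next`. -/
theorem card_changes_inv (x : α) (l : α → Bool) :
    ((cyc f x).filter fun y => l y ≠ l (f⁻¹ y)).card =
      ((cyc f x).filter fun y => l y ≠ l (f y)).card := by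
  rw [← card_filter_comp_apply]
  congr 1
  refine Finset.filter_congr fun y _ => ?_
  rw [show f⁻¹ (f y) = y from f.symm_apply_apply y]
  exact ne_comm

/-- The number of changes along a walk is odd iff the labels of its ends differ. -/
theorem odd_changes_iff {α : Type} {f : Equiv.Perm α} (x : α) (l : α → Bool) (k : ℕ) :
    Odd ((Finset.range k).filter fun j => l (f^[j] x) ≠ l (f (f^[j] x))).card ↔
      l x ≠ l (f^[k] x) := by
  induction k with
  | zero => simp
  | succ k ih =>
    rw [Finset.range_add_one, Finset.filter_insert, Function.iterate_succ_apply']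
    split_ifs with h
    · rw [Finset.card_insert_of_notMem (by simp), Nat.odd_add_one, ih]
      revert h
      cases l x <;> cases l (f^[k] x) <;> cases l (f (f^[k] x)) <;> simp
    · rw [ih, not_not.1 h]

theorem card_filter_segment {x : α} {k : ℕ} (hk : k ≤ Function.minimalPeriod f x) (p : α → Prop)
    [DecidablePred p] [DecidablePred fun y => ∃ j < k, f^[j] x = y] :
    ((cyc f x).filter fun y => p y ∧ ∃ j < k, f^[j] x = y).card =
      ((Finset.range k).filter fun j => p (f^[j] x)).card := by
  symm
  refine Finset.card_bij (fun j _ => f^[j] x) (fun j hj => ?_) (fun j hj j' hj' h => ?_)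
    fun y hy => ?_
  · rw [Finset.mem_filter, Finset.mem_range] at hj
    exact Finset.mem_filter.2 ⟨iterate_mem_cyc _ _, hj.2, j, hj.1, rfl⟩
  · rw [Finset.mem_filter, Finset.mem_range] at hj hj'
    exact iterate_inj (hj.1.trans_le hk) (hj'.1.trans_le hk) h
  · obtain ⟨-, hp, j, hj, rfl⟩ := Finset.mem_filter.1 hy
    exact ⟨j, Finset.mem_filter.2 ⟨Finset.mem_range.2 hj, hp⟩, rfl⟩

end Cycles

/-! ### Labels with prescribed changes exist: the sphere is simply connected -/

section Incidence

open Module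

variable {X Y : Type} [Fintype Y] [DecidableEq X]

/-- The incidence map of a graph with vertices `X` and edges `Y` from `p y` to `q y`. -/
noncomputable def incidence (p q : Y → X) : (Y → ZMod 2) →ₗ[ZMod 2] (X → ZMod 2) :=
  Fintype.linearCombination (ZMod 2) fun y => Pi.single (p y) 1 + Pi.single (q y) 1

theorem incidence_apply (p q : Y → X) (c : Y → ZMod 2) (x : X) :
    incidence p q c x = (∑ y, if p y = x then c y else 0) + ∑ y, if q y = x then c y else 0 := by
  rw [incidence, Fintype.linearCombination_apply, Finset.sum_apply, ← Finset.sum_add_distrib]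
  refine Finset.sum_congr rfl fun y _ => ?_
  simp only [Pi.smul_apply, Pi.add_apply, Pi.single_apply, smul_eq_mul, mul_add, mul_ite, mul_one,
    mul_zero, eq_comm (a := x)]

/-- The incidence map of a connected graph has corank at most one. -/
theorem card_le_finrank_range_incidence [Fintype X] (p q : Y → X) (x₀ : X)
    (hconn : ∀ x, Relation.EqvGen (fun x x' => ∃ y, p y = x ∧ q y = x') x x₀) :
    Fintype.card X ≤ finrank (ZMod 2) (LinearMap.range (incidence p q)) + 1 := by
  classical
  have hself : ∀ g : X → ZMod 2, g + g = 0 := fun g => funext fun x => CharTwo.add_self_eq_zero _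
  have hdiff : ∀ x x', Relation.EqvGen (fun x x' => ∃ y, p y = x ∧ q y = x') x x' →
      (Pi.single x 1 + Pi.single x' 1 : X → ZMod 2) ∈ LinearMap.range (incidence p q) := by
    intro x x' h
    induction h with
    | rel x x' h =>
      obtain ⟨y, rfl, rfl⟩ := h
      exact ⟨Pi.single y 1, by
        rw [incidence, Fintype.linearCombination_apply_single, one_smul]⟩
    | refl x => rw [hself]; exact Submodule.zero_mem _
    | symm x x' _ ih => rwa [add_comm]
    | trans x x' x'' _ _ ih₁ ih₂ =>
      have := Submodule.add_mem _ ih₁ ih₂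
      rwa [add_assoc, ← add_assoc (Pi.single x' 1) (Pi.single x' 1), hself,
        zero_add] at this
  -- Modulo the range, all unit vectors coincide with the one at `x₀`, because the graph is
  -- connected.
  have htop : (⊤ : Submodule (ZMod 2) (X → ZMod 2)) ≤ LinearMap.range (incidence p q) ⊔
      Submodule.span (ZMod 2) {Pi.single x₀ 1} := by
    intro w _
    rw [pi_eq_sum_univ' w]
    refine Submodule.sum_mem _ fun x _ => Submodule.smul_mem _ _ ?_
    have h₁ := Submodule.mem_sup_left (T := Submodule.span (ZMod 2) {Pi.single x₀ 1})
      (hdiff x x₀ (hconn x))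
    have h₂ := Submodule.mem_sup_right (S := LinearMap.range (incidence p q))
      (Submodule.mem_span_singleton_self (R := ZMod 2) (Pi.single x₀ 1 : X → ZMod 2))
    have := Submodule.add_mem _ h₁ h₂
    rw [add_assoc, hself, add_zero] at this
    convert this using 1
  have h₁ := Submodule.finrank_mono htop
  rw [finrank_top, Module.finrank_fintype_fun_eq_card] at h₁
  have h₂ := Submodule.finrank_add_le_finrank_add_finrank (LinearMap.range (incidence p q))
    (Submodule.span (ZMod 2) {Pi.single x₀ 1})
  have h₃ := finrank_span_le_card (R := ZMod 2) ({Pi.single x₀ 1} : Set (X → ZMod 2))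
  simp only [Set.toFinset_singleton, Finset.card_singleton] at h₃
  omega

end Incidence

namespace PlaneGraph

variable (G : PlaneGraph)

theorem rev_rev (d : G.Dart) : G.rev (G.rev d) = d := by
  obtain ⟨e, b⟩ := d
  simp [rev, dartRev]

theorem rev_fst (d : G.Dart) : (G.rev d).1 = d.1 := rfl

theorem faceNext_apply (d : G.Dart) : G.faceNext d = G.next⁻¹ (G.rev d) := rfl

/-- A relation between darts that is compatible with `next` and `rev` holds everywhere. -/
theorem connected_induction {r : G.Dart → G.Dart → Prop} (hr : Equivalence r)
    (hnext : ∀ d, r d (G.next d)) (hrev : ∀ d, r d (G.rev d)) (x y : G.Dart) : r x y := by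
  obtain ⟨g, hg, rfl⟩ := G.connected x y
  induction hg using Subgroup.closure_induction generalizing x with
  | mem g hg =>
    rcases hg with rfl | hg
    · exact hnext x
    · rw [Set.mem_singleton_iff] at hg
      subst hg
      exact hrev x
  | one => exact hr.refl x
  | mul g h _ _ ihg ihh => exact hr.trans (ihh x) (ihg _)
  | inv g _ ih =>
    have := ih (g⁻¹ x)
    rw [show g (g⁻¹ x) = x from g.apply_symm_apply x] at this
    exact hr.symm this

/-- The faces of `G`. -/
abbrev Face : Type := Quotient (Equiv.Perm.SameCycle.setoid G.faceNext)

def face (d : G.Dart) : G.Face := Quotient.mk _ d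

theorem origin_eq_iff {d d' : G.Dart} : G.origin d = G.origin d' ↔ G.next.SameCycle d d' :=
  Quotient.eq

theorem face_eq_iff {d d' : G.Dart} : G.face d = G.face d' ↔ G.faceNext.SameCycle d d' :=
  Quotient.eq

theorem origin_next (d : G.Dart) : G.origin (G.next d) = G.origin d :=
  G.origin_eq_iff.2 (Equiv.Perm.sameCycle_apply_left.2 (Equiv.Perm.SameCycle.refl _ _))

theorem origin_next_inv (d : G.Dart) : G.origin (G.next⁻¹ d) = G.origin d :=
  (G.origin_next _).symm.trans (congrArg G.origin (G.next.apply_symm_apply d))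

theorem origin_faceNext (d : G.Dart) : G.origin (G.faceNext d) = G.origin (G.rev d) :=
  G.origin_next_inv _

open Classical Module in
/-- If the changes `A` across darts at their origins and the changes `L` on the left of darts sum up
to zero around all vertices, faces, and edges, then they are the changes of some labeling. -/
theorem exists_potential (A L : G.Dart → ZMod 2)
    (hv : ∀ v, ∑ d, (if G.origin d = v then A d else 0) = 0)
    (hf : ∀ w, ∑ d, (if G.face d = w then L d else 0) = 0)
    (he : ∀ d, A d + A (G.rev d) + L d + L (G.rev d) = 0) :
    ∃ l : G.Dart → ZMod 2, (∀ d, A d = l d + l (G.next⁻¹ d)) ∧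
      ∀ d, L d = l d + l (G.faceNext d) := by
  -- The vertices, faces and edges of `G` are the nodes of a new graph in which every dart joins its
  -- edge to its origin and to the face on its left. Its `4m` arcs cut the sphere into `2m`
  -- quadrilaterals, which are the angles of `G`, and `δ` maps a labeling of these to the arcs
  -- across which it changes.
  let p : G.Dart ⊕ G.Dart → G.Vertex ⊕ G.Face ⊕ Fin G.numEdges :=
    Sum.elim (fun d => Sum.inl (G.origin d)) fun d => Sum.inr (Sum.inl (G.face d))
  let q : G.Dart ⊕ G.Dart → G.Vertex ⊕ G.Face ⊕ Fin G.numEdges :=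
    Sum.elim (fun d => Sum.inr (Sum.inr d.1)) fun d => Sum.inr (Sum.inr d.1)
  let δ : (G.Dart → ZMod 2) →ₗ[ZMod 2] (G.Dart ⊕ G.Dart → ZMod 2) :=
    { toFun := fun l => Sum.elim (fun d => l d + l (G.next⁻¹ d)) fun d => l d + l (G.faceNext d)
      map_add' := fun l l' => by
        funext y
        rcases y with d | d <;> simp <;> ring
      map_smul' := fun c l => by
        funext y
        rcases y with d | d <;> simp <;> ring }
  have hsum : ∀ (c : G.Dart ⊕ G.Dart → ZMod 2) (x), incidence p q c x =
      Sum.elim (fun v => ∑ d, if G.origin d = v then c (Sum.inl d) else 0)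
        (Sum.elim (fun w => ∑ d, if G.face d = w then c (Sum.inr d) else 0)
          fun e => ∑ b, (c (Sum.inl (e, b)) + c (Sum.inr (e, b)))) x := by
    intro c x
    rw [incidence_apply, Fintype.sum_sum_type, Fintype.sum_sum_type]
    rcases x with v | w | e
    · simp [p, q]
    · simp [p, q]
    · simp [p, q, Fintype.sum_prod_type, Finset.sum_add_distrib]
  have hker : ∀ c, c ∈ LinearMap.ker (incidence p q) ↔
      (∀ v, ∑ d, (if G.origin d = v then c (Sum.inl d) else 0) = 0) ∧
      (∀ w, ∑ d, (if G.face d = w then c (Sum.inr d) else 0) = 0) ∧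
      ∀ d, c (Sum.inl d) + c (Sum.inl (G.rev d)) + c (Sum.inr d) + c (Sum.inr (G.rev d)) = 0 := by
    intro c
    rw [LinearMap.mem_ker, funext_iff]
    simp only [hsum, Sum.forall, Sum.elim_inl, Sum.elim_inr, Pi.zero_apply]
    refine and_congr_right fun _ => and_congr_right fun _ => ?_
    simp only [Fintype.sum_bool]
    constructor
    · rintro h ⟨e, b⟩
      have := h e
      cases b <;> simp only [rev, dartRev, Equiv.prodCongr_apply, Prod.map_apply, Equiv.refl_apply,
        Equiv.boolNot_apply, Bool.not_false, Bool.not_true] <;> linear_combination this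
    · intro h e
      have := h (e, true)
      simp only [rev, dartRev, Equiv.prodCongr_apply, Prod.map_apply, Equiv.refl_apply,
        Equiv.boolNot_apply, Bool.not_true] at this
      linear_combination this
  have hle : LinearMap.range δ ≤ LinearMap.ker (incidence p q) := by
    rintro _ ⟨l, rfl⟩
    rw [hker]
    have hcyc : ∀ (g : Equiv.Perm G.Dart) (r : G.Dart → Prop) [DecidablePred r],
        (∀ d, r (g d) ↔ r d) →
        ∑ d, (if r d then l d + l (g d) else 0) = 0 := by
      intro g r _ hr
      have h₁ := Equiv.sum_comp g fun d => if r d then l d else 0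
      have h₂ : ∀ d, (if r d then l d + l (g d) else 0) =
          (if r d then l d else 0) + if r d then l (g d) else 0 := by
        intro d
        split_ifs <;> simp
      simp only [hr] at h₁
      simp only [h₂, Finset.sum_add_distrib, h₁]
      exact CharTwo.add_self_eq_zero _
    refine ⟨fun v => hcyc G.next⁻¹ (fun d => G.origin d = v) fun d => by
        rw [G.origin_next_inv],
      fun w => hcyc G.faceNext (fun d => G.face d = w) fun d => ?_, fun d => ?_⟩
    · rw [show G.face (G.faceNext d) = G.face d from G.face_eq_iff.2
        (Equiv.Perm.sameCycle_apply_left.2 (Equiv.Perm.SameCycle.refl _ _))]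
    · simp only [δ, LinearMap.coe_mk, AddHom.coe_mk, Sum.elim_inl, Sum.elim_inr, faceNext_apply,
        rev_rev]
      have h₂ : ∀ x : ZMod 2, x + x = 0 := CharTwo.add_self_eq_zero
      linear_combination h₂ (l d) + h₂ (l (G.next⁻¹ d)) + h₂ (l (G.rev d)) +
        h₂ (l (G.next⁻¹ (G.rev d)))
  -- By connectedness only constant labelings have no changes, so the rank of `δ` is at least `2m -
  -- 1`.
  have hδ : 2 * G.numEdges ≤ finrank (ZMod 2) (LinearMap.range δ) + 1 := by
    have h₁ : LinearMap.ker δ ≤ Submodule.span (ZMod 2) {fun _ => 1} := by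
      intro l hl
      have hl' := congrFun (LinearMap.mem_ker.1 hl)
      have hn : ∀ d, l d = l (G.next⁻¹ d) := fun d => CharTwo.add_eq_zero.1 (hl' (Sum.inl d))
      have hf : ∀ d, l d = l (G.faceNext d) := fun d => CharTwo.add_eq_zero.1 (hl' (Sum.inr d))
      have hconst : ∀ d, l d = l G.outer := fun d =>
        G.connected_induction (r := fun d d' => l d = l d') (InvImage.equivalence _ l ⟨fun _ => rfl,
          Eq.symm, Eq.trans⟩) (fun d => by
            rw [hn (G.next d), show G.next⁻¹ (G.next d) = d from G.next.symm_apply_apply d])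
          (fun d => by rw [hf d, faceNext_apply, ← hn]) d G.outer
      refine Submodule.mem_span_singleton.2 ⟨l G.outer, ?_⟩
      funext d
      simp [hconst d]
    have h₂ := (Submodule.finrank_mono h₁).trans
      (finrank_span_le_card (R := ZMod 2) ({fun _ => 1} : Set (G.Dart → ZMod 2)))
    simp only [Set.toFinset_singleton, Finset.card_singleton] at h₂
    have h₃ := δ.finrank_range_add_finrank_ker
    rw [Module.finrank_fintype_fun_eq_card, Fintype.card_prod, Fintype.card_fin, Fintype.card_bool]
      at h₃
    omega
  -- By Euler's formula the new graph has `2m + 2` nodes. It is connected, so its incidence map has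
  -- rank at least `2m + 1`, which leaves at most `2m - 1` of the `4m` dimensions for the kernel.
  have hp : finrank (ZMod 2) (LinearMap.ker (incidence p q)) + 1 ≤ 2 * G.numEdges := by
    have hq : ∀ d, Relation.EqvGen (fun x x' => ∃ y, p y = x ∧ q y = x') (Sum.inl (G.origin d))
        (Sum.inr (Sum.inr d.1)) := fun d => .rel _ _ ⟨Sum.inl d, rfl, rfl⟩
    have hd : ∀ d, Relation.EqvGen (fun x x' => ∃ y, p y = x ∧ q y = x') (Sum.inl (G.origin d))
        (Sum.inl (G.origin G.outer)) := fun d =>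
      G.connected_induction (r := fun d d' => Relation.EqvGen (fun x x' => ∃ y, p y = x ∧ q y = x')
          (Sum.inl (G.origin d)) (Sum.inl (G.origin d')))
        ⟨fun _ => .refl _, .symm _ _, .trans _ _ _⟩ (fun d => by rw [origin_next]; exact .refl _)
        (fun d => (hq d).trans _ _ _ ((hq (G.rev d)).symm _ _)) d G.outer
    have h₁ := card_le_finrank_range_incidence p q (Sum.inl (G.origin G.outer)) (by
      rintro (v | w | e)
      · obtain ⟨d, rfl⟩ := Quotient.exists_rep v
        exact hd d
      · obtain ⟨d, rfl⟩ := Quotient.exists_rep w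
        exact (Relation.EqvGen.rel _ _ ⟨Sum.inr d, rfl, rfl⟩).trans _ _ _
          (((hq d).symm _ _).trans _ _ _ (hd d))
      · exact ((hq (e, false)).symm _ _).trans _ _ _ (hd (e, false)))
    have h₂ := (incidence p q).finrank_range_add_finrank_ker
    have h₃ : Fintype.card G.Vertex + Fintype.card G.Face = G.numEdges + 2 := by
      rw [← G.euler, ← Nat.card_eq_fintype_card, ← Nat.card_eq_fintype_card]
      rfl
    rw [Module.finrank_fintype_fun_eq_card, Fintype.card_sum, Fintype.card_prod, Fintype.card_fin,
      Fintype.card_bool] at h₂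
    rw [Fintype.card_sum, Fintype.card_sum, Fintype.card_fin] at h₁
    omega
  have heq : LinearMap.range δ = LinearMap.ker (incidence p q) :=
    Submodule.eq_of_le_of_finrank_le hle (by omega)
  have hmem : Sum.elim A L ∈ LinearMap.ker (incidence p q) := (hker _).2 ⟨hv, hf, he⟩
  rw [← heq] at hmem
  obtain ⟨l, hl⟩ := hmem
  exact ⟨l, fun d => (congrFun hl (Sum.inl d)).symm, fun d => (congrFun hl (Sum.inr d)).symm⟩

end PlaneGraph

/-! ### Characterization of weak labelings -/

namespace PlaneGraph

variable (G : PlaneGraph)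

open Classical in
theorem cyc_next_eq (d : G.Dart) :
    cyc G.next d = Finset.univ.filter fun x => G.origin x = G.origin d := by
  ext x
  rw [mem_cyc, Finset.mem_filter, ← origin_eq_iff, eq_comm]
  simp

theorem mem_cyc_next {d x : G.Dart} : x ∈ cyc G.next d ↔ G.origin x = G.origin d := by
  rw [mem_cyc, ← origin_eq_iff, eq_comm]

/-- Labels with the changes `S` across darts at their origins and the changes `T` on the left. -/
theorem exists_labeling (S T : G.Dart → Bool) (a : G.Dart)
    (hv : ∀ d, Even ((cyc G.next d).filter fun x => S x = true).card)
    (hf : ∀ d, Even ((cyc G.faceNext d).filter fun x => T x = true).card)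
    (he : ∀ d, (S d ^^ S (G.rev d)) = (T d ^^ T (G.rev d))) :
    ∃ l : G.Dart → Bool, l a = false ∧ (∀ d, S d = (l d ^^ l (G.next⁻¹ d))) ∧
      ∀ d, T d = (l d ^^ l (G.faceNext d)) := by
  classical
  have hcard : ∀ s : Finset G.Dart, Even s.card → (s.card : ZMod 2) = 0 :=
    fun s h => (ZMod.natCast_eq_zero_iff_even).2 h
  obtain ⟨l, hS, hT⟩ := G.exists_potential (fun d => if S d = true then 1 else 0)
    (fun d => if T d = true then 1 else 0) (fun v => by
      obtain ⟨d, rfl⟩ := Quotient.exists_rep v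
      refine Eq.trans ?_ (hcard _ (hv d))
      rw [← Finset.sum_boole, cyc_next_eq, Finset.sum_filter]
      rfl) (fun w => by
      obtain ⟨d, rfl⟩ := Quotient.exists_rep w
      refine Eq.trans ?_ (hcard _ (hf d))
      rw [← Finset.sum_boole]
      have : cyc G.faceNext d = Finset.univ.filter fun x => G.face x = G.face d := by
        ext x
        rw [mem_cyc, Finset.mem_filter, ← face_eq_iff, eq_comm]
        simp
      rw [this, Finset.sum_filter]
      rfl) fun d => by
        have : ∀ a b c d : Bool, (a ^^ b) = (c ^^ d) → (if a = true then 1 else 0 : ZMod 2) +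
          (if b = true then 1 else 0) + (if c = true then 1 else 0) +
            (if d = true then 1 else 0) = 0 := by decide
        exact this _ _ _ _ (he d)
  have key : ∀ (b : Bool) (x y : ZMod 2), (if b = true then 1 else 0) = x + y →
      b = (decide (x = 1) ^^ decide (y = 1)) := by decide
  refine ⟨fun d => decide (l d = 1) ^^ decide (l a = 1), by simp, fun d => ?_, fun d => ?_⟩
  · rw [key _ _ _ (hS d)]
    simp [Bool.xor_left_comm (decide (l a = 1))]
  · rw [key _ _ _ (hT d)]
    simp [Bool.xor_left_comm (decide (l a = 1))]

variable {G} in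
theorem eq_of_origin_eq {l : G.Dart → Bool} {a : G.Dart}
    (h : ∀ d, G.origin d = G.origin a → l d = l (G.next⁻¹ d)) :
    ∀ d, G.origin d = G.origin a → l d = l a := by
  have key : ∀ (i : ℕ), l (G.next^[i] a) = l a := by
    intro i
    induction i with
    | zero => rfl
    | succ i ih =>
      have h₁ := (G.mem_cyc_next).1 (iterate_mem_cyc (f := G.next) a (i + 1))
      rw [h _ h₁, Function.iterate_succ_apply',
        show G.next⁻¹ (G.next (G.next^[i] a)) = G.next^[i] a from G.next.symm_apply_apply _, ih]
  intro d hd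
  obtain ⟨i, -, rfl⟩ := mem_cyc_iff_exists_iterate.1 (G.mem_cyc_next.2 hd)
  exact key i

open Classical in
/-- Numbers of changes that characterize weak labelings: the special vertices are the origins of the
outer darts `a` and `faceNext^[k] a`; the changes `S` at the origins and the changes `T` on the left
of darts can be chosen independently. -/
structure WeakCertificate (a : G.Dart) (k : ℕ) : Prop where
  outer : G.InOuterFace a
  ne : G.origin a ≠ G.origin (G.faceNext^[k] a)
  atOrigin : ∃ S : G.Dart → Bool, (∀ d, S d ≠ S (G.rev d)) ∧
    ∀ d, ((cyc G.next d).filter fun x => S x = true).card =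
      if G.origin d = G.origin a ∨ G.origin d = G.origin (G.faceNext^[k] a) then 0 else 2
  onLeft : ∃ T : G.Dart → Bool, (∀ d, T d ≠ T (G.rev d)) ∧
    (∀ d, ¬ G.InOuterFace d → ((cyc G.faceNext d).filter fun x => T x = true).card = 2) ∧
    ((cyc G.faceNext a).filter fun x => T x = true ∧ ∃ j < k, G.faceNext^[j] a = x).card = 1 ∧
    ((cyc G.faceNext a).filter fun x => T x = true ∧ ¬ ∃ j < k, G.faceNext^[j] a = x).card = 1

variable {G}

/-- All counts are even, and around an edge `S` and `T` contribute one change each from its two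
darts, so some labeling has these changes and is `false` at `a`. The single change on the outer
segment from `a` to the other special angle forces `true` there. -/
theorem WeakCertificate.admitsWeakLabeling {a : G.Dart} {k : ℕ} (h : G.WeakCertificate a k) :
    G.AdmitsWeakLabeling := by
  classical
  obtain ⟨hout, hne, ⟨S, hS, hSv⟩, T, hT, hTf, hT₁, hT₂⟩ := h
  have hface : ∀ d, ((cyc G.faceNext d).filter fun x => T x = true).card = 2 := by
    intro d
    by_cases hd : G.InOuterFace d
    · rw [cyc_eq_of_sameCycle (hd.symm.trans hout)]
      have := Finset.card_filter_add_card_filter_not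
        (s := (cyc G.faceNext a).filter fun x => T x = true)
        (fun x => ∃ j < k, G.faceNext^[j] a = x)
      rw [Finset.filter_filter, Finset.filter_filter, hT₁, hT₂] at this
      exact this.symm
    · exact hTf d hd
  -- A segment longer than the period would cover the whole outer face and leave no place for the
  -- second change.
  have hkp : k ≤ Function.minimalPeriod G.faceNext a := by
    by_contra hk
    obtain ⟨x, hx⟩ := Finset.card_pos.1 (hT₂.symm ▸ one_pos)
    rw [Finset.mem_filter] at hx
    obtain ⟨j, hj, rfl⟩ := mem_cyc_iff_exists_iterate.1 hx.1
    exact hx.2.2 ⟨j, by omega, rfl⟩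
  obtain ⟨l, hla, hlS, hlT⟩ := G.exists_labeling S T a (fun d => by rw [hSv]; split_ifs <;> simp)
    (fun d => by rw [hface]; simp) fun d => by
      have h₁ := hS d
      have h₂ := hT d
      revert h₁ h₂
      cases S d <;> cases S (G.rev d) <;> cases T d <;> cases T (G.rev d) <;> simp
  have hlS' : ∀ d, S d = true ↔ l d ≠ l (G.next⁻¹ d) := fun d => by rw [hlS]; simp
  have hlT' : ∀ d, T d = true ↔ l d ≠ l (G.faceNext d) := fun d => by rw [hlT]; simp
  have hconst : ∀ b, (G.origin b = G.origin a ∨ G.origin b = G.origin (G.faceNext^[k] a)) →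
      ∀ d, G.origin d = G.origin b → l d = l b := by
    intro b hb
    refine eq_of_origin_eq fun d hd => ?_
    by_contra hne
    have h₀ := hSv b
    rw [if_pos hb, Finset.card_eq_zero] at h₀
    have : d ∈ (cyc G.next b).filter fun x => S x = true :=
      Finset.mem_filter.2 ⟨G.mem_cyc_next.2 hd, (hlS' d).2 hne⟩
    rw [h₀] at this
    simp at this
  have hla₁ : l (G.faceNext^[k] a) = true := by
    have h₁ := odd_changes_iff (f := G.faceNext) a l k
    simp only [← hlT'] at h₁
    rw [← card_filter_segment hkp (fun x => T x = true), hT₁, hla] at h₁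
    simpa using (h₁.1 odd_one).symm
  refine ⟨G.origin a, G.origin (G.faceNext^[k] a), l, ⟨hne, ⟨a, hout, rfl⟩,
    ⟨_, hout.trans (mem_cyc.1 (iterate_mem_cyc a k)), rfl⟩,
    fun d hd => (hconst a (Or.inl rfl) d hd).trans hla,
    fun d hd => (hconst _ (Or.inr rfl) d hd).trans hla₁⟩, fun d h₀ h₁ => ?_, fun d => ?_,
    fun d => ?_⟩
  · rw [twoIntervals_iff, ← card_changes_inv]
    have := hSv d
    rw [if_neg (not_or.2 ⟨h₀, h₁⟩)] at this
    simpa only [hlS'] using this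
  · have h₁ := hS d
    have h₂ := hlS' d
    have h₃ := hlS' (G.rev d)
    unfold CoincideAtOrigin Xor
    revert h₁ h₂ h₃
    cases S d <;> cases S (G.rev d) <;> simp +contextual
  · rw [twoIntervals_iff]
    have := hface d
    simpa only [hlT'] using this

theorem AdmitsWeakLabeling.exists_certificate (h : G.AdmitsWeakLabeling) :
    ∃ a, ∃ k < Function.minimalPeriod G.faceNext a, G.WeakCertificate a k := by
  classical
  obtain ⟨s₀, s₁, l, ⟨hne, ⟨a, hout, rfl⟩, ⟨a₁, hout₁, rfl⟩, hl₀, hl₁⟩, hv, he, hf⟩ := h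
  obtain ⟨k, hk, rfl⟩ := mem_cyc_iff_exists_iterate.1 (mem_cyc.2 (hout.symm.trans hout₁))
  have hxor : ∀ x y : Bool, (x ^^ y) = true ↔ x ≠ y := by decide
  -- The four labels at an edge can be paired by endpoint or by side. If exactly one endpoint has a
  -- change, then so does exactly one side.
  have hcoin : ∀ x y z w : Bool, Xor (x = y) (z = w) → (x ^^ y) ≠ (z ^^ w) ∧
      (x ^^ w) ≠ (z ^^ y) := by
    unfold Xor
    decide
  have hface : ∀ d, ((cyc G.faceNext d).filter fun x => (l x ^^ l (G.faceNext x)) = true).card = 2 := by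
    intro d
    simp only [hxor]
    exact (twoIntervals_iff d l).1 (hf d)
  refine ⟨a, k, hk, hout, hne, ⟨fun d => l d ^^ l (G.next⁻¹ d), fun d => (hcoin _ _ _ _ (he d)).1,
    fun d => ?_⟩, fun d => l d ^^ l (G.faceNext d), fun d => ?_, fun d _ => hface d, ?_⟩
  · simp only [hxor]
    split_ifs with hd
    · rw [Finset.card_eq_zero, Finset.filter_eq_empty_iff]
      intro x hx
      rw [mem_cyc_next] at hx
      rcases hd with hd | hd
      · rw [hl₀ x (hx.trans hd), hl₀ _ ((G.origin_next_inv x).trans (hx.trans hd))]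
        simp
      · rw [hl₁ x (hx.trans hd), hl₁ _ ((G.origin_next_inv x).trans (hx.trans hd))]
        simp
    · rw [not_or] at hd
      rw [card_changes_inv]
      exact (twoIntervals_iff d l).1 (hv d hd.1 hd.2)
  · have := (hcoin _ _ _ _ (he d)).2
    simp only [faceNext_apply, rev_rev]
    exact this
  -- The labels at the two special angles differ, so the segment between them contains an odd number
  -- of the two changes of the outer face.
  · have h₁ := (odd_changes_iff (f := G.faceNext) a l k).2
      (by rw [hl₀ a rfl, hl₁ _ rfl]; exact Bool.false_ne_true)
    simp only [← hxor] at h₁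
    rw [← card_filter_segment hk.le (fun x => (l x ^^ l (G.faceNext x)) = true)] at h₁
    have h₂ := Finset.card_filter_add_card_filter_not
      (s := (cyc G.faceNext a).filter fun x => (l x ^^ l (G.faceNext x)) = true)
      (fun x => ∃ j < k, G.faceNext^[j] a = x)
    rw [Finset.filter_filter, Finset.filter_filter, hface] at h₂
    obtain ⟨m, hm⟩ := h₁
    beta_reduce
    generalize hA : Finset.card _ = A at h₂ hm
    generalize Finset.card _ = B at h₂
    rw [← hA]
    omega

theorem admitsWeakLabeling_iff : G.AdmitsWeakLabeling ↔
    ∃ a, ∃ k < Function.minimalPeriod G.faceNext a, G.WeakCertificate a k :=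
  ⟨fun h => h.exists_certificate, fun ⟨_, _, _, h⟩ => h.admitsWeakLabeling⟩

end PlaneGraph

/-! ### Characterization of generalized strong labelings -/

namespace BipartitePlaneGraph

open PlaneGraph

variable (G : BipartitePlaneGraph)

theorem white_rev (d : G.Dart) : G.white (G.origin (G.rev d)) = !G.white (G.origin d) := by
  have := G.proper d
  revert this
  cases G.white (G.origin d) <;> cases G.white (G.origin (G.rev d)) <;> simp

theorem white_faceNext (d : G.Dart) :
    G.white (G.origin (G.faceNext d)) = !G.white (G.origin d) := by
  rw [← G.white_rev, G.origin_faceNext]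

open Classical in
/-- A choice of two out of three incidences for every edge that characterizes generalized strong
labelings with special vertices at the outer darts `a` and `a'`: the edge can have a change at its
origin, at its end, and no change on the left of the dart from black to white. -/
structure StrongCertificate (a a' : G.Dart) : Prop where
  outer : G.InOuterFace a
  outer' : G.InOuterFace a'
  ne : G.origin a ≠ G.origin a'
  choice : ∃ (S : G.Dart → Bool) (N : Fin G.numEdges → Bool),
    (∀ e, [S (e, false), S (e, true), N e].count false = 1) ∧
    (∀ d, ((cyc G.next d).filter fun x => S x = true).card =
      if G.origin d = G.origin a ∨ G.origin d = G.origin a' then 0 else 2) ∧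
    ∀ d, ((cyc G.faceNext d).filter fun x =>
      G.white (G.origin x) = false ∧ N x.1 = true).card = 2

variable {G}

theorem count_dart {S : G.Dart → Bool} {N : Fin G.numEdges → Bool} (d : G.Dart) :
    [S (d.1, false), S (d.1, true), N d.1].count false = [S d, S (G.rev d), N d.1].count false := by
  obtain ⟨e, b⟩ := d
  cases b
  · rfl
  · exact (List.Perm.swap _ _ _).count_eq _

/-- In all six patterns the labels differ on the left of the dart from white to black. Equal labels
in a face thus occur only at darts from black to white, and `N` records the edges where they do. The
additional clause about the outer edge at `s₀` is not needed here. -/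
theorem AdmitsGeneralizedStrongLabeling.exists_certificate
    (h : G.AdmitsGeneralizedStrongLabeling) : ∃ a a', G.StrongCertificate a a' := by
  classical
  obtain ⟨s₀, s₁, l, ⟨hne, ⟨a, hout, rfl⟩, ⟨a₁, hout₁, rfl⟩, hl₀, hl₁⟩, hv, he, hf, -⟩ := h
  have hxor : ∀ x y : Bool, (x ^^ y) = true ↔ x ≠ y := by decide
  have hrule : ∀ d, G.white (G.origin d) = true → l d ≠ l (G.faceNext d) ∧
      [l d ^^ l (G.next⁻¹ d), l (G.rev d) ^^ l (G.next⁻¹ (G.rev d)),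
        !(l (G.rev d) ^^ l (G.faceNext (G.rev d)))].count false = 1 := by
    intro d hd
    have key : ∀ x y z w u v : Bool, ((Xor (x = y) (z = w) ∧ z = u ∧ ¬ x = v) ∨
      (¬ x = y ∧ ¬ z = w ∧ ¬ z = u ∧ ¬ x = v)) → x ≠ v ∧
        [x ^^ y, z ^^ w, !(z ^^ u)].count false = 1 := by
      unfold Xor
      decide
    exact key _ _ _ _ _ _ (he d hd)
  let N : Fin G.numEdges → Bool := fun e =>
    if G.white (G.origin (e, false)) = true then !(l (e, true) ^^ l (G.faceNext (e, true)))
    else !(l (e, false) ^^ l (G.faceNext (e, false)))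
  have hN : ∀ x, G.white (G.origin x) = false → N x.1 = !(l x ^^ l (G.faceNext x)) := by
    rintro ⟨e, b⟩ hx
    cases b
    · simp [N, hx]
    · have : G.white (G.origin (e, false)) = true := by
        have := G.white_rev (e, true)
        rw [hx] at this
        exact this
      simp [N, this]
  refine ⟨a, a₁, hout, hout₁, hne, fun d => l d ^^ l (G.next⁻¹ d), N, fun e => ?_, fun d => ?_,
    fun d => ?_⟩
  · obtain ⟨d, rfl, hd⟩ : ∃ d : G.Dart, d.1 = e ∧ G.white (G.origin d) = true := by
      cases hw : G.white (G.origin (e, false))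
      · refine ⟨(e, true), rfl, ?_⟩
        have := G.white_rev (e, false)
        rw [hw] at this
        exact this
      · exact ⟨(e, false), rfl, hw⟩
    rw [count_dart (S := fun d => l d ^^ l (G.next⁻¹ d))]
    have h₁ := hN (G.rev d) (by rw [white_rev, hd]; rfl)
    rw [rev_fst] at h₁
    rw [h₁]
    exact (hrule d hd).2
  · simp only [hxor]
    split_ifs with hd
    · rw [Finset.card_eq_zero, Finset.filter_eq_empty_iff]
      intro x hx
      rw [mem_cyc_next] at hx
      rcases hd with hd | hd
      · rw [hl₀ x (hx.trans hd), hl₀ _ ((G.origin_next_inv x).trans (hx.trans hd))]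
        simp
      · rw [hl₁ x (hx.trans hd), hl₁ _ ((G.origin_next_inv x).trans (hx.trans hd))]
        simp
    · rw [not_or] at hd
      rw [card_changes_inv]
      exact (twoIntervals_iff d l).1 (hv d hd.1 hd.2)
  · have h₁ : ((cyc G.faceNext d).filter fun x => G.white (G.origin x) = false ∧ N x.1 = true) =
        (cyc G.faceNext d).filter fun x => l x = l (G.faceNext x) := by
      refine Finset.filter_congr fun x _ => ?_
      cases hw : G.white (G.origin x)
      · rw [hN x hw]
        simp
      · simpa using (hrule x hw).1
    have h₂ := Finset.card_filter_add_card_filter_not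
      (s := (cyc G.faceNext d).filter fun x => l x = l (G.faceNext x)) (fun x => l x = false)
    rw [Finset.filter_filter, Finset.filter_filter] at h₂
    have h₃ : ∀ i, ((cyc G.faceNext d).filter fun x => l x = l (G.faceNext x) ∧ l x = i).card = 1 := by
      intro i
      obtain ⟨y, hy, huniq⟩ := hf d i
      rw [Finset.card_eq_one]
      refine ⟨y, ?_⟩
      ext x
      rw [Finset.mem_filter, Finset.mem_singleton, mem_cyc]
      constructor
      · rintro ⟨h₁, h₂, h₃⟩
        exact huniq x ⟨h₁, h₃, h₂ ▸ h₃⟩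
      · rintro rfl
        exact ⟨hy.1, hy.2.1.trans hy.2.2.symm, hy.2.1⟩
    have h₄ := h₃ true
    simp only [← Bool.not_eq_false] at h₄
    rw [h₁, ← h₂, h₃ false, h₄]

/-- The labeling again comes from its changes. What has to be shown is that three clauses missing
from the certificate hold automatically: the two pairs of equal labels in a face have different
labels, the special vertices have different labels, and the outer edge at `s₀` carries two labels 0.
-/
theorem StrongCertificate.admitsGeneralizedStrongLabeling {a a' : G.Dart}
    (h : G.StrongCertificate a a') : G.AdmitsGeneralizedStrongLabeling := by
  classical
  obtain ⟨hout, hout', hne, S, N, hE, hSv, hNf⟩ := h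
  let T : G.Dart → Bool := fun d => G.white (G.origin d) || !N d.1
  have hE' : ∀ d, [S d, S (G.rev d), N d.1].count false = 1 := fun d => by
    rw [← count_dart (G := G), hE]
  -- Colors alternate along a face. With `w` white angles, a face has `w` changes at white origins
  -- and `w - 2` at black ones, an even number in total.
  have hbal : ∀ d, ((cyc G.faceNext d).filter fun x => G.white (G.origin x) = false).card =
      ((cyc G.faceNext d).filter fun x => G.white (G.origin x) = true).card := by
    intro d
    have := card_up_eq_card_down (f := G.faceNext) d fun x => G.white (G.origin x)
    simpa [white_faceNext] using this
  obtain ⟨l, hla, hlS, hlT⟩ := G.exists_labeling S T a (fun d => by rw [hSv]; split_ifs <;> simp)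
    (fun d => by
      have h₁ := Finset.card_filter_add_card_filter_not
        (s := (cyc G.faceNext d).filter fun x => T x = true) (fun x => G.white (G.origin x) = true)
      have h₂ := Finset.card_filter_add_card_filter_not
        (s := (cyc G.faceNext d).filter fun x => G.white (G.origin x) = false)
        (fun x => N x.1 = true)
      simp only [Finset.filter_filter] at h₁ h₂
      rw [hNf, hbal] at h₂
      have h₃ : ((cyc G.faceNext d).filter fun x => T x = true ∧ G.white (G.origin x) = true) =
          (cyc G.faceNext d).filter fun x => G.white (G.origin x) = true :=
        Finset.filter_congr fun x _ => by cases hw : G.white (G.origin x) <;> simp [T, hw]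
      have h₄ : ((cyc G.faceNext d).filter fun x => T x = true ∧ ¬ G.white (G.origin x) = true) =
          (cyc G.faceNext d).filter fun x => G.white (G.origin x) = false ∧ ¬ N x.1 = true :=
        Finset.filter_congr fun x _ => by
          cases hw : G.white (G.origin x) <;> cases hn : N x.1 <;> simp [T, hw, hn]
      rw [h₃, h₄] at h₁
      rw [Nat.even_iff]
      omega) fun d => by
        have h₁ := hE' d
        have h₂ := G.white_rev d
        simp only [T, h₂, rev_fst]
        revert h₁
        cases S d <;> cases S (G.rev d) <;> cases N d.1 <;> cases G.white (G.origin d) <;> decide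
  have hlS' : ∀ d, S d = true ↔ l d ≠ l (G.next⁻¹ d) := fun d => by rw [hlS]; simp
  have hlT' : ∀ d, T d = true ↔ l d ≠ l (G.faceNext d) := fun d => by rw [hlT]; simp
  have hspec : ∀ b, (G.origin b = G.origin a ∨ G.origin b = G.origin a') → S b = false := by
    intro b hb
    have h₀ := hSv b
    rw [if_pos hb, Finset.card_eq_zero] at h₀
    by_contra hne
    have : b ∈ (cyc G.next b).filter fun x => S x = true :=
      Finset.mem_filter.2 ⟨G.mem_cyc_next.2 rfl, by simpa using hne⟩
    rw [h₀] at this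
    simp at this
  have hconst : ∀ b, (G.origin b = G.origin a ∨ G.origin b = G.origin a') →
      ∀ d, G.origin d = G.origin b → l d = l b := by
    intro b hb
    refine eq_of_origin_eq fun d hd => ?_
    have := hlS d
    rw [hspec d (by rwa [hd])] at this
    simpa using this.symm
  -- the pairs of equal labels along a face are at the selected darts from black to white
  have hpair : ∀ d, l d = l (G.faceNext d) ↔ G.white (G.origin d) = false ∧ N d.1 = true := by
    intro d
    rw [← not_iff_not, ← ne_eq, ← hlT']
    simp only [T]
    cases G.white (G.origin d) <;> simp
  have hunique : ∀ d (i : Bool), ∃! y, G.faceNext.SameCycle d y ∧ l y = i ∧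
      l (G.faceNext y) = i := by
    intro d i
    -- Twisting by the color exchanges equality and change along the boundary walk, so `g` changes
    -- exactly at the two selected darts, once in each direction. These darts start at black
    -- vertices, where `g` agrees with `l`, so one pair has label 0 and the other label 1.
    let g : G.Dart → Bool := fun x => l x ^^ G.white (G.origin x)
    have hg : ∀ x, g x ≠ g (G.faceNext x) ↔ G.white (G.origin x) = false ∧ N x.1 = true := by
      intro x
      rw [← hpair]
      simp only [g, white_faceNext]
      cases l x <;> cases l (G.faceNext x) <;> cases G.white (G.origin x) <;> simp
    have h₁ := card_changes (f := G.faceNext) d g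
    have h₂ := card_up_eq_card_down (f := G.faceNext) d g
    simp only [hg, hNf] at h₁
    have h₃ : ((cyc G.faceNext d).filter fun y => g y = i ∧ g (G.faceNext y) = !i).card = 1 := by
      cases i
      · exact h₂.trans (by omega)
      · show ((cyc G.faceNext d).filter fun y => g y = true ∧ g (G.faceNext y) = false).card = 1
        omega
    have h₄ : ∀ y, (g y = i ∧ g (G.faceNext y) = !i) ↔ (l y = i ∧ l (G.faceNext y) = i) := by
      intro y
      have h₅ := hpair y
      simp only [g, white_faceNext]
      revert h₅
      cases l y <;> cases l (G.faceNext y) <;> cases G.white (G.origin y) <;> cases i <;> simp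
    simp only [h₄] at h₃
    obtain ⟨y, hy⟩ := Finset.card_eq_one.1 h₃
    refine ⟨y, ?_, fun x hx => ?_⟩
    · have := Finset.mem_singleton_self y
      rw [← hy, Finset.mem_filter, mem_cyc] at this
      exact this
    · rw [← Finset.mem_singleton, ← hy, Finset.mem_filter, mem_cyc]
      exact hx
  -- the pair of equal labels next to a special vertex
  have hend : ∀ d, G.white (G.origin d) = false → (∀ b, b = d ∨ b = G.rev d →
      (G.origin b = G.origin a ∨ G.origin b = G.origin a') → l d = l (G.faceNext d) ∧
        S (G.rev b) = true) := by
    intro d hd b hb hb'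
    have h₁ := hspec b hb'
    have h₂ := hE' d
    rw [hpair, and_assoc]
    refine ⟨hd, ?_⟩
    revert h₂
    rcases hb with rfl | rfl
    · rw [h₁]
      cases S (G.rev b) <;> cases N b.1 <;> decide
    · rw [h₁, rev_rev]
      cases S d <;> cases N d.1 <;> decide
  -- Next to an outer angle `b` at a special vertex there is an outer dart from black to white,
  -- namely `b` itself or its predecessor. Its edge has no change at the special vertex, so it
  -- carries a pair of equal labels and has a change at its other end, which therefore is not
  -- special.
  have hcorner : ∀ b, G.InOuterFace b → (G.origin b = G.origin a ∨ G.origin b = G.origin a') →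
      ∃ d, G.InOuterFace d ∧ (G.origin d = G.origin b ∨ G.origin (G.rev d) = G.origin b) ∧
        l d = l b ∧ l (G.faceNext d) = l b ∧
          ∀ c, (G.origin c = G.origin a ∨ G.origin c = G.origin a') →
            (G.origin d = G.origin c ∨ G.origin (G.rev d) = G.origin c) →
              G.origin c = G.origin b := by
    intro b hb hsb
    obtain ⟨d, b', hd, hw, hb', hob, hl⟩ : ∃ d b', G.InOuterFace d ∧
        G.white (G.origin d) = false ∧ (b' = d ∨ b' = G.rev d) ∧ G.origin b' = G.origin b ∧
          (d = b ∨ G.faceNext d = b) := by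
      cases hw : G.white (G.origin b)
      · exact ⟨b, b, hb, hw, Or.inl rfl, rfl, Or.inl rfl⟩
      · have hbb : G.faceNext (G.faceNext.symm b) = b := G.faceNext.apply_symm_apply b
        refine ⟨G.faceNext.symm b, G.rev (G.faceNext.symm b), ?_, ?_, Or.inr rfl, ?_, Or.inr hbb⟩
        · exact mem_cyc.1 (apply_mem_cyc.1 (by rw [hbb]; exact mem_cyc.2 hb))
        · have := G.white_faceNext (G.faceNext.symm b)
          rw [hbb, hw] at this
          simpa using this.symm
        · rw [← G.origin_faceNext, hbb]
    obtain ⟨h₁, h₂⟩ := hend d hw b' hb' (by rwa [hob])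
    have h₃ : l d = l b := by
      rcases hl with rfl | rfl
      · rfl
      · exact h₁
    have h₄ : G.origin d = G.origin b ∨ G.origin (G.rev d) = G.origin b := by
      rcases hb' with rfl | rfl
      · exact Or.inl hob
      · exact Or.inr hob
    refine ⟨d, hd, h₄, h₃, h₁ ▸ h₃, fun c hc hdc => ?_⟩
    by_contra hcb
    have h₅ : G.origin (G.rev b') = G.origin c := by
      rcases hb' with rfl | rfl
      · exact hdc.resolve_left fun h => hcb (h.symm.trans hob)
      · rw [rev_rev]
        exact hdc.resolve_right fun h => hcb (h.symm.trans hob)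
    have h₆ := hspec (G.rev b') (by rwa [h₅])
    rw [h₂] at h₆
    exact Bool.false_ne_true h₆.symm
  -- Otherwise both special vertices would have a pair of 0s of the outer face at one of their
  -- edges. There is only one such pair, so that edge would join them, against the last part of
  -- `hcorner`.
  have hla₁ : l a' = true := by
    by_contra hla'
    obtain ⟨d, hd, -, h₁, h₂, h₃⟩ := hcorner a hout (Or.inl rfl)
    obtain ⟨d', hd', h₀', h₁', h₂', -⟩ := hcorner a' hout' (Or.inr rfl)
    rw [Bool.not_eq_true] at hla'
    rw [hla] at h₁ h₂
    rw [hla'] at h₁' h₂'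
    obtain rfl := (hunique G.outer false).unique ⟨hd, h₁, h₂⟩ ⟨hd', h₁', h₂'⟩
    exact hne (h₃ a' (Or.inr rfl) h₀').symm
  refine ⟨G.origin a, G.origin a', l, ⟨hne, ⟨a, hout, rfl⟩, ⟨a', hout', rfl⟩,
    fun d hd => (hconst a (Or.inl rfl) d hd).trans hla,
    fun d hd => (hconst _ (Or.inr rfl) d hd).trans hla₁⟩, fun d h₀ h₁ => ?_, fun d hd => ?_,
    hunique, fun d hd hw hs => ?_⟩
  · rw [twoIntervals_iff, ← card_changes_inv]
    have := hSv d
    rw [if_neg (not_or.2 ⟨h₀, h₁⟩)] at this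
    simpa only [hlS'] using this
  · have h₁ := hE' d
    have h₂ := hpair d
    have h₃ := hpair (G.rev d)
    rw [white_rev, rev_fst, hd] at h₃
    rw [hd] at h₂
    rw [hlS, hlS] at h₁
    unfold CoincideAtOrigin CoincideOnLeft Xor
    simp only [faceNext_apply, rev_rev] at h₂ h₃ ⊢
    revert h₁ h₂ h₃
    generalize l d = x, l (G.next⁻¹ d) = y, l (G.rev d) = z, l (G.next⁻¹ (G.rev d)) = w, N d.1 = n
    revert x y z w n
    decide
  · rcases hs with hs | hs
    · have h₁ := hconst a (Or.inl rfl) d hs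
      rw [← (hend d hw d (Or.inl rfl) (Or.inl hs)).1, h₁, hla]
      exact ⟨rfl, rfl⟩
    · have h₁ := hconst a (Or.inl rfl) (G.faceNext d) ((G.origin_faceNext d).trans hs)
      rw [(hend d hw (G.rev d) (Or.inr rfl) (Or.inl hs)).1, h₁, hla]
      exact ⟨rfl, rfl⟩

theorem admitsGeneralizedStrongLabeling_iff : G.AdmitsGeneralizedStrongLabeling ↔
    ∃ a a', G.StrongCertificate a a' :=
  ⟨fun h => h.exists_certificate, fun ⟨_, _, h⟩ => h.admitsGeneralizedStrongLabeling⟩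

end BipartitePlaneGraph


/-! ### Permutations of darts as tables -/

theorem List.getD_flatMap_pair {γ : Type} (g h : ℕ → γ) (m : ℕ) (e : ℕ) (he : e < m) (b : Bool) (d : γ) :
    ((List.range m).flatMap fun e => [g e, h e]).getD (2 * e + b.toNat) d =
      if b then h e else g e := by
  induction m with
  | zero => omega
  | succ m ih =>
    have hlen : ((List.range m).flatMap fun e => [g e, h e]).length = 2 * m := by
      simp [List.length_flatMap, mul_comm]
    rw [List.range_succ, List.flatMap_append]
    have hb := Bool.toNat_le b
    by_cases h' : e < m
    · rw [List.getD_append _ _ _ _ (by omega), ih h']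
    · obtain rfl : e = m := by omega
      rw [List.getD_append_right _ _ _ _ (by omega), hlen]
      cases b <;> simp

/-- The number of a dart. -/
def dartNumber {m : ℕ} (d : Fin m × Bool) : ℕ := 2 * d.1 + d.2.toNat

/-- The numbers of the images of the darts under `f`. -/
def dartTable {m : ℕ} (f : Fin m × Bool → Fin m × Bool) : List ℕ :=
  (List.finRange m).flatMap fun e => [dartNumber (f (e, false)), dartNumber (f (e, true))]

section DartNumber

variable {m : ℕ}

theorem dartNumber_injective : Function.Injective (dartNumber (m := m)) := by
  rintro ⟨e, b⟩ ⟨e', b'⟩ h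
  have h₁ := Bool.toNat_le b
  have h₂ := Bool.toNat_le b'
  simp only [dartNumber] at h
  have h₃ : e = e' := Fin.ext (by omega)
  have h₄ : b.toNat = b'.toNat := by omega
  subst h₃
  cases b <;> cases b' <;> simp_all

theorem dartNumber_lt (d : Fin m × Bool) : dartNumber d < 2 * m := by
  have h₁ := Bool.toNat_le d.2
  have h₂ := d.1.2
  rw [dartNumber]
  omega

theorem exists_dartNumber_eq {i : ℕ} (hi : i < 2 * m) : ∃ d : Fin m × Bool, dartNumber d = i := by
  refine ⟨(⟨i / 2, by omega⟩, decide (i % 2 = 1)), ?_⟩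
  rcases Nat.mod_two_eq_zero_or_one i with h | h <;> simp [dartNumber, h] <;> omega

theorem length_dartTable (f : Fin m × Bool → Fin m × Bool) : (dartTable f).length = 2 * m := by
  simp [dartTable, List.length_flatMap, mul_comm]

theorem getD_dartTable (f : Fin m × Bool → Fin m × Bool) (d : Fin m × Bool) :
    (dartTable f).getD (dartNumber d) 0 = dartNumber (f d) := by
  let g : Bool → ℕ → ℕ := fun b e => if he : e < m then dartNumber (f (⟨e, he⟩, b)) else 0
  have h : dartTable f = (List.range m).flatMap fun e => [g false e, g true e] := by
    rw [dartTable, ← List.map_coe_finRange_eq_range, List.flatMap_map]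
    simp [g]
  obtain ⟨e, b⟩ := d
  rw [h, dartNumber, List.getD_flatMap_pair _ _ _ _ e.2]
  cases b <;> simp [g]

theorem eq_dartTable {l : List ℕ} {f : Fin m × Bool → Fin m × Bool} (hl : l.length = 2 * m)
    (h : ∀ d, l.getD (dartNumber d) 0 = dartNumber (f d)) : l = dartTable f := by
  refine List.ext_getElem (hl.trans (length_dartTable f).symm) fun i h₁ h₂ => ?_
  obtain ⟨d, rfl⟩ := exists_dartNumber_eq (hl ▸ h₁)
  rw [← List.getD_eq_getElem _ 0, ← List.getD_eq_getElem _ 0, h, getD_dartTable]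

theorem countP_range_eq_card_of_bijective {ι : Type} [Fintype ι] {n : ℕ} {g : ι → ℕ}
    (hg : Function.Injective g) (hlt : ∀ x, g x < n) (hsurj : ∀ i < n, ∃ x, g x = i) (p : ℕ → Bool) :
    (List.range n).countP p = (Finset.univ.filter fun x => p (g x) = true).card := by
  have h : (List.range n).countP p = ((Finset.range n).filter (p · = true)).card := by
    rw [List.countP_eq_length_filter, ← List.toFinset_card_of_nodup (List.nodup_range.filter _),
      List.toFinset_filter, List.toFinset_range]
  rw [h]
  symm
  refine Finset.card_bij (fun x _ => g x) (fun x hx => ?_) (fun x _ y _ e => hg e) fun i hi => ?_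
  · simpa [hlt] using hx
  · rw [Finset.mem_filter, Finset.mem_range] at hi
    obtain ⟨x, rfl⟩ := hsurj i hi.1
    exact ⟨x, by simpa using hi.2, rfl⟩

theorem countP_range_eq_card (p : ℕ → Bool) :
    (List.range (2 * m)).countP p =
      (Finset.univ.filter fun d : Fin m × Bool => p (dartNumber d) = true).card :=
  countP_range_eq_card_of_bijective dartNumber_injective dartNumber_lt
    (fun _ => exists_dartNumber_eq) p

end DartNumber

namespace Table

/-- The `k`th iterate of a table. -/
def iter (t : List ℕ) (k i : ℕ) : ℕ := (fun j => t.getD j 0)^[k] i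

/-- The smallest number in the cycle of `i`. -/
def rep (t : List ℕ) (i : ℕ) : ℕ :=
  ((List.range t.length).filter fun y =>
    decide (∃ k ∈ List.range t.length, iter t k i = y)).headD 0

/-- The number of the reverse of a dart. -/
def rev (i : ℕ) : ℕ := if 2 * (i / 2) = i then i + 1 else i - 1

/-- The table of `faceNext` from the table of `next`. -/
def faces (t : List ℕ) : List ℕ := (List.range t.length).map fun i =>
  ((List.range t.length).filter fun y => decide (t.getD y 0 = rev i)).headD 0

variable {m : ℕ}

theorem iter_dartTable (f : Fin m × Bool → Fin m × Bool) (k : ℕ) (d : Fin m × Bool) :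
    iter (dartTable f) k (dartNumber d) = dartNumber (f^[k] d) := by
  induction k with
  | zero => rfl
  | succ k ih =>
    rw [Function.iterate_succ_apply', iter, Function.iterate_succ_apply', ← iter, ih,
      getD_dartTable]

theorem rep_mem {f : Equiv.Perm (Fin m × Bool)} (d : Fin m × Bool) :
    ∃ d', rep (dartTable f) (dartNumber d) = dartNumber d' ∧ f.SameCycle d d' := by
  have hne : ((List.range (dartTable f).length).filter fun y => decide
      (∃ k ∈ List.range (dartTable f).length, iter (dartTable f) k (dartNumber d) = y)) ≠ [] := by
    refine List.ne_nil_of_mem (a := dartNumber d) (List.mem_filter.2 ⟨?_, decide_eq_true ⟨0, ?_, rfl⟩⟩)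
    · rw [List.mem_range, length_dartTable]
      exact dartNumber_lt d
    · rw [List.mem_range, length_dartTable]
      exact Nat.zero_lt_of_lt (dartNumber_lt d)
  have hmem : rep (dartTable f) (dartNumber d) ∈ ((List.range (dartTable f).length).filter fun y =>
      decide (∃ k ∈ List.range (dartTable f).length, iter (dartTable f) k (dartNumber d) = y)) := by
    rw [rep, List.headD_eq_head?_getD, List.head?_eq_some_head hne]
    exact List.head_mem hne
  obtain ⟨_, h⟩ := List.mem_filter.1 hmem
  obtain ⟨k, _, h⟩ := of_decide_eq_true h
  exact ⟨f^[k] d, by rw [← h, iter_dartTable], mem_cyc.1 (iterate_mem_cyc d k)⟩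

/-- Hence the iterates with exponents below the length of the table exhaust a cycle. -/
theorem minimalPeriod_le (f : Equiv.Perm (Fin m × Bool)) (d : Fin m × Bool) :
    Function.minimalPeriod f d ≤ 2 * m := by
  have h := Finset.card_le_card_of_injOn (s := Finset.range (Function.minimalPeriod f d))
    (t := Finset.univ) (fun i => f^[i] d) (fun _ _ => Finset.mem_univ _) fun i hi j hj e =>
      iterate_inj (Finset.mem_range.1 hi) (Finset.mem_range.1 hj) e
  simpa [mul_comm] using h

theorem rep_eq_iff {f : Equiv.Perm (Fin m × Bool)} {d d' : Fin m × Bool} :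
    rep (dartTable f) (dartNumber d) = rep (dartTable f) (dartNumber d') ↔ f.SameCycle d d' := by
  constructor
  · intro h
    obtain ⟨x, hx, hdx⟩ := rep_mem (f := f) d
    obtain ⟨x', hx', hdx'⟩ := rep_mem (f := f) d'
    obtain rfl : x = x' := dartNumber_injective (hx.symm.trans (h.trans hx'))
    exact hdx.trans hdx'.symm
  · intro h
    have key : ∀ d y, (∃ k ∈ List.range (dartTable f).length,
        iter (dartTable f) k (dartNumber d) = y) ↔ ∃ x, f.SameCycle d x ∧ dartNumber x = y := by
      intro d y
      constructor
      · rintro ⟨k, _, rfl⟩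
        exact ⟨f^[k] d, mem_cyc.1 (iterate_mem_cyc d k), (iter_dartTable _ _ _).symm⟩
      · rintro ⟨x, hx, rfl⟩
        obtain ⟨k, hk, rfl⟩ := mem_cyc_iff_exists_iterate.1 (mem_cyc.2 hx)
        refine ⟨k, ?_, iter_dartTable _ _ _⟩
        rw [List.mem_range, length_dartTable]
        exact hk.trans_le (minimalPeriod_le f d)
    rw [rep, rep]
    congr 2
    ext y
    rw [decide_eq_decide, key, key]
    exact ⟨fun ⟨x, hx, e⟩ => ⟨x, h.symm.trans hx, e⟩, fun ⟨x, hx, e⟩ => ⟨x, h.trans hx, e⟩⟩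

theorem rep_lt {f : Equiv.Perm (Fin m × Bool)} {i : ℕ} (hi : i < 2 * m) :
    rep (dartTable f) i < 2 * m := by
  obtain ⟨d, rfl⟩ := exists_dartNumber_eq hi
  obtain ⟨d', h, _⟩ := rep_mem (f := f) d
  exact h ▸ dartNumber_lt d'

theorem rep_rep {f : Equiv.Perm (Fin m × Bool)} {i : ℕ} (hi : i < 2 * m) :
    rep (dartTable f) (rep (dartTable f) i) = rep (dartTable f) i := by
  obtain ⟨d, rfl⟩ := exists_dartNumber_eq hi
  obtain ⟨d', h, hd⟩ := rep_mem (f := f) d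
  rw [h, ← rep_eq_iff.2 hd, h]

theorem rev_dartNumber (d : Fin m × Bool) : rev (dartNumber d) = dartNumber (dartRev m d) := by
  obtain ⟨e, b⟩ := d
  cases b
  · simp [rev, dartNumber, dartRev]
  · have : 2 * ((2 * (e : ℕ) + 1) / 2) ≠ 2 * e + 1 := by omega
    simp [rev, dartNumber, dartRev, this]

/-- The inverse of `next` is found by search. Exactly one number passes the filter, so the default
of `headD` plays no role. -/
theorem faces_dartTable (G : PlaneGraph) : faces (dartTable G.next) = dartTable G.faceNext := by
  refine eq_dartTable (by simp [faces, length_dartTable]) fun d => ?_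
  have hd := dartNumber_lt d
  rw [faces, List.getD_eq_getElem _ _ (by simpa [length_dartTable] using hd), List.getElem_map,
    List.getElem_range, length_dartTable]
  have h : (List.range (2 * G.numEdges)).filter (fun y =>
      decide ((dartTable G.next).getD y 0 = rev (dartNumber d))) = [dartNumber (G.faceNext d)] := by
    have h₁ : ∀ y ∈ List.range (2 * G.numEdges),
        decide ((dartTable G.next).getD y 0 = rev (dartNumber d)) =
          (y == dartNumber (G.faceNext d)) := by
      intro y hy
      obtain ⟨x, rfl⟩ := exists_dartNumber_eq (List.mem_range.1 hy)
      rw [getD_dartTable, rev_dartNumber, Bool.eq_iff_iff, decide_eq_true_iff, beq_iff_eq,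
        dartNumber_injective.eq_iff, dartNumber_injective.eq_iff, G.faceNext_apply,
        Equiv.Perm.eq_inv_iff_eq]
      rfl
    rw [List.filter_congr h₁, List.filter_beq, List.count_eq_one_of_mem List.nodup_range
      (List.mem_range.2 (dartNumber_lt _))]
    rfl
  rw [h]
  rfl

end Table


/-! ### Deciding the existence of certificates -/

namespace PolyTime

variable {α β : Type} [Enc α] [Enc β]

theorem half {n : α → ℕ} (hn : PolyTime n) : PolyTime fun a => n a / 2 := by
  refine (fst.comp (iterate (h := fun (_ : α) (s : ℕ × ℕ) => (s.2, s.1 + 1)) (s := fun _ => (0, 0))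
    ((snd.comp snd).pair (fst.comp snd).succ) (const _) hn ⟨2, fun _ s => ?_⟩)).congr_enc
      fun a => ?_
  · simp only [size_pair, size_nat, Polynomial.eval_ofNat]
    omega
  · have h : ∀ k, (fun s : ℕ × ℕ => (s.2, s.1 + 1))^[k] (0, 0) = (k / 2, (k + 1) / 2) := by
      intro k
      induction k with
      | zero => rfl
      | succ k ih =>
        rw [Function.iterate_succ_apply', ih]
        exact Prod.ext rfl (by simp only; omega)
    rw [h]

theorem table_iter {t : α → List ℕ} {k i : α → ℕ} (ht : PolyTime t) (hk : PolyTime k)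
    (hi : PolyTime i) : PolyTime fun a => Table.iter (t a) (k a) (i a) := by
  obtain ⟨q, hq⟩ := ht.size_le
  refine iterate (h := fun a j => (t a).getD j 0) (getD (ht.comp fst) snd 0) hi hk
    ⟨q + 1, fun a j => ?_⟩
  have h := hq a
  rw [List.getD_eq_getElem?_getD]
  cases h' : (t a)[j]? with
  | none => simp [size_nat]; omega
  | some y =>
    have := size_le_of_mem (List.mem_of_getElem? h')
    simp
    omega

theorem table_rep {t : α → List ℕ} {i : α → ℕ} (ht : PolyTime t) (hi : PolyTime i) :
    PolyTime fun a => Table.rep (t a) (i a) := by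
  have h : PolyTime fun x : (α × ℕ) × ℕ => decide (Table.iter (t x.1.1) x.2 (i x.1.1) = x.1.2) :=
    decide_eq (table_iter (ht.comp (fst.comp fst)) snd (hi.comp (fst.comp fst))) (snd.comp fst)
  exact (headD 0).comp (filter (c := fun a y =>
    decide (∃ k ∈ List.range (t a).length, Table.iter (t a) k (i a) = y))
    (decide_exists_mem (c := fun x k => Table.iter (t x.1) k (i x.1) = x.2) h
      (range (length (ht.comp fst)))) (range (length ht)))

theorem table_rev {i : α → ℕ} (hi : PolyTime i) : PolyTime fun a => Table.rev (i a) :=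
  ite (decide_eq ((const 2).mul hi.half) hi) hi.succ hi.pred

theorem table_faces {t : α → List ℕ} (ht : PolyTime t) : PolyTime fun a => Table.faces (t a) :=
  map (g := fun a i => ((List.range (t a).length).filter fun y =>
      decide ((t a).getD y 0 = Table.rev i)).headD 0)
    ((headD 0).comp (filter (c := fun (x : α × ℕ) y => decide ((t x.1).getD y 0 = Table.rev x.2))
      (decide_eq (getD (ht.comp (fst.comp fst)) snd 0) (table_rev (snd.comp fst)))
      (range (length (ht.comp fst))))) (range (length ht))

end PolyTime

namespace Table

/-- The classes of equal values of the idempotent map `v`, with their demands. -/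
def classes (n : ℕ) (v dem : ℕ → ℕ) : List (List ℕ × ℕ) :=
  ((List.range n).filter fun c => decide (v c = c)).map fun c =>
    ((List.range n).filter fun i => decide (v i = c), dem c)

/-- The pairs of darts of the same edge. -/
def pairs (m : ℕ) : List (List ℕ) := (List.range m).map fun e => [2 * e, 2 * e + 1]

/-- The classes of darts at the same vertex; two vertices demand no dart, and the others two. -/
def vertexClasses (t : List ℕ) (a b : ℕ) : List (List ℕ × ℕ) :=
  classes t.length (rep t) fun c => if c = rep t a ∨ c = rep t b then 0 else 2

theorem flatten_pairs (m : ℕ) : (pairs m).flatten = List.range (2 * m) := by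
  induction m with
  | zero => rfl
  | succ m ih =>
    rw [show 2 * (m + 1) = 2 * m + 1 + 1 by ring, List.range_succ, List.range_succ, ← ih, pairs,
      List.range_succ]
    simp [pairs]

theorem flatten_map_filter_perm {cs l : List ℕ} (hcs : cs.Nodup) (hl : l.Nodup) {g : ℕ → ℕ}
    (h : ∀ i ∈ l, g i ∈ cs) : (cs.map fun c => l.filter fun i => decide (g i = c)).flatten.Perm l := by
  rw [List.perm_ext_iff_of_nodup _ hl]
  · intro i
    simp only [List.mem_flatten, List.mem_map]
    constructor
    · rintro ⟨_, ⟨c, _, rfl⟩, h⟩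
      exact (List.mem_filter.1 h).1
    · intro hi
      exact ⟨_, ⟨g i, h i hi, rfl⟩, List.mem_filter.2 ⟨hi, decide_eq_true rfl⟩⟩
  · rw [List.nodup_flatten]
    constructor
    · intro l' hl'
      obtain ⟨c, _, rfl⟩ := List.mem_map.1 hl'
      exact hl.filter _
    · rw [List.pairwise_map]
      refine hcs.imp fun {c c'} hne i hi hi' => hne ?_
      have h := of_decide_eq_true (List.mem_filter.1 hi).2
      have h' := of_decide_eq_true (List.mem_filter.1 hi').2
      exact h.symm.trans h'

/-- The values of an idempotent map are its fixed points, so the fibers over these partition the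
range, as `solvable_iff` requires. -/
theorem flatten_classes {n : ℕ} {v : ℕ → ℕ} (hv : ∀ i < n, v i < n ∧ v (v i) = v i)
    (dem : ℕ → ℕ) : ((classes n v dem).map Prod.fst).flatten.Perm (List.range n) := by
  rw [classes, List.map_map]
  refine flatten_map_filter_perm (List.nodup_range.filter _) List.nodup_range fun i hi => ?_
  have := hv i (List.mem_range.1 hi)
  exact List.mem_filter.2 ⟨List.mem_range.2 this.1, decide_eq_true this.2⟩

theorem forall_mem_classes {n : ℕ} {v : ℕ → ℕ} (hv : ∀ i < n, v i < n ∧ v (v i) = v i)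
    (dem : ℕ → ℕ) (p : List ℕ × ℕ → Prop) : (∀ x ∈ classes n v dem, p x) ↔
      ∀ i < n, p ((List.range n).filter fun j => decide (v j = v i), dem (v i)) := by
  constructor
  · intro h i hi
    exact h _ (List.mem_map.2 ⟨v i, List.mem_filter.2 ⟨List.mem_range.2 (hv i hi).1,
      decide_eq_true (hv i hi).2⟩, rfl⟩)
  · intro h x hx
    obtain ⟨c, hc, rfl⟩ := List.mem_map.1 hx
    obtain ⟨h₁, h₂⟩ := List.mem_filter.1 hc
    have := h c (List.mem_range.1 h₁)
    rwa [of_decide_eq_true h₂] at this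

variable {m : ℕ}

theorem rep_idem {f : Equiv.Perm (Fin m × Bool)} : ∀ i < 2 * m,
    rep (dartTable f) i < 2 * m ∧ rep (dartTable f) (rep (dartTable f) i) = rep (dartTable f) i :=
  fun _ hi => ⟨rep_lt hi, rep_rep hi⟩

theorem forall_lt_iff {p : ℕ → Prop} :
    (∀ i < 2 * m, p i) ↔ ∀ d : Fin m × Bool, p (dartNumber d) :=
  ⟨fun h d => h _ (dartNumber_lt d), fun h i hi => by
    obtain ⟨d, rfl⟩ := exists_dartNumber_eq hi
    exact h d⟩

theorem exists_lt_iff {p : ℕ → Prop} :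
    (∃ i ∈ List.range (2 * m), p i) ↔ ∃ d : Fin m × Bool, p (dartNumber d) :=
  ⟨fun ⟨i, hi, h⟩ => by
    obtain ⟨d, rfl⟩ := exists_dartNumber_eq (List.mem_range.1 hi)
    exact ⟨d, h⟩, fun ⟨d, h⟩ => ⟨_, List.mem_range.2 (dartNumber_lt d), h⟩⟩

theorem forall_mem_pairs (S : ℕ → Bool) : (∀ l ∈ pairs m, l.countP (fun x => !S x) = 1) ↔
    ∀ d : Fin m × Bool, S (dartNumber d) ≠ S (dartNumber (dartRev m d)) := by
  have h : ∀ e, [2 * e, 2 * e + 1].countP (fun x => !S x) = 1 ↔ S (2 * e) ≠ S (2 * e + 1) := by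
    intro e
    cases h₁ : S (2 * e) <;> cases h₂ : S (2 * e + 1) <;> simp [h₁, h₂]
  simp only [pairs, List.mem_map, List.mem_range, forall_exists_index, and_imp,
    forall_apply_eq_imp_iff₂, h]
  constructor
  · rintro h' ⟨e, b⟩
    cases b
    · exact h' e e.2
    · exact (h' e e.2).symm
  · intro h' e he
    exact h' (⟨e, he⟩, false)

theorem forall_mem_vertexClasses (f : Equiv.Perm (Fin m × Bool)) (a b : Fin m × Bool)
    (S : ℕ → Bool) : (∀ x ∈ vertexClasses (dartTable f) (dartNumber a) (dartNumber b),
      x.1.countP S = x.2) ↔ ∀ d, ((cyc f d).filter fun x => S (dartNumber x) = true).card =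
        open Classical in if f.SameCycle d a ∨ f.SameCycle d b then 0 else 2 := by
  rw [vertexClasses, length_dartTable, forall_mem_classes rep_idem, forall_lt_iff]
  refine forall_congr' fun d => ?_
  simp only [rep_eq_iff, List.countP_filter, countP_range_eq_card]
  congr! 2
  ext x
  simp [mem_cyc, and_comm, Equiv.Perm.sameCycle_comm]

end Table


/-! ### Weak labelings as two selection problems -/

namespace Table

/-- The first `k` darts of a face, starting with `a`. -/
def segment (t : List ℕ) (a k : ℕ) : List ℕ := (List.range k).map fun j => iter t j a

/-- Splits the cycle of `a` into its first `k` numbers and the others. -/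
def split (t : List ℕ) (a k i : ℕ) : ℕ :=
  if rep t i = rep t a then (if i ∈ segment t a k then a else iter t k a) else rep t i

/-- The classes of darts at the same face, the one of `a` being split into two classes, which
demand one dart each; the others demand two darts. -/
def splitClasses (t : List ℕ) (a k : ℕ) : List (List ℕ × ℕ) :=
  classes t.length (split t a k) fun c => if rep t c = rep t a then 1 else 2

/-- Decides whether the `k`th dart after `a` along its face yields a certificate. -/
def WeakCandidate (t : List ℕ) (o a k : ℕ) : Prop :=
  (rep (faces t) a = rep (faces t) o ∧ ¬ rep t a = rep t (iter (faces t) k a) ∧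
    ¬ iter (faces t) k a ∈ segment (faces t) a k) ∧
  Selection.solvable (pairs (t.length / 2)) (vertexClasses t a (iter (faces t) k a)) = true ∧
    Selection.solvable (pairs (t.length / 2)) (splitClasses (faces t) a k) = true

instance (t : List ℕ) (o a k : ℕ) : Decidable (WeakCandidate t o a k) := by
  unfold WeakCandidate
  infer_instance

/-- Decides whether a plane graph, given by a table and a dart of the outer face, admits a weak
labeling. -/
def weak (t : List ℕ) (o : ℕ) : Bool :=
  decide (∃ a ∈ List.range t.length, ∃ k ∈ List.range t.length, WeakCandidate t o a k)

variable {m : ℕ}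

theorem mem_segment {f : Equiv.Perm (Fin m × Bool)} {a x : Fin m × Bool} {k : ℕ} :
    dartNumber x ∈ segment (dartTable f) (dartNumber a) k ↔ ∃ j < k, f^[j] a = x := by
  simp [segment, iter_dartTable, dartNumber_injective.eq_iff]

theorem sameCycle_iterate {f : Equiv.Perm (Fin m × Bool)} (a : Fin m × Bool) (k : ℕ) :
    f.SameCycle a (f^[k] a) := mem_cyc.1 (iterate_mem_cyc a k)

theorem rep_split {f : Equiv.Perm (Fin m × Bool)} (a d : Fin m × Bool) (k : ℕ) :
    rep (dartTable f) (split (dartTable f) (dartNumber a) k (dartNumber d)) =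
      rep (dartTable f) (dartNumber d) := by
  rw [split, iter_dartTable]
  split_ifs with h₁ h₂
  · exact h₁.symm
  · rw [h₁, rep_eq_iff]
    exact (sameCycle_iterate a k).symm
  · exact rep_rep (dartNumber_lt d)

/-- On other cycles `split` is `rep`. On the cycle of `a` it takes only the two values `a` and
`f^[k] a`, and `hab` is what keeps them apart. -/
theorem split_eq_iff {f : Equiv.Perm (Fin m × Bool)} {a d x : Fin m × Bool} {k : ℕ}
    (hab : a ≠ f^[k] a) :
    split (dartTable f) (dartNumber a) k (dartNumber d) =
        split (dartTable f) (dartNumber a) k (dartNumber x) ↔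
      f.SameCycle d x ∧ (f.SameCycle d a → ((∃ j < k, f^[j] a = d) ↔ ∃ j < k, f^[j] a = x)) := by
  constructor
  · intro h
    have hdx : f.SameCycle d x := by
      rw [← rep_eq_iff, ← rep_split a d k, h, rep_split]
    refine ⟨hdx, fun hda => ?_⟩
    rw [split, split, if_pos (rep_eq_iff.2 hda), if_pos (rep_eq_iff.2 (hdx.symm.trans hda)),
      iter_dartTable] at h
    simp only [mem_segment] at h
    have hab' : dartNumber a ≠ dartNumber (f^[k] a) := dartNumber_injective.ne hab
    by_cases h₁ : ∃ j < k, f^[j] a = d <;> by_cases h₂ : ∃ j < k, f^[j] a = x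
    · exact iff_of_true h₁ h₂
    · rw [if_pos h₁, if_neg h₂] at h
      exact (hab' h).elim
    · rw [if_neg h₁, if_pos h₂] at h
      exact (hab' h.symm).elim
    · exact iff_of_false h₁ h₂
  · rintro ⟨hdx, h⟩
    by_cases hda : f.SameCycle d a
    · rw [split, split, if_pos (rep_eq_iff.2 hda), if_pos (rep_eq_iff.2 (hdx.symm.trans hda))]
      simp only [mem_segment, h hda]
    · rw [split, split, if_neg (mt rep_eq_iff.1 hda),
        if_neg (mt rep_eq_iff.1 fun h => hda (hdx.trans h)), rep_eq_iff.2 hdx]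

/-- The two representatives lie in their own parts: `a` is in the segment because `0 < k`, and
`f^[k] a` is outside by `hb`. -/
theorem split_idem {f : Equiv.Perm (Fin m × Bool)} {a : Fin m × Bool} {k : ℕ} (hk : 0 < k)
    (hab : a ≠ f^[k] a) (hb : ¬ ∃ j < k, f^[j] a = f^[k] a) : ∀ i < 2 * m,
      split (dartTable f) (dartNumber a) k i < 2 * m ∧
        split (dartTable f) (dartNumber a) k (split (dartTable f) (dartNumber a) k i) =
          split (dartTable f) (dartNumber a) k i := by
  rw [forall_lt_iff]
  intro d
  obtain ⟨x, hx, hdx⟩ : ∃ x, split (dartTable f) (dartNumber a) k (dartNumber d) = dartNumber x ∧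
      (f.SameCycle d a → ((∃ j < k, f^[j] a = x) ↔ ∃ j < k, f^[j] a = d)) := by
    rw [split, iter_dartTable]
    split_ifs with h₁ h₂
    · exact ⟨a, rfl, fun _ => iff_of_true ⟨0, hk, rfl⟩ (mem_segment.1 h₂)⟩
    · exact ⟨_, rfl, fun _ => iff_of_false hb (mt mem_segment.2 h₂)⟩
    · obtain ⟨x, hx, _⟩ := rep_mem (f := f) d
      exact ⟨x, hx, fun h => (h₁ (rep_eq_iff.2 h)).elim⟩
  have hc : f.SameCycle d x := by
    rw [← rep_eq_iff, ← hx, rep_split]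
  refine ⟨hx ▸ dartNumber_lt x, ?_⟩
  conv_lhs => rw [hx]
  exact (split_eq_iff hab).2 ⟨hc.symm, fun h => hdx (hc.trans h)⟩

-- A cycle other than that of `a` is a single class. The two parts of the cycle of `a` are the
-- classes of `a` and of `f^[k] a`, at which the forward direction evaluates its hypothesis.
open Classical in
theorem forall_mem_splitClasses {f : Equiv.Perm (Fin m × Bool)} {a : Fin m × Bool} {k : ℕ}
    (hk : 0 < k) (hab : a ≠ f^[k] a) (hb : ¬ ∃ j < k, f^[j] a = f^[k] a) (S : ℕ → Bool) :
    (∀ x ∈ splitClasses (dartTable f) (dartNumber a) k, x.1.countP S = x.2) ↔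
      (∀ d, ¬ f.SameCycle a d →
        ((cyc f d).filter fun x => S (dartNumber x) = true).card = 2) ∧
      ((cyc f a).filter fun x => S (dartNumber x) = true ∧ ∃ j < k, f^[j] a = x).card = 1 ∧
        ((cyc f a).filter fun x => S (dartNumber x) = true ∧ ¬ ∃ j < k, f^[j] a = x).card = 1 := by
  have hcard : ∀ d, ((List.range (2 * m)).filter fun j => decide
      (split (dartTable f) (dartNumber a) k j =
        split (dartTable f) (dartNumber a) k (dartNumber d))).countP S =
      ((cyc f d).filter fun x => S (dartNumber x) = true ∧
        (f.SameCycle d a → ((∃ j < k, f^[j] a = d) ↔ ∃ j < k, f^[j] a = x))).card := by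
    intro d
    rw [List.countP_filter, countP_range_eq_card]
    congr 1
    ext x
    simp only [Finset.mem_filter, Finset.mem_univ, true_and, Bool.and_eq_true, decide_eq_true_eq,
      mem_cyc]
    rw [@eq_comm ℕ (split _ _ _ _), split_eq_iff hab]
    tauto
  rw [splitClasses, length_dartTable, forall_mem_classes (split_idem hk hab hb), forall_lt_iff]
  simp only [hcard, rep_split, rep_eq_iff]
  have haa : f.SameCycle a a := Equiv.Perm.SameCycle.refl _ _
  have hbb : f.SameCycle (f^[k] a) a := (sameCycle_iterate a k).symm
  have ha : ∃ j < k, f^[j] a = a := ⟨0, hk, rfl⟩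
  constructor
  · intro h
    refine ⟨fun d hd => ?_, ?_, ?_⟩
    · have := h d
      rw [if_neg fun h => hd h.symm] at this
      rw [← this]
      congr! 2
      simp [show ¬ f.SameCycle d a from fun h => hd h.symm]
    · have := h a
      rw [if_pos haa] at this
      rw [← this]
      congr! 2
      simp [haa, ha]
    · have := h (f^[k] a)
      rw [if_pos hbb, cyc_eq_of_sameCycle hbb] at this
      rw [← this]
      congr! 2
      simp only [hbb, hb, true_imp_iff, false_iff]
  · rintro ⟨h₁, h₂, h₃⟩ d
    by_cases hd : f.SameCycle d a
    · rw [if_pos hd, cyc_eq_of_sameCycle hd]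
      by_cases hs : ∃ j < k, f^[j] a = d
      · rw [← h₂]
        congr! 2
        simp only [hd, hs, true_imp_iff, true_iff]
      · rw [← h₃]
        congr! 2
        simp only [hd, hs, true_imp_iff, false_iff]
    · rw [if_neg hd, ← h₁ d fun h => hd h.symm]
      congr! 2
      simp [hd]

/-- Selections are functions on all numbers, certificates use functions on darts; values at numbers
of no dart are irrelevant. -/
theorem exists_extend_dartNumber (p : (Fin m × Bool → Bool) → Prop) :
    (∃ S : ℕ → Bool, p fun d => S (dartNumber d)) ↔ ∃ S, p S := by
  constructor
  · rintro ⟨S, h⟩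
    exact ⟨_, h⟩
  · rintro ⟨S, h⟩
    refine ⟨Function.extend dartNumber S fun _ => false, ?_⟩
    convert h using 2 with d
    exact dartNumber_injective.extend_apply _ _ _

theorem flatten_pairs_nodup : (pairs m).flatten.Nodup := by
  rw [flatten_pairs]
  exact List.nodup_range

theorem weak_iff (G : PlaneGraph) :
    weak (dartTable G.next) (dartNumber G.outer) = true ↔ G.AdmitsWeakLabeling := by
  have hhalf : (dartTable G.next).length / 2 = G.numEdges := by rw [length_dartTable]; omega
  rw [weak, decide_eq_true_iff, length_dartTable, exists_lt_iff]
  -- The hypothesis says that `k` is below the period of `a`. It is part of the candidate test, as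
  -- without it the split classes would not be a partition with the right representatives.
  have key : ∀ (a : G.Dart) (k : ℕ), (¬ ∃ j < k, G.faceNext^[j] a = G.faceNext^[k] a) →
      (WeakCandidate (dartTable G.next) (dartNumber G.outer) (dartNumber a) k ↔
        G.WeakCertificate a k) := by
    intro a k hb
    rw [WeakCandidate, faces_dartTable, iter_dartTable, mem_segment, rep_eq_iff, rep_eq_iff,
      ← G.origin_eq_iff, hhalf]
    by_cases hne : G.origin a = G.origin (G.faceNext^[k] a)
    · exact iff_of_false (fun h => h.1.2.1 hne) fun h => h.ne hne
    have hab : a ≠ G.faceNext^[k] a := fun h => hne (congrArg _ h)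
    have hk : 0 < k := by
      rcases Nat.eq_zero_or_pos k with rfl | hk
      · exact (hab rfl).elim
      · exact hk
    rw [Selection.solvable_iff flatten_pairs_nodup, Selection.solvable_iff flatten_pairs_nodup]
    rotate_left
    · rw [flatten_pairs, splitClasses, length_dartTable]
      exact flatten_classes (split_idem hk hab hb) _
    · rw [flatten_pairs, vertexClasses, length_dartTable]
      exact flatten_classes rep_idem _
    simp only [forall_mem_pairs, forall_mem_vertexClasses, forall_mem_splitClasses hk hab hb]
    constructor
    · rintro ⟨⟨ho, -, -⟩, ⟨S, hS₁, hS₂⟩, T, hT₁, hT₂, hT₃, hT₄⟩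
      refine ⟨ho.symm, hne, ⟨_, hS₁, fun d => ?_⟩, _, hT₁, fun d hd => ?_, ?_, ?_⟩
      · rw [hS₂ d]
        simp only [G.origin_eq_iff]
      · exact hT₂ d fun h => hd (ho.symm.trans h)
      · exact hT₃
      · exact hT₄
    · rintro ⟨ho, -, hS, hT⟩
      refine ⟨⟨ho.symm, hne, hb⟩, ?_, ?_⟩
      · rw [← exists_extend_dartNumber] at hS
        obtain ⟨S, hS₁, hS₂⟩ := hS
        refine ⟨S, hS₁, fun d => ?_⟩
        rw [hS₂ d]
        simp only [G.origin_eq_iff]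
      · rw [← exists_extend_dartNumber] at hT
        obtain ⟨T, hT₁, hT₂, hT₃, hT₄⟩ := hT
        exact ⟨T, hT₁, fun d hd => hT₂ d fun h => hd (ho.symm.trans h), hT₃, hT₄⟩
  rw [G.admitsWeakLabeling_iff]
  constructor
  · rintro ⟨a, k, hk, h⟩
    have hb := h.1.2.2
    rw [faces_dartTable, iter_dartTable, mem_segment] at hb
    have hc := (key a k hb).1 h
    rw [← G.admitsWeakLabeling_iff]
    exact hc.admitsWeakLabeling
  · rintro ⟨a, k, hk, h⟩
    refine ⟨a, k, List.mem_range.2 (hk.trans_le (minimalPeriod_le _ _)), (key a k ?_).2 h⟩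
    rintro ⟨j, hj, e⟩
    exact hj.ne (iterate_inj (hj.trans hk) hk e)

end Table


/-! ### Generalized strong labelings as one selection problem -/

namespace Table

/-- The pairs of darts of the same edge, each with an additional element. -/
def triples (m : ℕ) : List (List ℕ) :=
  (List.range m).map fun e => [2 * e, 2 * e + 1] ++ [2 * m + e]

/-- The dart of the edge `e` that starts at its black end. -/
def blackDart (cs : List Bool) (e : ℕ) : ℕ := bif cs.getD e false then 2 * e + 1 else 2 * e

/-- The classes of edges whose darts from black to white are at the same face, with demand two. -/
def blackClasses (t : List ℕ) (cs : List Bool) : List (List ℕ × ℕ) :=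
  ((List.range t.length).filter fun c => decide (rep t c = c)).map fun c =>
    (((List.range (t.length / 2)).filter fun e => decide (rep t (blackDart cs e) = c)).map
      fun e => t.length + e, 2)

/-- Decides whether the darts `a` and `b` yield a certificate. -/
def StrongCandidate (t : List ℕ) (cs : List Bool) (o a b : ℕ) : Prop :=
  (rep (faces t) a = rep (faces t) o ∧ rep (faces t) b = rep (faces t) o ∧ ¬ rep t a = rep t b) ∧
  Selection.solvable (triples (t.length / 2))
    (vertexClasses t a b ++ blackClasses (faces t) cs) = true

instance (t : List ℕ) (cs : List Bool) (o a b : ℕ) : Decidable (StrongCandidate t cs o a b) := by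
  unfold StrongCandidate
  infer_instance

/-- Decides whether a plane graph, given by a table, the colors of the starts of the first darts of
the edges, and a dart of the outer face, admits a generalized strong labeling. -/
def strong (t : List ℕ) (cs : List Bool) (o : ℕ) : Bool :=
  decide (∃ a ∈ List.range t.length, ∃ b ∈ List.range t.length, StrongCandidate t cs o a b)

theorem flatten_triples_perm (m : ℕ) :
    (triples m).flatten.Perm (List.range (2 * m) ++ (List.range m).map (2 * m + ·)) := by
  rw [← flatten_pairs, triples, pairs, ← List.flatMap_def, ← List.flatMap_def,
    List.map_eq_flatMap]
  exact (List.flatMap_append_perm _ _ _).symm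

theorem flatten_triples_nodup (m : ℕ) : (triples m).flatten.Nodup := by
  rw [(flatten_triples_perm m).nodup_iff, ← List.range_add]
  exact List.nodup_range

section Colors

variable (G : BipartitePlaneGraph)

/-- The colors of the starts of the first darts of the edges. -/
def colors : List Bool := (List.finRange G.numEdges).map fun e => G.white (G.origin (e, false))

/-- The dart of the edge `e` that starts at its black end. -/
def toBlackDart (e : Fin G.numEdges) : G.Dart := (e, G.white (G.origin (e, false)))

theorem blackDart_colors (e : Fin G.numEdges) :
    blackDart (colors G) e = dartNumber (toBlackDart G e) := by
  have h : (colors G).getD e false = G.white (G.origin (e, false)) := by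
    simp [colors, List.getD_eq_getElem?_getD]
  rw [blackDart, h, dartNumber, toBlackDart]
  cases G.white (G.origin (e, false)) <;> rfl

theorem white_origin_eq_false_iff (d : G.Dart) :
    G.white (G.origin d) = false ↔ toBlackDart G d.1 = d := by
  obtain ⟨e, b⟩ := d
  have h : G.white (G.origin (e, true)) = !G.white (G.origin (e, false)) := G.white_rev (e, false)
  rw [toBlackDart, Prod.ext_iff]
  cases b <;> simp [h]

-- Every edge has exactly one dart that starts at its black end, so counting edges by the face of
-- this dart is the same as counting the black darts of that face.
open Classical in
theorem forall_mem_blackClasses (S : ℕ → Bool) :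
    (∀ x ∈ blackClasses (dartTable G.faceNext) (colors G), x.1.countP S = x.2) ↔
      ∀ d, ((cyc G.faceNext d).filter fun x => G.white (G.origin x) = false ∧
        S (2 * G.numEdges + x.1) = true).card = 2 := by
  have hhalf : 2 * G.numEdges / 2 = G.numEdges := by omega
  have hcard : ∀ d : G.Dart, (((List.range G.numEdges).filter fun e => decide
      (rep (dartTable G.faceNext) (blackDart (colors G) e) =
        rep (dartTable G.faceNext) (dartNumber d))).map fun e => 2 * G.numEdges + e).countP S =
      ((cyc G.faceNext d).filter fun x => G.white (G.origin x) = false ∧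
        S (2 * G.numEdges + x.1) = true).card := by
    intro d
    rw [List.countP_map, List.countP_filter, countP_range_eq_card_of_bijective Fin.val_injective
      Fin.is_lt fun i hi => ⟨⟨i, hi⟩, rfl⟩]
    refine Finset.card_bij (fun e _ => toBlackDart G e) (fun e he => ?_)
      (fun e _ e' _ h => congrArg Prod.fst h) fun x hx => ?_
    · rw [Finset.mem_filter, Bool.and_eq_true, decide_eq_true_iff, blackDart_colors,
        rep_eq_iff] at he
      rw [Finset.mem_filter, mem_cyc]
      exact ⟨he.2.2.symm, (white_origin_eq_false_iff G _).2 rfl, he.2.1⟩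
    · rw [Finset.mem_filter, mem_cyc, white_origin_eq_false_iff] at hx
      refine ⟨x.1, ?_, hx.2.1⟩
      rw [Finset.mem_filter, Bool.and_eq_true, decide_eq_true_iff, blackDart_colors, hx.2.1,
        rep_eq_iff]
      exact ⟨Finset.mem_univ _, hx.2.2, hx.1.symm⟩
  simp only [← hcard]
  rw [blackClasses, length_dartTable, hhalf]
  constructor
  · intro h d
    exact h _ (List.mem_map.2 ⟨_, List.mem_filter.2 ⟨List.mem_range.2 (rep_lt (dartNumber_lt d)),
      decide_eq_true (rep_rep (dartNumber_lt d))⟩, rfl⟩)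
  · intro h x hx
    obtain ⟨c, hc, rfl⟩ := List.mem_map.1 hx
    obtain ⟨h₁, h₂⟩ := List.mem_filter.1 hc
    obtain ⟨d, rfl⟩ := exists_dartNumber_eq (List.mem_range.1 h₁)
    have := h d
    rwa [of_decide_eq_true h₂] at this

theorem flatten_blackClasses_perm :
    ((blackClasses (dartTable G.faceNext) (colors G)).map Prod.fst).flatten.Perm
      ((List.range G.numEdges).map (2 * G.numEdges + ·)) := by
  have hhalf : 2 * G.numEdges / 2 = G.numEdges := by omega
  have h := (flatten_map_filter_perm (cs := (List.range (2 * G.numEdges)).filter fun c =>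
      decide (rep (dartTable G.faceNext) c = c)) (l := List.range G.numEdges)
      (g := fun e => rep (dartTable G.faceNext) (blackDart (colors G) e))
      (List.nodup_range.filter _) List.nodup_range fun i hi => ?_).map (2 * G.numEdges + ·)
  · rw [List.map_flatten, List.map_map] at h
    rw [blackClasses, length_dartTable, hhalf, List.map_map]
    exact h
  · have h₁ := blackDart_colors G ⟨i, List.mem_range.1 hi⟩
    simp only at h₁ ⊢
    rw [h₁]
    exact List.mem_filter.2 ⟨List.mem_range.2 (rep_lt (dartNumber_lt _)),
      decide_eq_true (rep_rep (dartNumber_lt _))⟩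

theorem forall_mem_triples (S : ℕ → Bool) {m : ℕ} :
    (∀ l ∈ triples m, l.countP (fun x => !S x) = 1) ↔
      ∀ e : Fin m, [S (dartNumber (e, false)), S (dartNumber (e, true)),
        S (2 * m + e)].count false = 1 := by
  have h : ∀ e, ([2 * e, 2 * e + 1] ++ [2 * m + e]).countP (fun x => !S x) =
      [S (2 * e), S (2 * e + 1), S (2 * m + e)].count false := by
    intro e
    cases h₁ : S (2 * e) <;> cases h₂ : S (2 * e + 1) <;> cases h₃ : S (2 * m + e) <;>
      simp [h₁, h₂, h₃]
  simp only [triples, List.mem_map, List.mem_range, forall_exists_index, and_imp,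
    forall_apply_eq_imp_iff₂, h]
  exact ⟨fun h e => h e e.2, fun h e he => h ⟨e, he⟩⟩

/-- A single selection codes both functions: numbers below `2 * m` stand for darts, the next `m`
numbers for edges. -/
theorem exists_extend_dartNumber_add {m : ℕ} (p : (Fin m × Bool → Bool) → (Fin m → Bool) → Prop) :
    (∃ S : ℕ → Bool, p (fun d => S (dartNumber d)) fun e => S (2 * m + e)) ↔ ∃ S N, p S N := by
  constructor
  · rintro ⟨S, h⟩
    exact ⟨_, _, h⟩
  · rintro ⟨S, N, h⟩
    refine ⟨fun i => if i < 2 * m then Function.extend dartNumber S (fun _ => false) i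
      else if h : i - 2 * m < m then N ⟨i - 2 * m, h⟩ else false, ?_⟩
    convert h using 2 with d e
    · exact (if_pos (dartNumber_lt d)).trans (dartNumber_injective.extend_apply _ _ _)
    · simp

/-- In contrast to the weak case, the triples couple the demands of vertices and faces, so that both
enter the same selection problem. -/
theorem strong_iff : strong (dartTable G.next) (colors G) (dartNumber G.outer) = true ↔
    G.AdmitsGeneralizedStrongLabeling := by
  have hhalf : 2 * G.numEdges / 2 = G.numEdges := by omega
  rw [strong, decide_eq_true_iff, length_dartTable, exists_lt_iff,
    G.admitsGeneralizedStrongLabeling_iff]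
  refine exists_congr fun a => ?_
  rw [exists_lt_iff]
  refine exists_congr fun b => ?_
  rw [StrongCandidate, faces_dartTable, rep_eq_iff, rep_eq_iff, rep_eq_iff, length_dartTable, hhalf,
    Selection.solvable_iff (flatten_triples_nodup _), ← G.origin_eq_iff]
  rotate_left
  · rw [List.map_append, List.flatten_append]
    refine List.Perm.trans (List.Perm.append ?_ (flatten_blackClasses_perm G))
      (flatten_triples_perm _).symm
    rw [vertexClasses, length_dartTable]
    exact flatten_classes rep_idem _
  simp only [List.mem_append, or_imp, forall_and, forall_mem_triples, forall_mem_vertexClasses,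
    forall_mem_blackClasses]
  have hext := exists_extend_dartNumber_add (m := G.numEdges) fun S N =>
    (∀ e, [S (e, false), S (e, true), N e].count false = 1) ∧
      (∀ d, ((cyc G.next d).filter fun x => S x = true).card =
        open Classical in if G.next.SameCycle d a ∨ G.next.SameCycle d b then 0 else 2) ∧
      ∀ d, (open Classical in (cyc G.faceNext d).filter fun x =>
        G.white (G.origin x) = false ∧ N x.1 = true).card = 2
  constructor
  · rintro ⟨⟨h₁, h₂, h₃⟩, h⟩
    refine ⟨h₁.symm, h₂.symm, h₃, ?_⟩
    simp only [G.origin_eq_iff]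
    exact hext.1 h
  · rintro ⟨h₁, h₂, h₃, h⟩
    simp only [G.origin_eq_iff] at h
    exact ⟨⟨h₁.symm, h₂.symm, h₃⟩, hext.2 h⟩

end Colors

end Table


/-! ### Polynomial time of the decision procedures -/

namespace PolyTime

variable {α : Type} [Enc α]

theorem classes {n : α → ℕ} {v dem : α → ℕ → ℕ} (hn : PolyTime n)
    (hv : PolyTime fun x : α × ℕ => v x.1 x.2) (hdem : PolyTime fun x : α × ℕ => dem x.1 x.2) :
    PolyTime fun a => Table.classes (n a) (v a) (dem a) :=
  map (g := fun a c => ((List.range (n a)).filter fun i => decide (v a i = c), dem a c))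
    (pair (filter (c := fun (x : α × ℕ) i => decide (v x.1 i = x.2))
      (decide_eq (hv.comp (pair (fst.comp fst) snd)) (snd.comp fst)) (range (hn.comp fst))) hdem)
    (filter (c := fun a c => decide (v a c = c)) (decide_eq hv snd) (range hn))

theorem vertexClasses {t : α → List ℕ} {i j : α → ℕ} (ht : PolyTime t) (hi : PolyTime i)
    (hj : PolyTime j) : PolyTime fun a => Table.vertexClasses (t a) (i a) (j a) :=
  classes (v := fun a => Table.rep (t a))
    (dem := fun a c => if c = Table.rep (t a) (i a) ∨ c = Table.rep (t a) (j a) then 0 else 2)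
    (length ht) (table_rep (ht.comp fst) snd)
    (ite (decide_or (decide_eq snd ((table_rep ht hi).comp fst))
      (decide_eq snd ((table_rep ht hj).comp fst))) (const 0) (const 2))

theorem pairs {m : α → ℕ} (hm : PolyTime m) : PolyTime fun a => Table.pairs (m a) :=
  map (g := fun _ e => [2 * e, 2 * e + 1])
    (cons ((const 2).mul snd) (cons ((const 2).mul snd).succ (const []))) (range hm)

theorem triples {m : α → ℕ} (hm : PolyTime m) : PolyTime fun a => Table.triples (m a) :=
  map (g := fun a e => [2 * e, 2 * e + 1] ++ [2 * m a + e])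
    (append (cons ((const 2).mul snd) (cons ((const 2).mul snd).succ (const [])))
      (cons (((const 2).mul (hm.comp fst)).add snd) (const []))) (range hm)

theorem segment {t : α → List ℕ} {i k : α → ℕ} (ht : PolyTime t) (hi : PolyTime i)
    (hk : PolyTime k) : PolyTime fun a => Table.segment (t a) (i a) (k a) :=
  map (g := fun a j => Table.iter (t a) j (i a)) (table_iter (ht.comp fst) snd (hi.comp fst))
    (range hk)

theorem splitClasses {t : α → List ℕ} {i k : α → ℕ} (ht : PolyTime t) (hi : PolyTime i)
    (hk : PolyTime k) : PolyTime fun a => Table.splitClasses (t a) (i a) (k a) := by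
  have hrep : PolyTime fun x : α × ℕ => Table.rep (t x.1) x.2 := table_rep (ht.comp fst) snd
  have hout : PolyTime fun x : α × ℕ =>
      decide (Table.rep (t x.1) x.2 = Table.rep (t x.1) (i x.1)) :=
    decide_eq hrep ((table_rep ht hi).comp fst)
  exact classes (v := fun a => Table.split (t a) (i a) (k a))
    (dem := fun a c => if Table.rep (t a) c = Table.rep (t a) (i a) then 1 else 2)
    (length ht)
    (ite (c := fun x : α × ℕ => Table.rep (t x.1) x.2 = Table.rep (t x.1) (i x.1)) hout
      (ite (c := fun x : α × ℕ => x.2 ∈ Table.segment (t x.1) (i x.1) (k x.1))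
        (decide_mem snd ((segment ht hi hk).comp fst)) (hi.comp fst)
        ((table_iter ht hk hi).comp fst)) hrep)
    (ite (c := fun x : α × ℕ => Table.rep (t x.1) x.2 = Table.rep (t x.1) (i x.1)) hout
      (const 1) (const 2))

theorem blackClasses {t : α → List ℕ} {cs : α → List Bool} (ht : PolyTime t) (hcs : PolyTime cs) :
    PolyTime fun a => Table.blackClasses (t a) (cs a) := by
  have hdart : PolyTime fun x : (α × ℕ) × ℕ => Table.blackDart (cs x.1.1) x.2 :=
    cond (getD (hcs.comp (fst.comp fst)) snd false) ((const 2).mul snd).succ ((const 2).mul snd)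
  exact map (g := fun a c => (((List.range ((t a).length / 2)).filter fun e =>
      decide (Table.rep (t a) (Table.blackDart (cs a) e) = c)).map fun e => (t a).length + e, 2))
    (pair (map (g := fun (x : α × ℕ) e => (t x.1).length + e)
      (((length ht).comp (fst.comp fst)).add snd)
      (filter (c := fun (x : α × ℕ) e =>
          decide (Table.rep (t x.1) (Table.blackDart (cs x.1) e) = x.2))
        (decide_eq (table_rep (ht.comp (fst.comp fst)) hdart) (snd.comp fst))
        (range ((length ht).half.comp fst)))) (const 2))
    (filter (c := fun a c => decide (Table.rep (t a) c = c))
      (decide_eq (table_rep (ht.comp fst) snd) snd) (range (length ht)))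

theorem weak {t : α → List ℕ} {o : α → ℕ} (ht : PolyTime t) (ho : PolyTime o) :
    PolyTime fun a => Table.weak (t a) (o a) := by
  have ht' : PolyTime fun x : (α × ℕ) × ℕ => t x.1.1 := ht.comp (fst.comp fst)
  have hf : PolyTime fun x : (α × ℕ) × ℕ => Table.faces (t x.1.1) := table_faces ht'
  have ha : PolyTime fun x : (α × ℕ) × ℕ => x.1.2 := snd.comp fst
  have hb : PolyTime fun x : (α × ℕ) × ℕ => Table.iter (Table.faces (t x.1.1)) x.2 x.1.2 :=
    table_iter hf snd ha
  have hp := pairs (length ht').half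
  have h : PolyTime fun x : (α × ℕ) × ℕ =>
      decide (Table.WeakCandidate (t x.1.1) (o x.1.1) x.1.2 x.2) := by
    refine (((decide_eq (table_rep hf ha) (table_rep hf (ho.comp (fst.comp fst)))).decide_and
      ((decide_eq (table_rep ht' ha) (table_rep ht' hb)).decide_not.decide_and
        (decide_mem hb (segment hf ha snd)).decide_not)).and
      ((solvable hp (vertexClasses ht' ha hb)).and
        (solvable hp (splitClasses hf ha snd)))).congr_enc fun x => congrArg _ ?_
    rw [Bool.eq_iff_iff, decide_eq_true_iff, Bool.and_eq_true, Bool.and_eq_true, decide_eq_true_iff]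
    rfl
  exact decide_exists_mem (c := fun a i => ∃ k ∈ List.range (t a).length,
      Table.WeakCandidate (t a) (o a) i k)
    (decide_exists_mem (c := fun (x : α × ℕ) k => Table.WeakCandidate (t x.1) (o x.1) x.2 k) h
      ((range (length ht)).comp fst)) (range (length ht))

theorem strong {t : α → List ℕ} {cs : α → List Bool} {o : α → ℕ} (ht : PolyTime t)
    (hcs : PolyTime cs) (ho : PolyTime o) : PolyTime fun a => Table.strong (t a) (cs a) (o a) := by
  have ht' : PolyTime fun x : (α × ℕ) × ℕ => t x.1.1 := ht.comp (fst.comp fst)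
  have ho' : PolyTime fun x : (α × ℕ) × ℕ => o x.1.1 := ho.comp (fst.comp fst)
  have hf : PolyTime fun x : (α × ℕ) × ℕ => Table.faces (t x.1.1) := table_faces ht'
  have ha : PolyTime fun x : (α × ℕ) × ℕ => x.1.2 := snd.comp fst
  have h : PolyTime fun x : (α × ℕ) × ℕ =>
      decide (Table.StrongCandidate (t x.1.1) (cs x.1.1) (o x.1.1) x.1.2 x.2) := by
    refine (((decide_eq (table_rep hf ha) (table_rep hf ho')).decide_and
      ((decide_eq (table_rep hf snd) (table_rep hf ho')).decide_and
        (decide_eq (table_rep ht' ha) (table_rep ht' snd)).decide_not)).and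
      (solvable (triples (length ht').half) (append (vertexClasses ht' ha snd)
        (blackClasses hf (hcs.comp (fst.comp fst)))))).congr_enc fun x => congrArg _ ?_
    rw [Bool.eq_iff_iff, decide_eq_true_iff, Bool.and_eq_true, decide_eq_true_iff]
    rfl
  exact decide_exists_mem (c := fun a i => ∃ j ∈ List.range (t a).length,
      Table.StrongCandidate (t a) (cs a) (o a) i j)
    (decide_exists_mem (c := fun (x : α × ℕ) j =>
        Table.StrongCandidate (t x.1) (cs x.1) (o x.1) x.2 j) h
      ((range (length ht)).comp fst)) (range (length ht))

end PolyTime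

/-! ### Reading the input -/

namespace Parse

/-- One step of reading numbers in unary and colors. The state consists of the number of numbers to
be read before the next color, the part of the current number that has been read, the colors, and
the numbers. -/
def step (s : ℕ × ℕ × List Bool × List ℕ) (b : Bool) : ℕ × ℕ × List Bool × List ℕ :=
  if s.1 = 0 then (2, 0, s.2.2.1 ++ [b], s.2.2.2)
  else bif b then (s.1, s.2.1 + 1, s.2.2.1, s.2.2.2)
  else (s.1 - 1, 0, s.2.2.1, s.2.2.2 ++ [s.2.1])

theorem foldl_unaryCode (p k c : ℕ) (cs : List Bool) (ns : List ℕ) :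
    (unaryCode k).foldl step (p + 1, c, cs, ns) = (p, 0, cs, ns ++ [c + k]) := by
  induction k generalizing c with
  | zero => rfl
  | succ k ih =>
    have : unaryCode (k + 1) = true :: unaryCode k := rfl
    rw [this, List.foldl_cons, show step (p + 1, c, cs, ns) true = (p + 1, c + 1, cs, ns) from rfl,
      ih, add_right_comm, add_assoc]

theorem foldl_flatMap_unaryCode (l : List ℕ) (p : ℕ) (cs : List Bool) (ns : List ℕ) :
    (l.flatMap unaryCode).foldl step (p + l.length, 0, cs, ns) = (p, 0, cs, ns ++ l) := by
  induction l generalizing ns with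
  | nil => simp
  | cons k l ih =>
    rw [List.flatMap_cons, List.foldl_append, List.length_cons, ← add_assoc, foldl_unaryCode, ih]
    simp

theorem foldl_flatMap_color {β : Type} (l : List β) (c : β → Bool) (g h : β → ℕ) (cs : List Bool)
    (ns : List ℕ) :
    (l.flatMap fun e => c e :: (unaryCode (g e) ++ unaryCode (h e))).foldl step (0, 0, cs, ns) =
      (0, 0, cs ++ l.map c, ns ++ l.flatMap fun e => [g e, h e]) := by
  induction l generalizing cs ns with
  | nil => simp
  | cons e l ih =>
    rw [List.flatMap_cons, List.foldl_append, List.foldl_cons, List.foldl_append,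
      show step (0, 0, cs, ns) (c e) = (2, 0, cs ++ [c e], ns) from rfl, foldl_unaryCode,
      foldl_unaryCode, ih]
    simp

/-- The colors and the numbers in the input. -/
def parse (p : ℕ) (l : List Bool) : List Bool × List ℕ := (l.foldl step (p, 0, [], [])).2.2

/-- Without colors the countdown must not run out before the last number. The length of the input is
a safe start, because every number takes at least one bit. -/
theorem parse_encode (G : PlaneGraph) :
    parse G.encode.length G.encode = ([], dartNumber G.outer :: dartTable G.next) := by
  have h : G.encode = (dartNumber G.outer :: dartTable G.next).flatMap unaryCode := by
    simp [PlaneGraph.encode, dartTable, dartCode, dartNumber, List.flatMap_assoc]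
  have hlen : ∀ l : List ℕ, l.length ≤ (l.flatMap unaryCode).length := by
    intro l
    induction l with
    | nil => simp
    | cons k l ih => simp [unaryCode] at ih ⊢; omega
  obtain ⟨p, hp⟩ := Nat.exists_eq_add_of_le' (hlen (dartNumber G.outer :: dartTable G.next))
  rw [h, parse, hp, foldl_flatMap_unaryCode]
  rfl

/-- One number, the outer dart, precedes the first color, and every color resets the countdown to
the two numbers of its edge. -/
theorem parse_encode_bipartite (G : BipartitePlaneGraph) :
    parse 1 G.encode = (Table.colors G, dartNumber G.outer :: dartTable G.next) := by
  rw [parse, BipartitePlaneGraph.encode, List.foldl_append, dartCode, foldl_unaryCode, zero_add]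
  have h := foldl_flatMap_color (List.finRange G.numEdges) (fun e => G.white (G.origin (e, false)))
    (fun e => dartNumber (G.next (e, false))) (fun e => dartNumber (G.next (e, true))) []
    [dartNumber G.outer]
  exact congrArg (fun s => s.2.2) h

end Parse

namespace PolyTime

theorem parse {p : List Bool → ℕ} (hp : PolyTime p) : PolyTime fun l => Parse.parse (p l) l := by
  have h₁ : PolyTime fun x : List Bool × (ℕ × ℕ × List Bool × List ℕ) × Bool => x.2.1.1 :=
    fst.comp (fst.comp snd)
  have h₂ : PolyTime fun x : List Bool × (ℕ × ℕ × List Bool × List ℕ) × Bool => x.2.1.2.1 :=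
    fst.comp (snd.comp (fst.comp snd))
  have h₃ : PolyTime fun x : List Bool × (ℕ × ℕ × List Bool × List ℕ) × Bool => x.2.1.2.2.1 :=
    fst.comp (snd.comp (snd.comp (fst.comp snd)))
  have h₄ : PolyTime fun x : List Bool × (ℕ × ℕ × List Bool × List ℕ) × Bool => x.2.1.2.2.2 :=
    snd.comp (snd.comp (snd.comp (fst.comp snd)))
  refine (snd.comp snd).comp (foldl (h := fun (_ : List Bool) s b => Parse.step s b)
    (s := fun l => (p l, 0, [], []))
    (ite (c := fun x : List Bool × (ℕ × ℕ × List Bool × List ℕ) × Bool => x.2.1.1 = 0)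
      (decide_eq_zero h₁) ((const 2).pair ((const 0).pair
        ((append h₃ (cons (snd.comp snd) (const []))).pair h₄)))
      (cond (snd.comp snd) (h₁.pair (h₂.succ.pair (h₃.pair h₄)))
        (h₁.pred.pair ((const 0).pair (h₃.pair (append h₄ (cons h₂ (const []))))))))
    (hp.pair (const _)) id ⟨20, fun _ s b => ?_⟩)
  obtain ⟨q, c, cs, ns⟩ := s
  have hb := size_bool b
  have ha := size_append cs [b]
  have ha' := size_append ns [c]
  simp only [size_cons, size_nil, size_nat] at ha ha'
  rw [Parse.step]
  simp only [Polynomial.eval_ofNat]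
  split_ifs
  · simp only [size_pair, size_nat]
    omega
  · cases b
    · simp only [size_pair, size_nat, cond_false]
      omega
    · simp only [size_pair, size_nat, cond_true]
      omega

end PolyTime

theorem mainTheorem10 :
    PolyTimeRecognizable PlaneGraph.encode PlaneGraph.AdmitsWeakLabeling ∧
      PolyTimeRecognizable BipartitePlaneGraph.encode
        BipartitePlaneGraph.AdmitsGeneralizedStrongLabeling := by
  have h₁ : PolyTime fun l : List Bool => (Parse.parse l.length l).2 :=
    PolyTime.snd.comp (PolyTime.parse (PolyTime.length PolyTime.id))
  have h₂ : PolyTime fun l : List Bool => Parse.parse 1 l := PolyTime.parse (PolyTime.const 1)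
  refine ⟨PolyTime.polyTimeRecognizable (PolyTime.weak (PolyTime.tail.comp h₁)
      ((PolyTime.headD 0).comp h₁)) fun G => ?_,
    PolyTime.polyTimeRecognizable (PolyTime.strong (PolyTime.tail.comp (PolyTime.snd.comp h₂))
      (PolyTime.fst.comp h₂) ((PolyTime.headD 0).comp (PolyTime.snd.comp h₂))) fun G => ?_⟩
  · rw [Parse.parse_encode]
    exact Table.weak_iff G
  · rw [Parse.parse_encode_bipartite]
    exact Table.strong_iff G
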